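/- Model. Let $\mathbb E$ be a measurable space with a $\sigma$-finite measure $\mu$, and let $f^i_x(\cdot)$, $i=0,1,2$, $x\in\mathbb E$, be jointly measurable nonnegative functions with $\int f^i_x\,d\mu=1$. Let $p_1,p_2\in[0,1)$, $q_i=1-p_i$, $\pi,\rho\in[0,1]$, $\bar\pi=1-\pi$, $\bar\rho=1-\rho$. Fix $x\in\mathbb E$. Under the probability $\mathbf P_x$, $\theta_1,\theta_2$ are random variables with values in $\{0,1,2,\dots\}$ such that $\mathbf P_x(\theta_1=0)=\pi$, $\mathbf P_x(\theta_1=j)=\bar\pi p_1^{j-1}q_1$ for $j\ge1$, and, given $\theta_1=j$, $\theta_2=j$ with probability $\rho$ and $\theta_2=k$ with probability $\bar\rho p_2^{k-j-1}q_2$ for $k>j$. The observed $\mathbb E$-valued sequence $(X_n)_{n\ge0}$ has $X_0=x$ and, given $\theta_1=j,\theta_2=k$, is a Markov chain in which the transition from $X_n$ to $X_{n+1}$ has the $\mu$-density $f^0_{X_n}$ if $n+1<j$, $f^1_{X_n}$ if $j\le n+1<k$, and $f^2_{X_n}$ if $n+1\ge k$ (and $n+1\ge j$). Put $\mathcal F_n=\sigma(X_0,\dots,X_n)$,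 $\Pi^i_n=\mathbf P_x(\theta_i\le n\mid\mathcal F_n)$ for $i=1,2$, $\Pi^{12}_n=\mathbf P_x(\theta_1=\theta_2>n\mid\mathcal F_n)$ and $\overrightarrow\Pi_n=(\Pi^1_n,\Pi^2_n,\Pi^{12}_n)$ (any $\mathcal F_n$-measurable versions). The problem is to maximise $\mathbf P_x(\tau<\infty,\ \theta_1\le\tau<\theta_2)$ over all $(\mathcal F_n)$-stopping times $\tau$ with values in $\{0,1,\dots,\infty\}$. Notation. For $\vec\alpha=(\alpha,\beta,\gamma)$ let $$\mathbf H(x,y,\vec\alpha)=(1-\alpha)p_1f^0_x(y)+[p_2(\alpha-\beta)+q_1(1-\alpha-\gamma)]f^1_x(y)+[q_2\alpha+p_2\beta+q_1\gamma]f^2_x(y),$$ $$\overrightarrow\Pi_1(x,y,\vec\alpha)=\Bigl(1-\tfrac{p_1(1-\alpha)f^0_x(y)}{\mathbf H(x,y,\vec\alpha)},\ \tfrac{(q_2\alpha+p_2\beta+q_1\gamma)f^2_x(y)}{\mathbf H(x,y,\vec\alpha)},\ \tfrac{p_1\gamma f^0_x(y)}{\mathbf H(x,y,\vec\alpha)}\Bigr)$$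 (with $0/0=0$). States are the $(y,z,\vec\alpha)\in\mathbb E^2\times[0,1]^3$ with $0\le\beta\le\alpha$, $0\le\gamma\le1-\alpha$. Let $h(y,z,\vec\alpha)=\alpha-\beta$, $\mathbf Tv(y,z,\vec\alpha)=\int_{\mathbb E}v(z,u,\overrightarrow\Pi_1(z,u,\vec\alpha))\mathbf H(z,u,\vec\alpha)\mu(du)$, $\mathbf Qv=\max\{v,\mathbf Tv\}$ and $h^*=\lim_k\mathbf Q^kh$. For functions $R,S$ on the states let $B(R,S)$ be the set of the states with $$\alpha-\beta\ \ge\ (1-\alpha-\gamma)\Bigl[p_1\!\int_{\mathbb E}\! R(z,u,\overrightarrow\Pi_1(z,u,\vec\alpha))f^0_z(u)\mu(du)+q_1\!\int_{\mathbb E}\! S(z,u,\overrightarrow\Pi_1(z,u,\vec\alpha))f^1_z(u)\mu(du)\Bigr]+(\alpha-\beta)p_2\!\int_{\mathbb E}\! S(z,u,\overrightarrow\Pi_1(z,u,\vec\alpha))f^1_z(u)\mu(du).$$ Let $R^1=0$, $S^1=1$, $\mathcal R_k=B(R^k,S^k)$ and $$R^{k+1}(y,z,\vec\alpha)=(1-\mathbb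 I_{\mathcal R_k})\Bigl(p_1\!\int_{\mathbb E}\! R^k(z,u,\overrightarrow\Pi_1(z,u,\vec\alpha))f^0_z(u)\mu(du)+q_1\!\int_{\mathbb E}\! S^k(z,u,\overrightarrow\Pi_1(z,u,\vec\alpha))f^1_z(u)\mu(du)\Bigr),$$ $$S^{k+1}(y,z,\vec\alpha)=\mathbb I_{\mathcal R_k}+(1-\mathbb I_{\mathcal R_k})\,p_2\!\int_{\mathbb E}\! S^k(z,u,\overrightarrow\Pi_1(z,u,\vec\alpha))f^1_z(u)\mu(du).$$ Theorem. (a) $\mathbf T$ is the transition operator of the system: $\mathbf E_x(v(X_{n+1},X_{n+2},\overrightarrow\Pi_{n+2})\mid\mathcal F_{n+1})=\mathbf Tv(X_n,X_{n+1},\overrightarrow\Pi_{n+1})$ a.s. for all $n\ge0$ and all measurable $v$ with values in $[0,1]$. On the states the limits $h^*$, $R^*=\lim_kR^k$ and $S^*=\lim_kS^k$ exist, $\mathcal R_k=\{h\ge\mathbf T\mathbf Q^{k-1}h\}$ for all $k\ge1$, and $\{h\ge h^*\}=B^*$, where $B^*=B(R^*,S^*)$. Consequently $\inf\{n\ge0:h(X_n,X_{n+1},\overrightarrow\Pi_{n+1})\ge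 h^*(X_n,X_{n+1},\overrightarrow\Pi_{n+1})\}$ is a.s. equal to $$\tau_0^*=\inf\{n\ge0:(X_n,X_{n+1},\overrightarrow\Pi_{n+1})\in B^*\}.$$ The time $\tau_0^*$ is a stopping time of the filtration $(\mathcal F_{n+1})_{n\ge0}$ and is optimal for the system $(X_n,X_{n+1},\overrightarrow\Pi_{n+1})_{n\ge0}$ with payoff $h$: it maximises $\mathbf E_x[\mathbb I_{\{\sigma<\infty\}}h(X_\sigma,X_{\sigma+1},\overrightarrow\Pi_{\sigma+1})]$ over all $(\mathcal F_{n+1})_{n\ge0}$-stopping times $\sigma$. (b) The optimal value $\max_\tau\mathbf P_x(\tau<\infty,\theta_1\le\tau<\theta_2)$ is $V(x)=\max\{\pi\bar\rho,V_0(x)\}$, where, with $\vec\pi=(\pi,\rho\pi,\rho\bar\pi)$, $$V_0(x)=\bar\pi\bar\rho\Bigl[p_1\!\int_{\mathbb E}\! R^*(x,u,\overrightarrow\Pi_1(x,u,\vec\pi))f^0_x(u)\mu(du)+q_1\!\int_{\mathbb E}\! S^*(x,u,\overrightarrow\Pi_1(x,u,\vec\pi))f^1_x(u)\mu(du)\Bigr]+\pi\bar\rho\,p_2\!\int_{\mathbb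 E}\! S^*(x,u,\overrightarrow\Pi_1(x,u,\vec\pi))f^1_x(u)\mu(du).$$ It is attained by the $(\mathcal F_n)$-stopping time $\tau^*$ given by $\tau^*=0$ if $\pi\bar\rho\ge V_0(x)$ and, if $\pi\bar\rho<V_0(x)$, by the rule of (a), that is $\tau^*=\tau_0^*+1$, since the state $(X_n,X_{n+1},\overrightarrow\Pi_{n+1})$ number $n$ is the one observed at time $n+1$. -/

import Mathlib

open MeasureTheory Filter Topology

noncomputable section

namespace TwoDisorders

/-- The known data of the model: the parameters of the a priori law of the two disorder times and
the transition densities `f i x ·` (`i = 0, 1, 2`) of the three segments with respect to `μ`. -/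
structure Params (E : Type*) [MeasurableSpace E] where
  μ : Measure E
  sigmaFinite : SigmaFinite μ
  f : Fin 3 → E → E → ℝ
  f_measurable : ∀ i, Measurable (Function.uncurry (f i))
  f_nonneg : ∀ i x y, 0 ≤ f i x y
  f_integral : ∀ i x, ∫ y, f i x y ∂μ = 1
  p₁ : ℝ
  p₂ : ℝ
  π : ℝ
  ρ : ℝ
  p₁_mem : p₁ ∈ Set.Ico (0 : ℝ) 1
  p₂_mem : p₂ ∈ Set.Ico (0 : ℝ) 1
  π_mem : π ∈ Set.Icc (0 : ℝ) 1
  ρ_mem : ρ ∈ Set.Icc (0 : ℝ) 1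

/-! ### The observed process -/

/-- `σ(X_0, …, X_n)`. -/
@[reducible] def obsSigma {Ω E : Type*} [MeasurableSpace E] (X : ℕ → Ω → E) (n : ℕ) : MeasurableSpace Ω :=
  ⨆ (i : ℕ) (_ : i ≤ n), MeasurableSpace.comap (X i) inferInstance

/-- The filtration `𝓕_n = σ(X_0, …, X_n)` of the observations. -/
def obsFiltration {Ω E : Type*} [m : MeasurableSpace Ω] [MeasurableSpace E] (X : ℕ → Ω → E)
    (hX : ∀ n, Measurable (X n)) : Filtration ℕ m where
  seq := obsSigma X
  mono' := fun _ _ hab =>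
    iSup₂_le fun i hi => le_iSup₂_of_le (f := fun (j : ℕ) (_ : j ≤ _) =>
      MeasurableSpace.comap (X j) inferInstance) i (hi.trans hab) le_rfl
  le' := fun _ => iSup₂_le fun i _ => (hX i).comap_le

/-- The filtration `n ↦ 𝓕_{n+1}`. -/
def shiftFiltration {Ω : Type*} {m : MeasurableSpace Ω} (F : Filtration ℕ m) : Filtration ℕ m where
  seq := fun n => F (n + 1)
  mono' := fun _ _ hab => F.mono (Nat.succ_le_succ hab)
  le' := fun n => F.le (n + 1)

namespace Params

variable {E : Type*} [MeasurableSpace E] (M : Params E)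

def q₁ : ℝ := 1 - M.p₁

def q₂ : ℝ := 1 - M.p₂

/-- `P(θ₁ = j)`. -/
def prior₁ (j : ℕ) : ℝ := if j = 0 then M.π else (1 - M.π) * M.p₁ ^ (j - 1) * M.q₁

/-- `P(θ₂ = k ∣ θ₁ = j)`. -/
def prior₂ (j k : ℕ) : ℝ :=
  if k = j then M.ρ else if j < k then (1 - M.ρ) * M.p₂ ^ (k - j - 1) * M.q₂ else 0

/-- The segment to which the observation number `n` belongs if `θ₁ = j` and `θ₂ = k`. -/
def segment (j k n : ℕ) : Fin 3 := if n < j then 0 else if n < k then 1 else 2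

/-- `P` is the law `P_x` of the switched sequence: `X_0 = x`, the disorder times have the a priori
law, and, given `θ₁ = j` and `θ₂ = k`, the sequence `X` is a Markov chain in which the transition
from `X_n` to `X_{n+1}` has the density of the segment of the observation number `n + 1`. -/
structure IsModel {Ω : Type*} [MeasurableSpace Ω] (x : E) (P : Measure Ω) (θ₁ θ₂ : Ω → ℕ)
    (X : ℕ → Ω → E) : Prop where
  measurable_θ₁ : Measurable θ₁
  measurable_θ₂ : Measurable θ₂
  start : ∀ᵐ ω ∂P, X 0 ω = x
  prior : ∀ j k, P {ω | θ₁ ω = j ∧ θ₂ ω = k} = ENNReal.ofReal (M.prior₁ j * M.prior₂ j k)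
  transition : ∀ (n j k : ℕ) (A : Set Ω), MeasurableSet[obsSigma X n] A →
    ∀ B : Set E, MeasurableSet B →
      P (A ∩ {ω | θ₁ ω = j ∧ θ₂ ω = k} ∩ X (n + 1) ⁻¹' B) =
        ∫⁻ ω in A ∩ {ω | θ₁ ω = j ∧ θ₂ ω = k},
          (∫⁻ u in B, ENNReal.ofReal (M.f (segment j k (n + 1)) (X n ω) u) ∂M.μ) ∂P

/-! ### Posterior probabilities and the Markov system -/

/-- The function `H(x, y, α, β, γ)`. -/
def H (x y : E) (a : ℝ × ℝ × ℝ) : ℝ :=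
  (1 - a.1) * M.p₁ * M.f 0 x y
    + (M.p₂ * (a.1 - a.2.1) + M.q₁ * (1 - a.1 - a.2.2)) * M.f 1 x y
    + (M.q₂ * a.1 + M.p₂ * a.2.1 + M.q₁ * a.2.2) * M.f 2 x y

/-- The update `(Π¹, Π², Π¹²)(x, y, α, β, γ)` of the posterior probabilities. -/
def post (x y : E) (a : ℝ × ℝ × ℝ) : ℝ × ℝ × ℝ :=
  (1 - M.p₁ * (1 - a.1) * M.f 0 x y / M.H x y a,
   (M.q₂ * a.1 + M.p₂ * a.2.1 + M.q₁ * a.2.2) * M.f 2 x y / M.H x y a,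
   M.p₁ * a.2.2 * M.f 0 x y / M.H x y a)

/-- The prior values `(π, ρπ, ρ(1 - π))` of the three posterior probabilities. -/
def init : ℝ × ℝ × ℝ := (M.π, M.ρ * M.π, M.ρ * (1 - M.π))

end Params

/-- `Ψ n` is a version of `(P(θ₁ ≤ n ∣ 𝓕_n), P(θ₂ ≤ n ∣ 𝓕_n), P(θ₁ = θ₂ > n ∣ 𝓕_n))`. -/
structure IsPosterior {Ω : Type*} {m : MeasurableSpace Ω} (P : Measure Ω) (F : Filtration ℕ m)
    (θ₁ θ₂ : Ω → ℕ) (Ψ : ℕ → Ω → ℝ × ℝ × ℝ) : Prop where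
  adapted : ∀ n, Measurable[F n] (Ψ n)
  fst : ∀ n, (fun ω => (Ψ n ω).1) =ᵐ[P]
    P[Set.indicator {ω | θ₁ ω ≤ n} (fun _ => (1 : ℝ)) | F n]
  snd : ∀ n, (fun ω => (Ψ n ω).2.1) =ᵐ[P]
    P[Set.indicator {ω | θ₂ ω ≤ n} (fun _ => (1 : ℝ)) | F n]
  trd : ∀ n, (fun ω => (Ψ n ω).2.2) =ᵐ[P]
    P[Set.indicator {ω | θ₁ ω = θ₂ ω ∧ n < θ₁ ω} (fun _ => (1 : ℝ)) | F n]

/-- A state `(y, z, α, β, γ)`: the last two observations and the three posterior probabilities. -/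
abbrev State (E : Type*) := E × E × ℝ × ℝ × ℝ

/-- The states whose last three coordinates are possible values of the posterior probabilities of
`θ₁ ≤ n`, `θ₂ ≤ n` and `θ₁ = θ₂ > n`. -/
def stateSpace (E : Type*) : Set (State E) :=
  {s | 0 ≤ s.2.2.2.1 ∧ s.2.2.2.1 ≤ s.2.2.1 ∧ 0 ≤ s.2.2.2.2 ∧ s.2.2.2.2 ≤ 1 - s.2.2.1}

/-- The Markov system `n ↦ (X_n, X_{n+1}, Ψ_{n+1})`. -/
def system {Ω E : Type*} (X : ℕ → Ω → E) (Ψ : ℕ → Ω → ℝ × ℝ × ℝ) (n : ℕ) (ω : Ω) : State E :=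
  (X n ω, X (n + 1) ω, Ψ (n + 1) ω)

/-- The payoff function `h(y, z, α, β, γ) = α - β`. -/
def payoff {E : Type*} (s : State E) : ℝ := s.2.2.1 - s.2.2.2.1

/-- The payoff collected along the system `S` at the random time `τ`; it is `0` if `τ = ∞`. -/
def stoppedPayoff {Ω E : Type*} (S : ℕ → Ω → State E) (τ : Ω → WithTop ℕ) : Ω → ℝ :=
  Set.indicator {ω | τ ω ≠ ⊤} (stoppedValue (fun n ω => payoff (S n ω)) τ)

/-- The event `{τ < ∞, θ₁ ≤ τ < θ₂}`. -/
def success {Ω : Type*} (θ₁ θ₂ : Ω → ℕ) (τ : Ω → WithTop ℕ) : Set Ω :=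
  {ω | τ ω < ⊤ ∧ (θ₁ ω : WithTop ℕ) ≤ τ ω ∧ τ ω < (θ₂ ω : WithTop ℕ)}

namespace Params

variable {E : Type*} [MeasurableSpace E] (M : Params E)

/-! ### Optimal stopping operators -/

/-- The transition operator of the Markov system: from `(y, z, α)` it moves to
`(z, u, post z u α)`, and the new observation `u` has the density `H(z, u, α)`. -/
def T (v : State E → ℝ) (s : State E) : ℝ :=
  ∫ u, v (s.2.1, u, M.post s.2.1 u s.2.2) * M.H s.2.1 u s.2.2 ∂M.μ

def Q (v : State E → ℝ) (s : State E) : ℝ := max (v s) (M.T v s)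

/-- `h* = lim Q^k h`. -/
def hStar (s : State E) : ℝ := limUnder atTop fun k : ℕ => (M.Q)^[k] payoff s

/-! ### The functions `R`, `S` and the stopping sets -/

/-- `∫ g(z, u, post z u α) f^i_z(u) μ(du)`. -/
def integ (i : Fin 3) (g : State E → ℝ) (z : E) (a : ℝ × ℝ × ℝ) : ℝ :=
  ∫ u, g (z, u, M.post z u a) * M.f i z u ∂M.μ

/-- The set of the states `(y, z, α, β, γ)` with
`α - β ≥ (1 - α - γ) (p₁ ∫ R f⁰ + q₁ ∫ S f¹) + (α - β) p₂ ∫ S f¹`. -/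
def stopRegion (R S : State E → ℝ) : Set (State E) :=
  {s | s ∈ stateSpace E ∧
    (1 - s.2.2.1 - s.2.2.2.2) *
        (M.p₁ * M.integ 0 R s.2.1 s.2.2 + M.q₁ * M.integ 1 S s.2.1 s.2.2)
      + (s.2.2.1 - s.2.2.2.1) * (M.p₂ * M.integ 1 S s.2.1 s.2.2)
    ≤ s.2.2.1 - s.2.2.2.1}

open Classical in
/-- The pair `(R^{k+1}, S^{k+1})`; the numbering of the functions begins with
`R^1 = 0` and `S^1 = 1`. -/
def RS : ℕ → (State E → ℝ) × (State E → ℝ)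
  | 0 => (fun _ => 0, fun _ => 1)
  | k + 1 =>
    (fun s => if s ∈ M.stopRegion (RS k).1 (RS k).2 then 0 else
        M.p₁ * M.integ 0 (RS k).1 s.2.1 s.2.2 + M.q₁ * M.integ 1 (RS k).2 s.2.1 s.2.2,
     fun s => if s ∈ M.stopRegion (RS k).1 (RS k).2 then 1 else
        M.p₂ * M.integ 1 (RS k).2 s.2.1 s.2.2)

/-- `R^{k+1}`. -/
def R (k : ℕ) : State E → ℝ := (M.RS k).1

/-- `S^{k+1}`. -/
def S (k : ℕ) : State E → ℝ := (M.RS k).2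

/-- The set `𝓡_{k+1}`. -/
def stopSet (k : ℕ) : Set (State E) := M.stopRegion (M.R k) (M.S k)

def RStar (s : State E) : ℝ := limUnder atTop fun k => M.R k s

def SStar (s : State E) : ℝ := limUnder atTop fun k => M.S k s

/-- The set `B*`. -/
def BStar : Set (State E) := M.stopRegion M.RStar M.SStar

/-! ### The value and the optimal time -/

def V₀ (x : E) : ℝ :=
  (1 - M.π) * (1 - M.ρ) *
      (M.p₁ * M.integ 0 M.RStar x M.init + M.q₁ * M.integ 1 M.SStar x M.init)
    + M.π * (1 - M.ρ) * M.p₂ * M.integ 1 M.SStar x M.init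

def V (x : E) : ℝ := max (M.π * (1 - M.ρ)) (M.V₀ x)

/-- The first `n ≥ 0` with `(X_n, X_{n+1}, Ψ_{n+1}) ∈ B*` (`∞` if there is none). -/
def tauZero {Ω : Type*} (X : ℕ → Ω → E) (Ψ : ℕ → Ω → ℝ × ℝ × ℝ) : Ω → WithTop ℕ :=
  hittingAfter (system X Ψ) M.BStar 0

open Classical in
/-- The optimal time for the observed sequence. The state number `n` of the Markov system is known
at time `n + 1`, so that the entry number `tauZero` means stopping at time `tauZero + 1`. -/
def tauStar {Ω : Type*} (x : E) (X : ℕ → Ω → E) (Ψ : ℕ → Ω → ℝ × ℝ × ℝ) (ω : Ω) : WithTop ℕ :=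
  if M.V₀ x ≤ M.π * (1 - M.ρ) then 0 else M.tauZero X Ψ ω + 1

end Params

end TwoDisorders

end

open TwoDisorders

/-!
# Stopping between two disorders

**The value iteration.** On the states, `(Q^k h)(y, z, α, β, γ) = (1 - α - γ) R + (α - β) S` with
the pair `(R, S)` number `k` of the recursion (`Params.iterate_Q_payoff`). This is Bayes' formula:
the posterior weights `1 - α - γ` of `n < θ₁ < θ₂` and `α - β` of `θ₁ ≤ n < θ₂`, multiplied by the
predictive density `H`, evolve linearly (`Params.post_before_mul_H`, `Params.post_between_mul_H`),
so that `T` maps an expression of this form to the right side of the inequality that defines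
`stopRegion` (`Params.T_val`). Where `H` vanishes so do all its summands, and the convention
`0 / 0 = 0` does no harm.

**The limits.** Since `Q^k h` increases, the stopping sets decrease. Hence `S` decreases
(`Params.S_succ_le`). Monotonicity of `R` is not evident, but `R` is the probability `notBefore`
of not stopping before `θ₁` minus the probability of not stopping before `θ₂`, and both increase.
Passing to the limit under the integral gives the Bellman equation for `limVal = h*`
(`Params.limVal_eq_max`), and with it the description of `B*`.

**Filtering.** Given the disorder times, the law of `(X_0, …, X_n)` depends on `(θ₁, θ₂)` only
through the segments of the observations up to `n`. So, given `𝓕_n`, the waiting time for the next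
disorder is geometric on each of the events `n < θ₁ < θ₂`, `n < θ₁ = θ₂`, `θ₁ ≤ n < θ₂`
(`Params.IsModel.measure_inter_image`), and the observation number `n + 1` has the conditional
density `H`; by Bayes' formula `Ψ_{n+1}` is almost surely the value of `post` at `Ψ_n`
(`IsPosterior.ae_eq_post`, `IsPosterior.lintegral_next`). In particular `T` is the transition
operator (`IsPosterior.condExp_system`).

**Optimal stopping.** The process `h*(X_n, X_n, Ψ_n)` is a supermartingale that dominates the
payoff, and a martingale as long as it exceeds it; its mean is at most `P(n < θ₂)`, which tends to
`0`. Hence it bounds the expected payoff of every stopping time, and the first time at which it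
equals the payoff attains the bound (`integral_stoppedSum_le`, `integral_stoppedSum_eq`). As `h*`
does not depend on the first coordinate of the state, this covers time `0` as well, where
`Ψ_0 = (π, ρπ, ρ(1 - π))` and the Bellman equation reads `V = max (π(1 - ρ)) V₀`; the rule then is
to stop at once or to wait for the entry of the system into `B*`.
-/

namespace TwoDisorders

/-! ### The simplex of posterior probabilities -/

/-- The triples `(α, β, γ)` that are possible values of the posterior probabilities. -/
def Adm (a : ℝ × ℝ × ℝ) : Prop := 0 ≤ a.2.1 ∧ a.2.1 ≤ a.1 ∧ 0 ≤ a.2.2 ∧ a.2.2 ≤ 1 - a.1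

theorem mem_stateSpace {E : Type*} {s : State E} : s ∈ stateSpace E ↔ Adm s.2.2 := Iff.rfl

theorem measurableSet_stateSpace {E : Type*} [MeasurableSpace E] :
    MeasurableSet (stateSpace E) := by
  have h1 : MeasurableSet {s : State E | 0 ≤ s.2.2.2.1} :=
    measurableSet_le (by fun_prop) (by fun_prop)
  have h2 : MeasurableSet {s : State E | s.2.2.2.1 ≤ s.2.2.1} :=
    measurableSet_le (by fun_prop) (by fun_prop)
  have h3 : MeasurableSet {s : State E | 0 ≤ s.2.2.2.2} :=
    measurableSet_le (by fun_prop) (by fun_prop)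
  have h4 : MeasurableSet {s : State E | s.2.2.2.2 ≤ 1 - s.2.2.1} :=
    measurableSet_le (by fun_prop) (by fun_prop)
  exact h1.inter (h2.inter (h3.inter h4))

namespace Params

variable {E : Type*} [MeasurableSpace E] (M : Params E)

instance : SigmaFinite M.μ := M.sigmaFinite

theorem p₁_nonneg : 0 ≤ M.p₁ := M.p₁_mem.1
theorem p₂_nonneg : 0 ≤ M.p₂ := M.p₂_mem.1
theorem q₁_nonneg : 0 ≤ M.q₁ := sub_nonneg.2 M.p₁_mem.2.le
theorem q₂_nonneg : 0 ≤ M.q₂ := sub_nonneg.2 M.p₂_mem.2.le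
theorem p₁_add_q₁ : M.p₁ + M.q₁ = 1 := add_sub_cancel _ _
theorem p₂_add_q₂ : M.p₂ + M.q₂ = 1 := add_sub_cancel _ _

theorem integrable_f (i : Fin 3) (z : E) : Integrable (M.f i z) M.μ := by
  by_contra h
  have := M.f_integral i z
  rw [integral_undef h] at this
  exact zero_ne_one this

theorem measurable_f_comp {α : Type*} [MeasurableSpace α] (i : Fin 3) {g h : α → E}
    (hg : Measurable g) (hh : Measurable h) : Measurable fun t => M.f i (g t) (h t) :=
  (M.f_measurable i).comp (hg.prodMk hh)

theorem measurable_H_comp {α : Type*} [MeasurableSpace α] {g h : α → E} {a : α → ℝ × ℝ × ℝ}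
    (hg : Measurable g) (hh : Measurable h) (ha : Measurable a) :
    Measurable fun t => M.H (g t) (h t) (a t) := by
  have h0 := M.measurable_f_comp 0 hg hh
  have h1 := M.measurable_f_comp 1 hg hh
  have h2 := M.measurable_f_comp 2 hg hh
  unfold H
  fun_prop

theorem measurable_post_comp {α : Type*} [MeasurableSpace α] {g h : α → E} {a : α → ℝ × ℝ × ℝ}
    (hg : Measurable g) (hh : Measurable h) (ha : Measurable a) :
    Measurable fun t => M.post (g t) (h t) (a t) := by
  have h0 := M.measurable_f_comp 0 hg hh
  have h2 := M.measurable_f_comp 2 hg hh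
  have hH := M.measurable_H_comp hg hh ha
  unfold post
  fun_prop

theorem adm_init : Adm M.init := by
  obtain ⟨h1, h2⟩ := M.π_mem
  obtain ⟨h3, h4⟩ := M.ρ_mem
  refine ⟨mul_nonneg h3 h1, mul_le_of_le_one_left h1 h4, mul_nonneg h3 (by linarith),
    mul_le_of_le_one_left (by linarith) h4⟩

variable {M} in
theorem weight₀_nonneg {a : ℝ × ℝ × ℝ} (ha : Adm a) : 0 ≤ (1 - a.1) * M.p₁ :=
  mul_nonneg (by linarith [ha.2.2.1, ha.2.2.2]) M.p₁_nonneg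

variable {M} in
theorem weight₁_nonneg {a : ℝ × ℝ × ℝ} (ha : Adm a) :
    0 ≤ M.p₂ * (a.1 - a.2.1) + M.q₁ * (1 - a.1 - a.2.2) :=
  add_nonneg (mul_nonneg M.p₂_nonneg (by linarith [ha.2.1]))
    (mul_nonneg M.q₁_nonneg (by linarith [ha.2.2.2]))

variable {M} in
theorem weight₂_nonneg {a : ℝ × ℝ × ℝ} (ha : Adm a) :
    0 ≤ M.q₂ * a.1 + M.p₂ * a.2.1 + M.q₁ * a.2.2 :=
  add_nonneg (add_nonneg (mul_nonneg M.q₂_nonneg (ha.1.trans ha.2.1))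
    (mul_nonneg M.p₂_nonneg ha.1)) (mul_nonneg M.q₁_nonneg ha.2.2.1)

variable {M}

theorem H_nonneg (x y : E) {a : ℝ × ℝ × ℝ} (ha : Adm a) : 0 ≤ M.H x y a :=
  add_nonneg (add_nonneg (mul_nonneg (weight₀_nonneg ha) (M.f_nonneg _ _ _))
    (mul_nonneg (weight₁_nonneg ha) (M.f_nonneg _ _ _)))
    (mul_nonneg (weight₂_nonneg ha) (M.f_nonneg _ _ _))

/-- If `H` vanishes then so does each of its three nonnegative summands, so that no probability is
lost through the convention `0 / 0 = 0`. -/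
theorem summands_eq_zero {x y : E} {a : ℝ × ℝ × ℝ} (ha : Adm a) (h : M.H x y a = 0) :
    M.p₁ * (1 - a.1) * M.f 0 x y = 0 ∧
    (M.p₂ * (a.1 - a.2.1) + M.q₁ * (1 - a.1 - a.2.2)) * M.f 1 x y = 0 ∧
    (M.q₂ * a.1 + M.p₂ * a.2.1 + M.q₁ * a.2.2) * M.f 2 x y = 0 := by
  have h0 := mul_nonneg (weight₀_nonneg (M := M) ha) (M.f_nonneg 0 x y)
  have h1 := mul_nonneg (weight₁_nonneg (M := M) ha) (M.f_nonneg 1 x y)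
  have h2 := mul_nonneg (weight₂_nonneg (M := M) ha) (M.f_nonneg 2 x y)
  unfold H at h
  refine ⟨?_, ?_, ?_⟩
  · rw [mul_comm M.p₁]; linarith
  · linarith
  · linarith

theorem one_sub_post_fst_mul_H {x y : E} {a : ℝ × ℝ × ℝ} (ha : Adm a) :
    (1 - (M.post x y a).1) * M.H x y a = (1 - a.1) * M.p₁ * M.f 0 x y := by
  by_cases h : M.H x y a = 0
  · rw [h, mul_zero, mul_comm _ M.p₁, (summands_eq_zero ha h).1]
  · simp only [post]; field_simp; ring

theorem post_snd_mul_H {x y : E} {a : ℝ × ℝ × ℝ} (ha : Adm a) :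
    (M.post x y a).2.1 * M.H x y a
      = (M.q₂ * a.1 + M.p₂ * a.2.1 + M.q₁ * a.2.2) * M.f 2 x y := by
  by_cases h : M.H x y a = 0
  · rw [h, mul_zero, (summands_eq_zero ha h).2.2]
  · simp only [post]; field_simp

theorem post_trd_mul_H {x y : E} {a : ℝ × ℝ × ℝ} (ha : Adm a) :
    (M.post x y a).2.2 * M.H x y a = M.p₁ * a.2.2 * M.f 0 x y := by
  by_cases h : M.H x y a = 0
  · have h1 := (summands_eq_zero ha h).1
    have h2 : 0 ≤ M.p₁ * a.2.2 * M.f 0 x y :=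
      mul_nonneg (mul_nonneg M.p₁_nonneg ha.2.2.1) (M.f_nonneg _ _ _)
    have h3 : M.p₁ * a.2.2 * M.f 0 x y ≤ M.p₁ * (1 - a.1) * M.f 0 x y :=
      mul_le_mul_of_nonneg_right (mul_le_mul_of_nonneg_left ha.2.2.2 M.p₁_nonneg)
        (M.f_nonneg _ _ _)
    rw [h, mul_zero]
    linarith
  · simp only [post]; field_simp

/-- The posterior mass of `n < θ₁ < θ₂` after an observation. -/
theorem post_before_mul_H {x y : E} {a : ℝ × ℝ × ℝ} (ha : Adm a) :
    (1 - (M.post x y a).1 - (M.post x y a).2.2) * M.H x y a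
      = M.p₁ * (1 - a.1 - a.2.2) * M.f 0 x y := by
  have h1 := one_sub_post_fst_mul_H (M := M) (x := x) (y := y) ha
  have h2 := post_trd_mul_H (M := M) (x := x) (y := y) ha
  linear_combination h1 - h2

/-- The posterior mass of `θ₁ ≤ n < θ₂` after an observation. -/
theorem post_between_mul_H {x y : E} {a : ℝ × ℝ × ℝ} (ha : Adm a) :
    ((M.post x y a).1 - (M.post x y a).2.1) * M.H x y a
      = (M.p₂ * (a.1 - a.2.1) + M.q₁ * (1 - a.1 - a.2.2)) * M.f 1 x y := by
  have h1 := one_sub_post_fst_mul_H (M := M) (x := x) (y := y) ha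
  have h2 := post_snd_mul_H (M := M) (x := x) (y := y) ha
  have h3 : M.H x y a = (1 - a.1) * M.p₁ * M.f 0 x y
    + (M.p₂ * (a.1 - a.2.1) + M.q₁ * (1 - a.1 - a.2.2)) * M.f 1 x y
    + (M.q₂ * a.1 + M.p₂ * a.2.1 + M.q₁ * a.2.2) * M.f 2 x y := rfl
  linear_combination h3 - h1 - h2

theorem adm_post (x y : E) {a : ℝ × ℝ × ℝ} (ha : Adm a) : Adm (M.post x y a) := by
  rcases (H_nonneg (M := M) x y ha).eq_or_lt with h | h
  · refine ⟨?_, ?_, ?_, ?_⟩ <;> simp [post, ← h]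
  · have key : ∀ t : ℝ, 0 ≤ t * M.H x y a → 0 ≤ t := fun t ht =>
      nonneg_of_mul_nonneg_left ht h
    refine ⟨key _ ?_, sub_nonneg.1 (key _ ?_), key _ ?_, sub_nonneg.1 (key _ ?_)⟩
    · rw [post_snd_mul_H ha]; exact mul_nonneg (weight₂_nonneg ha) (M.f_nonneg _ _ _)
    · rw [post_between_mul_H ha]; exact mul_nonneg (weight₁_nonneg ha) (M.f_nonneg _ _ _)
    · rw [post_trd_mul_H ha]
      exact mul_nonneg (mul_nonneg M.p₁_nonneg ha.2.2.1) (M.f_nonneg _ _ _)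
    · rw [post_before_mul_H ha]
      exact mul_nonneg (mul_nonneg M.p₁_nonneg (by linarith [ha.2.2.2])) (M.f_nonneg _ _ _)

theorem integrable_H (x : E) (a : ℝ × ℝ × ℝ) : Integrable (fun u => M.H x u a) M.μ :=
  (((M.integrable_f 0 x).const_mul _).add ((M.integrable_f 1 x).const_mul _)).add
    ((M.integrable_f 2 x).const_mul _)

theorem integral_H {z : E} {a : ℝ × ℝ × ℝ} : ∫ u, M.H z u a ∂M.μ = 1 := by
  have h0 := (M.integrable_f 0 z).const_mul ((1 - a.1) * M.p₁)
  have h1 := (M.integrable_f 1 z).const_mul (M.p₂ * (a.1 - a.2.1) + M.q₁ * (1 - a.1 - a.2.2))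
  have h2 := (M.integrable_f 2 z).const_mul (M.q₂ * a.1 + M.p₂ * a.2.1 + M.q₁ * a.2.2)
  have h01 : Integrable (fun u => (1 - a.1) * M.p₁ * M.f 0 z u
    + (M.p₂ * (a.1 - a.2.1) + M.q₁ * (1 - a.1 - a.2.2)) * M.f 1 z u) M.μ := h0.add h1
  simp only [H]
  rw [integral_add h01 h2, integral_add h0 h1, integral_const_mul, integral_const_mul,
    integral_const_mul, M.f_integral, M.f_integral, M.f_integral]
  linear_combination (1 - a.1) * M.p₁_add_q₁ + a.1 * M.p₂_add_q₂

theorem lintegral_H_mul_eq_add {a : ℝ × ℝ × ℝ} (ha : Adm a) (z : E)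
    {φ : E → ENNReal} (hφ : Measurable φ) :
    ∫⁻ u, ENNReal.ofReal (M.H z u a) * φ u ∂M.μ
      = ∫⁻ u, ENNReal.ofReal ((1 - a.1) * M.p₁) * ENNReal.ofReal (M.f 0 z u) * φ u ∂M.μ
        + (∫⁻ u, ENNReal.ofReal (M.p₂ * (a.1 - a.2.1) + M.q₁ * (1 - a.1 - a.2.2))
            * ENNReal.ofReal (M.f 1 z u) * φ u ∂M.μ
          + ∫⁻ u, ENNReal.ofReal (M.q₂ * a.1 + M.p₂ * a.2.1 + M.q₁ * a.2.2)
            * ENNReal.ofReal (M.f 2 z u) * φ u ∂M.μ) := by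
  have hf : ∀ i, Measurable fun u => ENNReal.ofReal (M.f i z u) := fun i =>
    (M.measurable_f_comp i measurable_const measurable_id).ennreal_ofReal
  have hf0 := hf 0
  have hf1 := hf 1
  rw [← lintegral_add_left (by fun_prop), ← lintegral_add_left (by fun_prop)]
  refine lintegral_congr fun u => ?_
  have h0 := weight₀_nonneg (M := M) ha
  have h1 := weight₁_nonneg (M := M) ha
  have h2 := weight₂_nonneg (M := M) ha
  have f0 := mul_nonneg h0 (M.f_nonneg 0 z u)
  have f1 := mul_nonneg h1 (M.f_nonneg 1 z u)
  have f2 := mul_nonneg h2 (M.f_nonneg 2 z u)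
  rw [← add_mul, ← add_mul, ← ENNReal.ofReal_mul h0, ← ENNReal.ofReal_mul h1,
    ← ENNReal.ofReal_mul h2, ← ENNReal.ofReal_add f1 f2,
    ← ENNReal.ofReal_add f0 (add_nonneg f1 f2), ← add_assoc, H]

/-! ### The integrals in the recursion -/

/-- Functions with values in the unit interval. -/
def IsUnit01 {E : Type*} (g : State E → ℝ) : Prop := ∀ s, g s ∈ Set.Icc (0 : ℝ) 1

theorem measurable_comp_post {g : State E → ℝ} (hg : Measurable g) (z : E) (a : ℝ × ℝ × ℝ) :
    Measurable fun u => g (z, u, M.post z u a) :=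
  hg.comp (measurable_const.prodMk (measurable_id.prodMk
    (M.measurable_post_comp measurable_const measurable_id measurable_const)))

theorem integrable_integ (i : Fin 3) {g : State E → ℝ} (hm : Measurable g) (hg : IsUnit01 g)
    (z : E) (a : ℝ × ℝ × ℝ) : Integrable (fun u => g (z, u, M.post z u a) * M.f i z u) M.μ :=
  (M.integrable_f i z).bdd_mul (c := 1) (measurable_comp_post hm z a).aestronglyMeasurable
    (ae_of_all _ fun u => by
      rw [Real.norm_eq_abs, abs_of_nonneg (hg _).1]; exact (hg _).2)

theorem integ_mem (i : Fin 3) {g : State E → ℝ} (hm : Measurable g) (hg : IsUnit01 g)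
    (z : E) (a : ℝ × ℝ × ℝ) : M.integ i g z a ∈ Set.Icc (0 : ℝ) 1 := by
  refine ⟨integral_nonneg fun u => mul_nonneg (hg _).1 (M.f_nonneg _ _ _), ?_⟩
  rw [← M.f_integral i z]
  exact integral_mono (integrable_integ i hm hg z a) (M.integrable_f i z) fun u =>
    mul_le_of_le_one_left (M.f_nonneg _ _ _) (hg _).2

theorem integ_mono (i : Fin 3) {g g' : State E → ℝ} (hm : Measurable g) (hg : IsUnit01 g)
    (hm' : Measurable g') (hg' : IsUnit01 g') (h : ∀ s, g s ≤ g' s)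
    (z : E) (a : ℝ × ℝ × ℝ) : M.integ i g z a ≤ M.integ i g' z a :=
  integral_mono (integrable_integ i hm hg z a) (integrable_integ i hm' hg' z a) fun _ =>
    mul_le_mul_of_nonneg_right (h _) (M.f_nonneg _ _ _)

theorem integ_sub (i : Fin 3) {g g' : State E → ℝ} (hm : Measurable g) (hg : IsUnit01 g)
    (hm' : Measurable g') (hg' : IsUnit01 g') (z : E) (a : ℝ × ℝ × ℝ) :
    M.integ i (fun s => g s - g' s) z a = M.integ i g z a - M.integ i g' z a := by
  rw [integ, integ, integ, ← integral_sub (integrable_integ i hm hg z a)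
    (integrable_integ i hm' hg' z a)]
  simp only [sub_mul]

theorem tendsto_integ (i : Fin 3) {g : ℕ → State E → ℝ} {g' : State E → ℝ}
    (hm : ∀ k, Measurable (g k)) (hg : ∀ k, IsUnit01 (g k))
    (h : ∀ s, Tendsto (fun k => g k s) atTop (𝓝 (g' s))) (z : E) (a : ℝ × ℝ × ℝ) :
    Tendsto (fun k => M.integ i (g k) z a) atTop (𝓝 (M.integ i g' z a)) := by
  refine tendsto_integral_of_dominated_convergence (M.f i z)
    (fun k => (integrable_integ i (hm k) (hg k) z a).aestronglyMeasurable)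
    (M.integrable_f i z) (fun k => ae_of_all _ fun u => ?_)
    (ae_of_all _ fun u => (h _).mul_const _)
  rw [Real.norm_eq_abs, abs_of_nonneg (mul_nonneg (hg k _).1 (M.f_nonneg _ _ _))]
  exact mul_le_of_le_one_left (M.f_nonneg _ _ _) (hg k _).2

theorem measurable_integ (i : Fin 3) {g : State E → ℝ} (hm : Measurable g) :
    Measurable fun s : State E => M.integ i g s.2.1 s.2.2 := by
  have hz : Measurable fun p : State E × E => p.1.2.1 := by fun_prop
  have hu : Measurable fun p : State E × E => p.2 := by fun_prop
  have ha : Measurable fun p : State E × E => p.1.2.2 := by fun_prop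
  have h : Measurable fun p : State E × E =>
      g (p.1.2.1, p.2, M.post p.1.2.1 p.2 p.1.2.2) * M.f i p.1.2.1 p.2 :=
    (hm.comp (hz.prodMk (hu.prodMk (M.measurable_post_comp hz hu ha)))).mul
      (M.measurable_f_comp i hz hu)
  exact (h.stronglyMeasurable.integral_prod_right' (ν := M.μ)).measurable

/-! ### The value functions in terms of `R` and `S` -/

/-- The payoff of a rule that succeeds with conditional probability `r` given `n < θ₁ < θ₂` and with
conditional probability `s` given `θ₁ ≤ n < θ₂`. -/
def val {E : Type*} (r s : State E → ℝ) (t : State E) : ℝ :=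
  (1 - t.2.2.1 - t.2.2.2.2) * r t + (t.2.2.1 - t.2.2.2.1) * s t

variable (M) in
/-- The right-hand side of the inequality that defines `stopRegion`. -/
noncomputable def contVal (r s : State E → ℝ) (t : State E) : ℝ :=
  (1 - t.2.2.1 - t.2.2.2.2) *
      (M.p₁ * M.integ 0 r t.2.1 t.2.2 + M.q₁ * M.integ 1 s t.2.1 t.2.2)
    + (t.2.2.1 - t.2.2.2.1) * (M.p₂ * M.integ 1 s t.2.1 t.2.2)

theorem mem_stopRegion {r s : State E → ℝ} {t : State E} :
    t ∈ M.stopRegion r s ↔ t ∈ stateSpace E ∧ M.contVal r s t ≤ payoff t := Iff.rfl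

theorem measurable_payoff : Measurable (payoff : State E → ℝ) := by
  unfold payoff; fun_prop

theorem measurable_val {r s : State E → ℝ} (hr : Measurable r) (hs : Measurable s) :
    Measurable (val r s) := by
  unfold val; fun_prop

theorem measurable_contVal {r s : State E → ℝ} (hr : Measurable r) (hs : Measurable s) :
    Measurable (M.contVal r s) := by
  have h0 := measurable_integ (M := M) 0 hr
  have h1 := measurable_integ (M := M) 1 hs
  unfold contVal
  fun_prop

theorem measurableSet_stopRegion {r s : State E → ℝ} (hr : Measurable r) (hs : Measurable s) :
    MeasurableSet (M.stopRegion r s) :=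
  measurableSet_stateSpace.inter (measurableSet_le (measurable_contVal hr hs) measurable_payoff)

theorem val_mem {E : Type*} {r s : State E → ℝ} (hr : IsUnit01 r) (hs : IsUnit01 s) {t : State E}
    (ht : t ∈ stateSpace E) : 0 ≤ val r s t ∧ val r s t ≤ 1 - t.2.2.2.1 := by
  obtain ⟨h1, h2, h3, h4⟩ := ht
  obtain ⟨hr0, hr1⟩ := hr t
  obtain ⟨hs0, hs1⟩ := hs t
  unfold val
  constructor
  · exact add_nonneg (mul_nonneg (by linarith) hr0) (mul_nonneg (by linarith) hs0)
  · have := mul_le_of_le_one_right (show 0 ≤ 1 - t.2.2.1 - t.2.2.2.2 by linarith) hr1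
    have := mul_le_of_le_one_right (show 0 ≤ t.2.2.1 - t.2.2.2.1 by linarith) hs1
    linarith

theorem val_mul_H {r s : State E → ℝ} {z u : E} {a : ℝ × ℝ × ℝ} (ha : Adm a) :
    val r s (z, u, M.post z u a) * M.H z u a
      = (1 - a.1 - a.2.2) * (M.p₁ * (r (z, u, M.post z u a) * M.f 0 z u)
          + M.q₁ * (s (z, u, M.post z u a) * M.f 1 z u))
        + (a.1 - a.2.1) * (M.p₂ * (s (z, u, M.post z u a) * M.f 1 z u)) := by
  have h1 := post_before_mul_H (M := M) (x := z) (y := u) ha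
  have h2 := post_between_mul_H (M := M) (x := z) (y := u) ha
  unfold val
  dsimp only
  linear_combination r (z, u, M.post z u a) * h1 + s (z, u, M.post z u a) * h2

/-- The transition operator on functions of the form `val r s`. -/
theorem T_val {r s : State E → ℝ} (hrm : Measurable r) (hr : IsUnit01 r) (hsm : Measurable s)
    (hs : IsUnit01 s) {t : State E} (ht : t ∈ stateSpace E) :
    M.T (val r s) t = M.contVal r s t := by
  obtain ⟨y, z, a⟩ := t
  have ha : Adm a := ht
  have i0 := integrable_integ (M := M) 0 hrm hr z a
  have i1 := integrable_integ (M := M) 1 hsm hs z a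
  simp only [T, contVal, val_mul_H ha]
  rw [integral_add, integral_const_mul, integral_const_mul, integral_add, integral_const_mul,
    integral_const_mul, integral_const_mul]
  · rfl
  · exact i0.const_mul _
  · exact i1.const_mul _
  · exact ((i0.const_mul _).add (i1.const_mul _)).const_mul _
  · exact (i1.const_mul _).const_mul _

theorem T_congr {v w : State E → ℝ} (h : ∀ s ∈ stateSpace E, v s = w s) {t : State E}
    (ht : t ∈ stateSpace E) : M.T v t = M.T w t := by
  refine integral_congr_ae (ae_of_all _ fun u => ?_)
  dsimp only
  rw [h _ (adm_post (M := M) t.2.1 u ht)]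

theorem integrable_mul_H {v : State E → ℝ} (hm : Measurable v)
    (hv : ∀ s ∈ stateSpace E, v s ∈ Set.Icc (0 : ℝ) 1) (z : E) {a : ℝ × ℝ × ℝ} (ha : Adm a) :
    Integrable (fun u => v (z, u, M.post z u a) * M.H z u a) M.μ :=
  (integrable_H z a).bdd_mul (c := 1) (measurable_comp_post hm z a).aestronglyMeasurable
    (ae_of_all _ fun u => by
      have := hv (z, u, M.post z u a) (adm_post z u ha)
      rw [Real.norm_eq_abs, abs_of_nonneg this.1]; exact this.2)

theorem val_mem_unit {E : Type*} {r s : State E → ℝ} (hr : IsUnit01 r) (hs : IsUnit01 s)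
    {t : State E} (ht : t ∈ stateSpace E) : val r s t ∈ Set.Icc (0 : ℝ) 1 := by
  have := val_mem hr hs ht
  exact ⟨this.1, this.2.trans (by linarith [ht.1])⟩

theorem contVal_mono {r s r' s' : State E → ℝ} (hrm : Measurable r) (hr : IsUnit01 r)
    (hsm : Measurable s) (hs : IsUnit01 s) (hrm' : Measurable r') (hr' : IsUnit01 r')
    (hsm' : Measurable s') (hs' : IsUnit01 s')
    (h : ∀ t ∈ stateSpace E, val r s t ≤ val r' s' t) {t : State E} (ht : t ∈ stateSpace E) :
    M.contVal r s t ≤ M.contVal r' s' t := by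
  rw [← T_val hrm hr hsm hs ht, ← T_val hrm' hr' hsm' hs' ht]
  refine integral_mono
    (integrable_mul_H (measurable_val hrm hsm) (fun _ => val_mem_unit hr hs) _ ht)
    (integrable_mul_H (measurable_val hrm' hsm') (fun _ => val_mem_unit hr' hs') _ ht) fun u => ?_
  exact mul_le_mul_of_nonneg_right (h _ (adm_post _ u ht)) (H_nonneg _ _ ht)

/-! ### The recursion for `R` and `S` -/

open Classical in
theorem R_succ (k : ℕ) (t : State E) : M.R (k + 1) t = if t ∈ M.stopSet k then 0 else
    M.p₁ * M.integ 0 (M.R k) t.2.1 t.2.2 + M.q₁ * M.integ 1 (M.S k) t.2.1 t.2.2 := rfl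

open Classical in
theorem S_succ (k : ℕ) (t : State E) : M.S (k + 1) t = if t ∈ M.stopSet k then 1 else
    M.p₂ * M.integ 1 (M.S k) t.2.1 t.2.2 := rfl

theorem measurable_RS (k : ℕ) : Measurable (M.R k) ∧ Measurable (M.S k) := by
  classical
  induction k with
  | zero => exact ⟨measurable_const, measurable_const⟩
  | succ k ih =>
    have hset : MeasurableSet (M.stopSet k) := measurableSet_stopRegion ih.1 ih.2
    have h0 := measurable_integ (M := M) 0 ih.1
    have h1 := measurable_integ (M := M) 1 ih.2
    refine ⟨Measurable.ite hset measurable_const ?_, Measurable.ite hset measurable_const ?_⟩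
    · exact (h0.const_mul _).add (h1.const_mul _)
    · exact h1.const_mul _

theorem measurable_R (k : ℕ) : Measurable (M.R k) := (measurable_RS k).1
theorem measurable_S (k : ℕ) : Measurable (M.S k) := (measurable_RS k).2

theorem isUnit01_RS (k : ℕ) : IsUnit01 (M.R k) ∧ IsUnit01 (M.S k) := by
  induction k with
  | zero => exact ⟨fun _ => ⟨le_rfl, zero_le_one⟩, fun _ => ⟨zero_le_one, le_rfl⟩⟩
  | succ k ih =>
    have h0 := integ_mem (M := M) 0 (measurable_R k) ih.1
    have h1 := integ_mem (M := M) 1 (measurable_S k) ih.2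
    have := M.p₁_add_q₁
    constructor <;> intro t
    · rw [R_succ]
      split_ifs
      · exact ⟨le_rfl, zero_le_one⟩
      · refine ⟨add_nonneg (mul_nonneg M.p₁_nonneg (h0 _ _).1)
          (mul_nonneg M.q₁_nonneg (h1 _ _).1), ?_⟩
        have := mul_le_of_le_one_right M.p₁_nonneg (h0 t.2.1 t.2.2).2
        have := mul_le_of_le_one_right M.q₁_nonneg (h1 t.2.1 t.2.2).2
        linarith
    · rw [S_succ]
      split_ifs
      · exact ⟨zero_le_one, le_rfl⟩
      · exact ⟨mul_nonneg M.p₂_nonneg (h1 _ _).1,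
          mul_le_one₀ M.p₂_mem.2.le (h1 _ _).1 (h1 _ _).2⟩

theorem isUnit01_R (k : ℕ) : IsUnit01 (M.R k) := (isUnit01_RS k).1
theorem isUnit01_S (k : ℕ) : IsUnit01 (M.S k) := (isUnit01_RS k).2

theorem val_zero (t : State E) : val (M.R 0) (M.S 0) t = payoff t := by
  simp [val, payoff, R, S, RS]

theorem val_succ (k : ℕ) {t : State E} (ht : t ∈ stateSpace E) :
    val (M.R (k + 1)) (M.S (k + 1)) t = max (payoff t) (M.contVal (M.R k) (M.S k) t) := by
  have hmem : t ∈ M.stopSet k ↔ M.contVal (M.R k) (M.S k) t ≤ payoff t :=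
    mem_stopRegion.trans (and_iff_right ht)
  unfold val
  rw [R_succ, S_succ]
  split_ifs with h
  · rw [max_eq_left (hmem.1 h)]; simp [payoff]
  · rw [max_eq_right (not_le.1 fun h' => h (hmem.2 h')).le]; rfl

theorem val_le_succ (k : ℕ) : ∀ t ∈ stateSpace E,
    val (M.R k) (M.S k) t ≤ val (M.R (k + 1)) (M.S (k + 1)) t := by
  induction k with
  | zero => intro t ht; rw [val_succ 0 ht, val_zero]; exact le_max_left _ _
  | succ k ih =>
    intro t ht
    rw [val_succ k ht, val_succ (k + 1) ht]
    exact max_le_max le_rfl (contVal_mono (measurable_R k) (isUnit01_R k) (measurable_S k)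
      (isUnit01_S k) (measurable_R _) (isUnit01_R _) (measurable_S _) (isUnit01_S _) ih ht)

theorem contVal_le_succ (k : ℕ) {t : State E} (ht : t ∈ stateSpace E) :
    M.contVal (M.R k) (M.S k) t ≤ M.contVal (M.R (k + 1)) (M.S (k + 1)) t :=
  contVal_mono (measurable_R k) (isUnit01_R k) (measurable_S k)
    (isUnit01_S k) (measurable_R _) (isUnit01_R _) (measurable_S _) (isUnit01_S _)
    (val_le_succ k) ht

theorem stopSet_succ_subset (k : ℕ) : M.stopSet (k + 1) ⊆ M.stopSet k := fun _ ht =>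
  ⟨ht.1, (contVal_le_succ k ht.1).trans ht.2⟩

/-- The value iteration is expressed by `R` and `S`. -/
theorem iterate_Q_payoff (k : ℕ) : ∀ t ∈ stateSpace E,
    (M.Q)^[k] payoff t = val (M.R k) (M.S k) t := by
  induction k with
  | zero => intro t _; exact (val_zero t).symm
  | succ k ih =>
    intro t ht
    rw [Function.iterate_succ_apply', Q, ih t ht, T_congr ih ht,
      T_val (measurable_R k) (isUnit01_R k) (measurable_S k) (isUnit01_S k) ht, val_succ k ht]
    rcases k with _ | k
    · rw [val_zero]
    · rw [val_succ k ht, max_assoc, max_eq_right (contVal_le_succ k ht)]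

theorem T_iterate_Q_payoff (k : ℕ) {t : State E} (ht : t ∈ stateSpace E) :
    M.T ((M.Q)^[k] payoff) t = M.contVal (M.R k) (M.S k) t := by
  rw [T_congr (iterate_Q_payoff k) ht,
    T_val (measurable_R k) (isUnit01_R k) (measurable_S k) (isUnit01_S k) ht]

/-! ### Convergence of `R` and `S` -/

variable (M) in
open Classical in
/-- The conditional probability, given `n < θ₁ < θ₂`, that the rule behind `R k` does not stop
before `θ₁`. It increases with `k`, and so does `notBefore k - R k`, the probability of not stopping
before `θ₂`. -/
noncomputable def notBefore : ℕ → State E → ℝ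
  | 0 => fun _ => 0
  | k + 1 => fun t => if t ∈ M.stopSet k then 0 else
      M.p₁ * M.integ 0 (notBefore k) t.2.1 t.2.2 + M.q₁

theorem measurableSet_stopSet (k : ℕ) : MeasurableSet (M.stopSet k) :=
  measurableSet_stopRegion (measurable_R k) (measurable_S k)

theorem measurable_notBefore (k : ℕ) : Measurable (M.notBefore k) := by
  classical
  induction k with
  | zero => exact measurable_const
  | succ k ih =>
    exact Measurable.ite (measurableSet_stopSet k) measurable_const
      (((measurable_integ (M := M) 0 ih).const_mul _).add_const _)

open Classical in
theorem notBefore_succ (k : ℕ) (t : State E) : M.notBefore (k + 1) t =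
    if t ∈ M.stopSet k then 0 else M.p₁ * M.integ 0 (M.notBefore k) t.2.1 t.2.2 + M.q₁ := rfl

theorem isUnit01_notBefore (k : ℕ) : IsUnit01 (M.notBefore k) := by
  induction k with
  | zero => exact fun _ => ⟨le_rfl, zero_le_one⟩
  | succ k ih =>
    intro t
    have h0 := integ_mem (M := M) 0 (measurable_notBefore k) ih t.2.1 t.2.2
    rw [notBefore_succ]
    split_ifs
    · exact ⟨le_rfl, zero_le_one⟩
    · refine ⟨add_nonneg (mul_nonneg M.p₁_nonneg h0.1) M.q₁_nonneg, ?_⟩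
      have := mul_le_of_le_one_right M.p₁_nonneg h0.2
      linarith [M.p₁_add_q₁]

theorem R_le_notBefore (k : ℕ) : ∀ t, M.R k t ≤ M.notBefore k t := by
  induction k with
  | zero => exact fun _ => le_rfl
  | succ k ih =>
    intro t
    rw [notBefore_succ, R_succ]
    split_ifs
    · exact le_rfl
    · exact add_le_add (mul_le_mul_of_nonneg_left (integ_mono 0 (measurable_R k) (isUnit01_R k)
        (measurable_notBefore k) (isUnit01_notBefore k) ih _ _) M.p₁_nonneg)
        (mul_le_of_le_one_right M.q₁_nonneg
          (integ_mem 1 (measurable_S k) (isUnit01_S k) _ _).2)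

theorem S_succ_le (k : ℕ) : ∀ t, M.S (k + 1) t ≤ M.S k t := by
  induction k with
  | zero => exact fun t => (isUnit01_S 1 t).2
  | succ k ih =>
    intro t
    rw [S_succ (k + 1), S_succ k]
    by_cases h : t ∈ M.stopSet k
    · rw [if_pos h, ← S_succ (k + 1)]
      exact (isUnit01_S _ t).2
    · rw [if_neg h, if_neg fun h' => h (stopSet_succ_subset k h')]
      exact mul_le_mul_of_nonneg_left (integ_mono 1 (measurable_S _) (isUnit01_S _)
        (measurable_S _) (isUnit01_S _) ih _ _) M.p₂_nonneg

theorem notBefore_le_succ (k : ℕ) : ∀ t, M.notBefore k t ≤ M.notBefore (k + 1) t := by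
  induction k with
  | zero => exact fun t => (isUnit01_notBefore 1 t).1
  | succ k ih =>
    intro t
    rw [notBefore_succ k]
    split_ifs with h
    · exact (isUnit01_notBefore _ t).1
    · rw [notBefore_succ (k + 1), if_neg fun h' => h (stopSet_succ_subset k h')]
      exact add_le_add_left (mul_le_mul_of_nonneg_left (integ_mono 0 (measurable_notBefore _)
        (isUnit01_notBefore _) (measurable_notBefore _) (isUnit01_notBefore _) ih _ _)
        M.p₁_nonneg) _

theorem isUnit01_notBefore_sub_R (k : ℕ) : IsUnit01 fun t => M.notBefore k t - M.R k t :=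
  fun t => ⟨sub_nonneg.2 (R_le_notBefore k t),
    by linarith [(isUnit01_notBefore (M := M) k t).2, (isUnit01_R (M := M) k t).1]⟩

theorem measurable_notBefore_sub_R (k : ℕ) : Measurable fun t => M.notBefore k t - M.R k t :=
  (measurable_notBefore k).sub (measurable_R k)

theorem notBefore_sub_R_le_succ (k : ℕ) :
    ∀ t, M.notBefore k t - M.R k t ≤ M.notBefore (k + 1) t - M.R (k + 1) t := by
  induction k with
  | zero => exact fun t => by simpa [notBefore, R, RS] using R_le_notBefore (M := M) 1 t
  | succ k ih =>
    intro t
    by_cases h : t ∈ M.stopSet k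
    · rw [notBefore_succ k, R_succ k, if_pos h, if_pos h, sub_self]
      exact (isUnit01_notBefore_sub_R _ t).1
    · have h' : t ∉ M.stopSet (k + 1) := fun h' => h (stopSet_succ_subset k h')
      rw [notBefore_succ k, R_succ k, if_neg h, if_neg h, notBefore_succ (k + 1),
        R_succ (k + 1), if_neg h', if_neg h']
      have h1 := integ_mono (M := M) 0 (measurable_notBefore_sub_R k) (isUnit01_notBefore_sub_R k)
        (measurable_notBefore_sub_R (k + 1)) (isUnit01_notBefore_sub_R (k + 1)) ih t.2.1 t.2.2
      rw [integ_sub 0 (measurable_notBefore _) (isUnit01_notBefore _) (measurable_R _)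
        (isUnit01_R _), integ_sub 0 (measurable_notBefore _) (isUnit01_notBefore _)
        (measurable_R _) (isUnit01_R _)] at h1
      have h2 := integ_mono (M := M) 1 (measurable_S (M := M) (k + 1)) (isUnit01_S (k + 1))
        (measurable_S k) (isUnit01_S k) (S_succ_le k) t.2.1 t.2.2
      have h3 := mul_le_mul_of_nonneg_left h1 M.p₁_nonneg
      have h4 := mul_le_mul_of_nonneg_left h2 M.q₁_nonneg
      linarith

theorem tendsto_S (t : State E) : Tendsto (fun k => M.S k t) atTop (𝓝 (M.SStar t)) :=
  tendsto_nhds_limUnder ⟨_, tendsto_atTop_ciInf (antitone_nat_of_succ_le fun k => S_succ_le k t)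
    ⟨0, by rintro _ ⟨k, rfl⟩; exact (isUnit01_S k t).1⟩⟩

theorem tendsto_R (t : State E) : Tendsto (fun k => M.R k t) atTop (𝓝 (M.RStar t)) := by
  have h1 := tendsto_atTop_ciSup (monotone_nat_of_le_succ fun k => notBefore_le_succ (M := M) k t)
    ⟨1, by rintro _ ⟨k, rfl⟩; exact (isUnit01_notBefore k t).2⟩
  have h2 := tendsto_atTop_ciSup
    (monotone_nat_of_le_succ fun k => notBefore_sub_R_le_succ (M := M) k t)
    ⟨1, by rintro _ ⟨k, rfl⟩; exact (isUnit01_notBefore_sub_R k t).2⟩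
  refine tendsto_nhds_limUnder ⟨_, (h1.sub h2).congr fun k => ?_⟩
  ring

theorem measurable_RStar : Measurable M.RStar :=
  measurable_of_tendsto_metrizable measurable_R (tendsto_pi_nhds.2 tendsto_R)

theorem measurable_SStar : Measurable M.SStar :=
  measurable_of_tendsto_metrizable measurable_S (tendsto_pi_nhds.2 tendsto_S)

theorem isUnit01_RStar : IsUnit01 M.RStar := fun t =>
  isClosed_Icc.mem_of_tendsto (tendsto_R t) (Eventually.of_forall fun k => isUnit01_R k t)

theorem isUnit01_SStar : IsUnit01 M.SStar := fun t =>
  isClosed_Icc.mem_of_tendsto (tendsto_S t) (Eventually.of_forall fun k => isUnit01_S k t)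

theorem measurableSet_BStar : MeasurableSet M.BStar :=
  measurableSet_stopRegion measurable_RStar measurable_SStar

/-! ### The limit of the value iteration -/

variable (M) in
/-- The limit of the value iteration; on the states it is `hStar`. -/
noncomputable def limVal : State E → ℝ := val M.RStar M.SStar

theorem measurable_limVal : Measurable M.limVal := measurable_val measurable_RStar measurable_SStar

theorem limVal_mem {t : State E} (ht : t ∈ stateSpace E) : M.limVal t ∈ Set.Icc (0 : ℝ) 1 :=
  val_mem_unit isUnit01_RStar isUnit01_SStar ht

theorem tendsto_val (t : State E) :
    Tendsto (fun k => val (M.R k) (M.S k) t) atTop (𝓝 (M.limVal t)) :=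
  ((tendsto_R t).const_mul _).add ((tendsto_S t).const_mul _)

theorem tendsto_iterate_Q {t : State E} (ht : t ∈ stateSpace E) :
    Tendsto (fun k : ℕ => (M.Q)^[k] payoff t) atTop (𝓝 (M.limVal t)) :=
  (tendsto_val t).congr fun k => (iterate_Q_payoff k t ht).symm

theorem hStar_eq {t : State E} (ht : t ∈ stateSpace E) : M.hStar t = M.limVal t :=
  (tendsto_iterate_Q ht).limUnder_eq

theorem T_limVal {t : State E} (ht : t ∈ stateSpace E) :
    M.T M.limVal t = M.contVal M.RStar M.SStar t :=
  T_val measurable_RStar isUnit01_RStar measurable_SStar isUnit01_SStar ht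

/-- The Bellman equation. -/
theorem limVal_eq_max {t : State E} (ht : t ∈ stateSpace E) :
    M.limVal t = max (payoff t) (M.contVal M.RStar M.SStar t) := by
  have h0 := tendsto_integ (M := M) 0 (measurable_R (M := M)) isUnit01_R tendsto_R t.2.1 t.2.2
  have h1 := tendsto_integ (M := M) 1 (measurable_S (M := M)) isUnit01_S tendsto_S t.2.1 t.2.2
  have h : Tendsto (fun k => M.contVal (M.R k) (M.S k) t) atTop
      (𝓝 (M.contVal M.RStar M.SStar t)) :=
    (((h0.const_mul _).add (h1.const_mul _)).const_mul _).add ((h1.const_mul _).const_mul _)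
  refine tendsto_nhds_unique ((tendsto_add_atTop_iff_nat 1).2 (tendsto_val t)) ?_
  exact (tendsto_const_nhds.max h).congr fun k => (val_succ k ht).symm

theorem mem_BStar {t : State E} (ht : t ∈ stateSpace E) :
    t ∈ M.BStar ↔ M.limVal t ≤ payoff t := by
  rw [limVal_eq_max ht, max_le_iff]
  exact mem_stopRegion.trans ⟨fun h => ⟨le_rfl, h.2⟩, fun h => ⟨ht, h.2⟩⟩

/-! ### Independence of the first coordinate -/

theorem R_congr (k : ℕ) (y y' z : E) (a : ℝ × ℝ × ℝ) : M.R k (y, z, a) = M.R k (y', z, a) := by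
  cases k <;> rfl

theorem S_congr (k : ℕ) (y y' z : E) (a : ℝ × ℝ × ℝ) : M.S k (y, z, a) = M.S k (y', z, a) := by
  cases k <;> rfl

theorem limVal_congr (y y' z : E) (a : ℝ × ℝ × ℝ) :
    M.limVal (y, z, a) = M.limVal (y', z, a) := by
  refine tendsto_nhds_unique (tendsto_val _) ((tendsto_val (y', z, a)).congr fun k => ?_)
  simp only [val, R_congr k y y', S_congr k y y']

theorem contVal_init (y x : E) : M.contVal M.RStar M.SStar (y, x, M.init) = M.V₀ x := by
  simp only [contVal, init, V₀]; ring

theorem payoff_init (y x : E) : payoff (y, x, M.init) = M.π * (1 - M.ρ) := by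
  simp only [payoff, init]; ring

theorem limVal_init (y x : E) : M.limVal (y, x, M.init) = M.V x := by
  rw [limVal_eq_max (mem_stateSpace.2 M.adm_init), contVal_init, payoff_init, V]

end Params
end TwoDisorders

namespace TwoDisorders

/-! ### Measures that agree on a sub-σ-algebra -/

section Agree

variable {Ω : Type*} {m m0 : MeasurableSpace Ω}

theorem setLIntegral_congr_of_agree (hm : m ≤ m0) {ν ν' : Measure Ω}
    (h : ∀ A, MeasurableSet[m] A → ν A = ν' A) {g : Ω → ENNReal} (hg : Measurable[m] g)
    {A : Set Ω} (hA : MeasurableSet[m] A) : ∫⁻ ω in A, g ω ∂ν = ∫⁻ ω in A, g ω ∂ν' := by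
  have : ν.trim hm = ν'.trim hm := by
    refine @Measure.ext _ m _ _ fun s hs => ?_
    rw [trim_measurableSet_eq hm hs, trim_measurableSet_eq hm hs, h s hs]
  rw [← setLIntegral_trim hm hg hA, ← setLIntegral_trim hm hg hA, this]

theorem agree_on_sup {ν ν' : Measure Ω} [IsFiniteMeasure ν] {m₁ m₂ : MeasurableSpace Ω}
    (h₁ : m₁ ≤ m0) (h₂ : m₂ ≤ m0)
    (h : ∀ A B, MeasurableSet[m₁] A → MeasurableSet[m₂] B → ν (A ∩ B) = ν' (A ∩ B))
    {A : Set Ω} (hA : MeasurableSet[m₁ ⊔ m₂] A) : ν A = ν' A := by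
  refine ext_on_measurableSpace_of_generate_finite m0
    {s | ∃ A B, MeasurableSet[m₁] A ∧ MeasurableSet[m₂] B ∧ s = A ∩ B} ?_
    (sup_le h₁ h₂) ?_ ?_ ?_ hA
  · rintro _ ⟨A, B, hA, hB, rfl⟩
    exact h A B hA hB
  · apply le_antisymm
    · refine sup_le (fun A hA => ?_) fun B hB => ?_
      · exact MeasurableSpace.measurableSet_generateFrom
          ⟨A, Set.univ, hA, MeasurableSet.univ, (Set.inter_univ A).symm⟩
      · exact MeasurableSpace.measurableSet_generateFrom
          ⟨Set.univ, B, MeasurableSet.univ, hB, (Set.univ_inter B).symm⟩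
    · refine MeasurableSpace.generateFrom_le ?_
      rintro _ ⟨A, B, hA, hB, rfl⟩
      exact MeasurableSet.inter ((le_sup_left : m₁ ≤ m₁ ⊔ m₂) A hA)
        ((le_sup_right : m₂ ≤ m₁ ⊔ m₂) B hB)
  · rintro _ ⟨A, B, hA, hB, rfl⟩ _ ⟨A', B', hA', hB', rfl⟩ _
    exact ⟨A ∩ A', B ∩ B', hA.inter hA', hB.inter hB', Set.inter_inter_inter_comm _ _ _ _⟩
  · simpa using h Set.univ Set.univ MeasurableSet.univ MeasurableSet.univ

/-- A version of a conditional probability is a density on the sub-σ-algebra. -/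
theorem density_of_eq_condExp (hm : m ≤ m0) {P : Measure Ω} [IsFiniteMeasure P] {D : Set Ω}
    (hD : MeasurableSet D) {g : Ω → ℝ} (hg : g =ᵐ[P] P[D.indicator (fun _ => (1 : ℝ)) | m]) :
    0 ≤ᵐ[P] g ∧ ∀ A, MeasurableSet[m] A → P (A ∩ D) = ∫⁻ ω in A, ENNReal.ofReal (g ω) ∂P := by
  have hind : Integrable (D.indicator fun _ => (1 : ℝ)) P :=
    (integrable_const 1).indicator hD
  have hnn : 0 ≤ᵐ[P] g := by
    have h0 : 0 ≤ᵐ[P] P[D.indicator (fun _ => (1 : ℝ)) | m] :=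
      condExp_nonneg (ae_of_all _ fun ω => Set.indicator_nonneg (fun _ _ => zero_le_one) ω)
    filter_upwards [hg, h0] with ω h1 h2
    rw [h1]; exact h2
  refine ⟨hnn, fun A hA => ?_⟩
  have hgi : Integrable g P := integrable_condExp.congr hg.symm
  rw [← ofReal_integral_eq_lintegral_ofReal hgi.integrableOn (ae_restrict_of_ae hnn),
    setIntegral_congr_ae (hm A hA) (hg.mono fun ω h _ => h), setIntegral_condExp hm hind hA,
    setIntegral_indicator hD]
  simp

/-- A density on the sub-σ-algebra is a version of the conditional probability. -/
theorem eq_condExp_of_density (hm : m ≤ m0) {P : Measure Ω} [IsFiniteMeasure P] {D : Set Ω}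
    (hD : MeasurableSet D) {g : Ω → ℝ} (hgm : Measurable[m] g) (hnn : 0 ≤ᵐ[P] g)
    (h : ∀ A, MeasurableSet[m] A → P (A ∩ D) = ∫⁻ ω in A, ENNReal.ofReal (g ω) ∂P) :
    g =ᵐ[P] P[D.indicator (fun _ => (1 : ℝ)) | m] := by
  have hgi : Integrable g P := by
    refine ⟨(hgm.mono hm le_rfl).aestronglyMeasurable, ?_⟩
    rw [hasFiniteIntegral_iff_ofReal hnn, ← setLIntegral_univ, ← h _ MeasurableSet.univ]
    exact measure_lt_top _ _
  refine ae_eq_condExp_of_forall_setIntegral_eq hm ((integrable_const 1).indicator hD)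
    (fun _ _ _ => hgi.integrableOn) (fun A hA _ => ?_)
    (Measurable.stronglyMeasurable hgm).aestronglyMeasurable
  rw [setIntegral_indicator hD, integral_eq_lintegral_of_nonneg_ae (ae_restrict_of_ae hnn)
    hgi.aestronglyMeasurable.restrict, ← h A hA]
  simp [Measure.real]

end Agree

/-- If `κ` is the conditional density of `Z` given `Y` on rectangles, then it is so for all
functions of the pair. -/
theorem lintegral_pair_of_density {Ω α E : Type*} [MeasurableSpace Ω] [MeasurableSpace α]
    [MeasurableSpace E] {ν ν' : Measure Ω} [IsFiniteMeasure ν] [IsFiniteMeasure ν']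
    {μ : Measure E} [SigmaFinite μ] {Y : Ω → α} {Z : Ω → E} (hY : Measurable Y)
    (hZ : Measurable Z) {κ : α × E → ENNReal} (hκ : Measurable κ)
    (h : ∀ C B, MeasurableSet C → MeasurableSet B →
      ν (Y ⁻¹' C ∩ Z ⁻¹' B) = ∫⁻ ω in Y ⁻¹' C, ∫⁻ u in B, κ (Y ω, u) ∂μ ∂ν')
    {Φ : α × E → ENNReal} (hΦ : Measurable Φ) :
    ∫⁻ ω, Φ (Y ω, Z ω) ∂ν = ∫⁻ ω, ∫⁻ u, κ (Y ω, u) * Φ (Y ω, u) ∂μ ∂ν' := by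
  have hmeas : ν.map (fun ω => (Y ω, Z ω)) = ((ν'.map Y).prod μ).withDensity κ := by
    refine Measure.ext_prod fun {C B} hC hB => ?_
    rw [Measure.map_apply (hY.prodMk hZ) (hC.prod hB), withDensity_apply _ (hC.prod hB),
      ← Measure.prod_restrict, lintegral_prod _ hκ.aemeasurable,
      ← Measure.restrict_map hY hC |>.symm, lintegral_map hκ.lintegral_prod_right' hY]
    exact h C B hC hB
  rw [← lintegral_map (f := Φ) (g := fun ω => (Y ω, Z ω)) hΦ (hY.prodMk hZ), hmeas,
    lintegral_withDensity_eq_lintegral_mul _ hκ hΦ, lintegral_prod _ (hκ.mul hΦ).aemeasurable,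
    lintegral_map (hκ.mul hΦ).lintegral_prod_right' hY]
  rfl

/-! ### The pair of the disorder times -/

/-- The pair of the disorder times. -/
def times {Ω : Type*} (θ₁ θ₂ : Ω → ℕ) (ω : Ω) : ℕ × ℕ := (θ₁ ω, θ₂ ω)

section Times

variable {Ω : Type*} [MeasurableSpace Ω] {T : Ω → ℕ × ℕ}

theorem measure_preimage_image_eq (hT : Measurable T) {ν ν' : Measure Ω} {D : Set (ℕ × ℕ)}
    {e : ℕ × ℕ → ℕ × ℕ} (he : Set.InjOn e D) (h : ∀ d ∈ D, ν (T ⁻¹' {e d}) = ν' (T ⁻¹' {d})) :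
    ν (T ⁻¹' (e '' D)) = ν' (T ⁻¹' D) := by
  have hmeas : ∀ y, MeasurableSet (T ⁻¹' {y}) := fun y => hT (measurableSet_singleton y)
  rw [← tsum_measure_preimage_singleton (Set.to_countable _) fun y _ => hmeas y,
    ← tsum_measure_preimage_singleton (Set.to_countable _) fun y _ => hmeas y,
    tsum_image (fun d => ν (T ⁻¹' {d})) he]
  exact tsum_congr fun d => h d d.2

theorem measure_preimage_congr (hT : Measurable T) {ν ν' : Measure Ω} {D : Set (ℕ × ℕ)}
    (h : ∀ d ∈ D, ν (T ⁻¹' {d}) = ν' (T ⁻¹' {d})) : ν (T ⁻¹' D) = ν' (T ⁻¹' D) := by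
  simpa using measure_preimage_image_eq (e := id) hT Function.injective_id.injOn h

end Times

/-- `n < θ₁ ≤ θ₂`. -/
def before (n : ℕ) : Set (ℕ × ℕ) := {d | n < d.1 ∧ d.1 ≤ d.2}

/-- `n < θ₁ < θ₂`. -/
def beforeLt (n : ℕ) : Set (ℕ × ℕ) := {d | n < d.1 ∧ d.1 < d.2}

/-- `n < θ₁ = θ₂`. -/
def beforeEq (n : ℕ) : Set (ℕ × ℕ) := {d | d.1 = d.2 ∧ n < d.1}

/-- `θ₁ ≤ n < θ₂`. -/
def between (n : ℕ) : Set (ℕ × ℕ) := {d | d.1 ≤ n ∧ n < d.2}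

/-- `θ₁ ≤ θ₂ ≤ n`. -/
def after (n : ℕ) : Set (ℕ × ℕ) := {d | d.1 ≤ d.2 ∧ d.2 ≤ n}

/-! ### The law of the observations given the disorder times -/

section Obs

variable {Ω E : Type*} [MeasurableSpace E] {X : ℕ → Ω → E}

theorem obsSigma_zero : obsSigma X 0 = MeasurableSpace.comap (X 0) inferInstance := by
  simp [obsSigma]

theorem obsSigma_succ (n : ℕ) :
    obsSigma X (n + 1) = obsSigma X n ⊔ MeasurableSpace.comap (X (n + 1)) inferInstance := by
  apply le_antisymm
  · refine iSup₂_le fun i hi => ?_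
    rcases Nat.le_succ_iff.1 hi with h | rfl
    · exact le_sup_of_le_left (le_iSup₂_of_le (f := fun (j : ℕ) (_ : j ≤ n) =>
        MeasurableSpace.comap (X j) inferInstance) i h le_rfl)
    · exact le_sup_right
  · refine sup_le (iSup₂_le fun i hi => ?_) ?_
    · exact le_iSup₂_of_le (f := fun (j : ℕ) (_ : j ≤ n + 1) =>
        MeasurableSpace.comap (X j) inferInstance) i (hi.trans n.le_succ) le_rfl
    · exact le_iSup₂_of_le (f := fun (j : ℕ) (_ : j ≤ n + 1) =>
        MeasurableSpace.comap (X j) inferInstance) (n + 1) le_rfl le_rfl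

theorem measurable_obs {i n : ℕ} (h : i ≤ n) : Measurable[obsSigma X n] (X i) :=
  Measurable.of_comap_le (le_iSup₂_of_le (f := fun (j : ℕ) (_ : j ≤ n) =>
    MeasurableSpace.comap (X j) inferInstance) i h le_rfl)

theorem obsSigma_le [MeasurableSpace Ω] (hX : ∀ n, Measurable (X n)) (n : ℕ) :
    obsSigma X n ≤ ‹MeasurableSpace Ω› := (obsFiltration X hX).le n

theorem agree_on_obsSigma_succ [MeasurableSpace Ω] (hX : ∀ n, Measurable (X n)) (n : ℕ)
    {ν ν' : Measure Ω} [IsFiniteMeasure ν]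
    (h : ∀ A B, MeasurableSet[obsSigma X n] A → MeasurableSet B →
      ν (A ∩ X (n + 1) ⁻¹' B) = ν' (A ∩ X (n + 1) ⁻¹' B))
    {A : Set Ω} (hA : MeasurableSet[obsSigma X (n + 1)] A) : ν A = ν' A := by
  rw [obsSigma_succ] at hA
  refine agree_on_sup (obsSigma_le hX n) (hX (n + 1)).comap_le ?_ hA
  rintro A _ hA ⟨B, hB, rfl⟩
  exact h A B hA hB

end Obs

namespace Params.IsModel

variable {E Ω : Type*} [MeasurableSpace E] [MeasurableSpace Ω] {M : Params E} {x : E}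
  {P : Measure Ω} {θ₁ θ₂ : Ω → ℕ} {X : ℕ → Ω → E}

theorem measurable_times (hM : M.IsModel x P θ₁ θ₂ X) : Measurable (times θ₁ θ₂) :=
  hM.measurable_θ₁.prodMk hM.measurable_θ₂

theorem times_preimage_singleton {Ω : Type*} {θ₁ θ₂ : Ω → ℕ} (d : ℕ × ℕ) :
    times θ₁ θ₂ ⁻¹' {d} = {ω | θ₁ ω = d.1 ∧ θ₂ ω = d.2} := by
  ext ω; simp [times, Prod.ext_iff]

theorem measure_times (hM : M.IsModel x P θ₁ θ₂ X) (d : ℕ × ℕ) :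
    P (times θ₁ θ₂ ⁻¹' {d}) = ENNReal.ofReal (M.prior₁ d.1 * M.prior₂ d.1 d.2) := by
  rw [times_preimage_singleton, hM.prior]

/-- The σ-algebra of the fixed starting point is trivial. -/
theorem measure_obs_zero (hM : M.IsModel x P θ₁ θ₂ X) {A : Set Ω}
    (hA : MeasurableSet[obsSigma X 0] A) : P A = 0 ∨ P Aᶜ = 0 := by
  rw [obsSigma_zero] at hA
  obtain ⟨B, _, rfl⟩ := hA
  have h0 : P {ω | ¬ X 0 ω = x} = 0 := hM.start
  by_cases hx : x ∈ B
  · refine Or.inr (measure_mono_null (fun ω hω (h : X 0 ω = x) => hω ?_) h0)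
    rwa [Set.mem_preimage, h]
  · refine Or.inl (measure_mono_null (fun ω hω (h : X 0 ω = x) => hx ?_) h0)
    rw [← h]; exact hω

theorem transition_of_segment (hM : M.IsModel x P θ₁ θ₂ X) (hX : ∀ n, Measurable (X n))
    {D : Set (ℕ × ℕ)} {n : ℕ} {i : Fin 3} (hseg : ∀ d ∈ D, segment d.1 d.2 (n + 1) = i)
    {A : Set Ω} (hA : MeasurableSet[obsSigma X n] A) {B : Set E} (hB : MeasurableSet B) :
    P (A ∩ times θ₁ θ₂ ⁻¹' D ∩ X (n + 1) ⁻¹' B)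
      = ∫⁻ ω in A ∩ times θ₁ θ₂ ⁻¹' D, (∫⁻ u in B, ENNReal.ofReal (M.f i (X n ω) u) ∂M.μ) ∂P := by
  have hA' := obsSigma_le hX _ _ hA
  have hT := hM.measurable_times
  have hD : ∀ D, MeasurableSet (times θ₁ θ₂ ⁻¹' D) := fun D => hT D.to_countable.measurableSet
  have key := measure_preimage_congr (D := D) hT (ν := P.restrict (A ∩ X (n + 1) ⁻¹' B))
    (ν' := (P.restrict A).withDensity fun ω =>
      ∫⁻ u in B, ENNReal.ofReal (M.f i (X n ω) u) ∂M.μ) fun d hd => ?_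
  · rw [Measure.restrict_apply (hD _), withDensity_apply _ (hD _),
      Measure.restrict_restrict (hD _)] at key
    rw [Set.inter_comm A, ← key, Set.inter_assoc]
  · rw [Measure.restrict_apply (hD _), withDensity_apply _ (hD _),
      Measure.restrict_restrict (hD _), Set.inter_comm _ A, times_preimage_singleton,
      ← hseg d hd, ← hM.transition n d.1 d.2 A hA B hB, Set.inter_comm, Set.inter_right_comm]

theorem ae_le (hM : M.IsModel x P θ₁ θ₂ X) : ∀ᵐ ω ∂P, θ₁ ω ≤ θ₂ ω := by
  have key := measure_preimage_congr (D := {d : ℕ × ℕ | d.2 < d.1}) hM.measurable_times (ν := P)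
    (ν' := 0) fun d hd => by
      have hd : d.2 < d.1 := hd
      rw [hM.measure_times, prior₂, if_neg hd.ne, if_neg hd.not_gt]
      simp
  rw [ae_iff]
  simpa [times, Set.preimage] using key

variable [IsProbabilityMeasure P]

/-- Every event is independent of the trivial σ-algebra of the starting point. -/
theorem measure_obs_zero_inter (hM : M.IsModel x P θ₁ θ₂ X) {A : Set Ω}
    (hA : MeasurableSet[obsSigma X 0] A) (C : Set Ω) :
    P (A ∩ C) = P (A ∩ Set.univ) * P C := by
  rcases hM.measure_obs_zero hA with h | h
  · rw [measure_mono_null Set.inter_subset_left h, measure_mono_null Set.inter_subset_left h,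
      zero_mul]
  · have key : ∀ C, P (A ∩ C) = P C := fun C => by
      rw [Set.inter_comm]
      exact measure_inter_conull h
    rw [key, key, measure_univ, one_mul]

/-- Up to time `n` the law of the observations depends on the disorder times only through the
segments of the first `n` observations. -/
theorem measure_inter_times (hM : M.IsModel x P θ₁ θ₂ X) (hX : ∀ n, Measurable (X n))
    {d d' : ℕ × ℕ} {c : ENNReal}
    (hw : ENNReal.ofReal (M.prior₁ d'.1 * M.prior₂ d'.1 d'.2)
      = c * ENNReal.ofReal (M.prior₁ d.1 * M.prior₂ d.1 d.2)) (n : ℕ)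
    (hseg : ∀ i ≤ n, segment d'.1 d'.2 i = segment d.1 d.2 i) {A : Set Ω}
    (hA : MeasurableSet[obsSigma X n] A) :
    P (A ∩ times θ₁ θ₂ ⁻¹' {d'}) = c * P (A ∩ times θ₁ θ₂ ⁻¹' {d}) := by
  have hmeas : ∀ d, MeasurableSet (times θ₁ θ₂ ⁻¹' {d}) := fun d =>
    hM.measurable_times (measurableSet_singleton d)
  induction n generalizing A with
  | zero =>
    rw [hM.measure_obs_zero_inter hA, hM.measure_obs_zero_inter hA (_ ⁻¹' {d}),
      hM.measure_times, hM.measure_times, hw, mul_left_comm]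
  | succ n ih =>
    have ih' := fun A hA => @ih (fun i hi => hseg i (hi.trans n.le_succ)) A hA
    have key := agree_on_obsSigma_succ hX n (ν := P.restrict (times θ₁ θ₂ ⁻¹' {d'}))
      (ν' := c • P.restrict (times θ₁ θ₂ ⁻¹' {d})) (fun A B hA hB => ?_) hA
    · rwa [Measure.smul_apply, Measure.restrict_apply (obsSigma_le hX _ _ hA),
        Measure.restrict_apply (obsSigma_le hX _ _ hA)] at key
    · have hAB : MeasurableSet (A ∩ X (n + 1) ⁻¹' B) :=
        (obsSigma_le hX _ _ hA).inter (hX _ hB)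
      have htr : ∀ d, P.restrict (times θ₁ θ₂ ⁻¹' {d}) (A ∩ X (n + 1) ⁻¹' B) =
          ∫⁻ ω in A, (∫⁻ u in B, ENNReal.ofReal (M.f (segment d.1 d.2 (n + 1)) (X n ω) u) ∂M.μ)
            ∂(P.restrict (times θ₁ θ₂ ⁻¹' {d})) := by
        intro d
        rw [Measure.restrict_apply hAB, Measure.restrict_restrict (obsSigma_le hX _ _ hA),
          times_preimage_singleton, ← hM.transition n d.1 d.2 A hA B hB, Set.inter_right_comm]
      have hg : Measurable[obsSigma X n] fun ω => ∫⁻ u in B,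
          ENNReal.ofReal (M.f (segment d.1 d.2 (n + 1)) (X n ω) u) ∂M.μ :=
        ((M.f_measurable _).ennreal_ofReal.lintegral_prod_right'
          (ν := M.μ.restrict B)).comp (measurable_obs le_rfl)
      rw [Measure.smul_apply, htr d', htr d, hseg _ le_rfl]
      rw [setLIntegral_congr_of_agree (obsSigma_le hX n)
        (ν' := c • P.restrict (times θ₁ θ₂ ⁻¹' {d})) (fun A hA => ?_) hg hA,
        Measure.restrict_smul, lintegral_smul_measure]
      rw [Measure.smul_apply, Measure.restrict_apply (obsSigma_le hX _ _ hA),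
        Measure.restrict_apply (obsSigma_le hX _ _ hA)]
      exact ih' A hA

theorem measure_inter_image (hM : M.IsModel x P θ₁ θ₂ X) (hX : ∀ n, Measurable (X n))
    {D : Set (ℕ × ℕ)} {e : ℕ × ℕ → ℕ × ℕ} (he : Set.InjOn e D) {c : ℝ} (hc : 0 ≤ c)
    (hw : ∀ d ∈ D, M.prior₁ (e d).1 * M.prior₂ (e d).1 (e d).2
      = c * (M.prior₁ d.1 * M.prior₂ d.1 d.2)) (n : ℕ)
    (hseg : ∀ d ∈ D, ∀ i ≤ n, segment (e d).1 (e d).2 i = segment d.1 d.2 i) {A : Set Ω}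
    (hA : MeasurableSet[obsSigma X n] A) :
    P (A ∩ times θ₁ θ₂ ⁻¹' (e '' D)) = ENNReal.ofReal c * P (A ∩ times θ₁ θ₂ ⁻¹' D) := by
  have hA' := obsSigma_le hX _ _ hA
  have key := measure_preimage_image_eq hM.measurable_times (ν := P.restrict A)
    (ν' := ENNReal.ofReal c • P.restrict A) he fun d hd => ?_
  · rwa [Measure.smul_apply, Measure.restrict_apply' hA', Measure.restrict_apply' hA',
      Set.inter_comm, Set.inter_comm _ A] at key
  · rw [Measure.smul_apply, Measure.restrict_apply' hA', Measure.restrict_apply' hA',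
      Set.inter_comm, Set.inter_comm _ A]
    refine hM.measure_inter_times hX ?_ n (hseg d hd) hA
    rw [hw d hd, ENNReal.ofReal_mul hc]

end Params.IsModel
end TwoDisorders

namespace TwoDisorders

/-! ### One step of the disorder times given the observations -/

namespace Params.IsModel

variable {E Ω : Type*} [MeasurableSpace E] [MeasurableSpace Ω] {M : Params E} {x : E}
  {P : Measure Ω} {θ₁ θ₂ : Ω → ℕ} {X : ℕ → Ω → E}

theorem measurableSet_times (hM : M.IsModel x P θ₁ θ₂ X) (D : Set (ℕ × ℕ)) :
    MeasurableSet (times θ₁ θ₂ ⁻¹' D) :=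
  hM.measurable_times D.to_countable.measurableSet

theorem measure_inter_union (hM : M.IsModel x P θ₁ θ₂ X) (A : Set Ω) {D D₁ D₂ : Set (ℕ × ℕ)}
    (h : D = D₁ ∪ D₂) (hd : Disjoint D₁ D₂) : P (A ∩ times θ₁ θ₂ ⁻¹' D)
      = P (A ∩ times θ₁ θ₂ ⁻¹' D₁) + P (A ∩ times θ₁ θ₂ ⁻¹' D₂) := by
  rw [h, Set.preimage_union, Set.inter_comm, Set.inter_comm A, Set.inter_comm A,
    ← Measure.restrict_apply (hM.measurableSet_times D₁),
    ← Measure.restrict_apply (hM.measurableSet_times D₂), ← Set.preimage_union,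
    ← Measure.restrict_apply (hM.measurableSet_times _), Set.preimage_union]
  exact measure_union (hd.preimage _) (hM.measurableSet_times D₂)

/-- The partition by the segment of the observation number `n`. -/
theorem setLIntegral_eq_add (hM : M.IsModel x P θ₁ θ₂ X) (n : ℕ) {A : Set Ω}
    (hA : MeasurableSet A) (g : Ω → ENNReal) :
    ∫⁻ ω in A, g ω ∂P = ∫⁻ ω in A ∩ times θ₁ θ₂ ⁻¹' before n, g ω ∂P
      + (∫⁻ ω in A ∩ times θ₁ θ₂ ⁻¹' between n, g ω ∂P
        + ∫⁻ ω in A ∩ times θ₁ θ₂ ⁻¹' after n, g ω ∂P) := by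
  have hmD := hM.measurableSet_times
  have hsplit : A =ᵐ[P] (A ∩ times θ₁ θ₂ ⁻¹' before n
      ∪ (A ∩ times θ₁ θ₂ ⁻¹' between n ∪ A ∩ times θ₁ θ₂ ⁻¹' after n) : Set Ω) := by
    rw [← Set.inter_union_distrib_left, ← Set.inter_union_distrib_left]
    refine (inter_ae_eq_left_of_ae_eq_univ ?_).symm
    rw [ae_eq_univ, ← Set.preimage_union, ← Set.preimage_union]
    refine measure_mono_null (fun ω hω (hle : θ₁ ω ≤ θ₂ ω) => hω ?_) (ae_iff.1 hM.ae_le)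
    simp only [times, before, between, after, Set.mem_preimage, Set.mem_union,
      Set.mem_ofPred_eq]
    omega
  have hd1 : Disjoint (A ∩ times θ₁ θ₂ ⁻¹' between n) (A ∩ times θ₁ θ₂ ⁻¹' after n) := by
    rw [Set.disjoint_left]
    rintro ω ⟨_, h1⟩ ⟨_, h2⟩
    exact absurd h1.2 (not_lt.2 h2.2)
  have hd2 : Disjoint (A ∩ times θ₁ θ₂ ⁻¹' before n)
      (A ∩ times θ₁ θ₂ ⁻¹' between n ∪ A ∩ times θ₁ θ₂ ⁻¹' after n) := by
    rw [Set.disjoint_left]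
    rintro ω ⟨_, h1⟩ (⟨_, h2⟩ | ⟨_, h2⟩)
    · exact absurd h1.1 (not_lt.2 h2.1)
    · exact absurd h1.1 (not_lt.2 (h2.1.trans h2.2))
  rw [setLIntegral_congr hsplit, lintegral_union ((hA.inter (hmD _)).union (hA.inter (hmD _)))
    hd2, lintegral_union (hA.inter (hmD _)) hd1]

theorem measure_after_zero (hM : M.IsModel x P θ₁ θ₂ X) :
    P (times θ₁ θ₂ ⁻¹' after 0) = ENNReal.ofReal (M.ρ * M.π) := by
  have hs : after 0 = {(0, 0)} := by
    ext ⟨j, k⟩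
    simp only [after, Set.mem_ofPred_eq, Set.mem_singleton_iff, Prod.mk.injEq]
    omega
  rw [hs, hM.measure_times]
  simp [prior₁, prior₂, mul_comm]

variable [IsProbabilityMeasure P]

/-- The complementary part of an event that keeps the proportion `c` of its mass. -/
theorem measure_inter_complement (hM : M.IsModel x P θ₁ θ₂ X) (A : Set Ω)
    {D D₁ D₂ : Set (ℕ × ℕ)} (h : D = D₁ ∪ D₂) (hd : Disjoint D₁ D₂) {c c' : ℝ} (hc : 0 ≤ c)
    (hc' : 0 ≤ c') (hcc : c + c' = 1)
    (h₁ : P (A ∩ times θ₁ θ₂ ⁻¹' D₁) = ENNReal.ofReal c * P (A ∩ times θ₁ θ₂ ⁻¹' D)) :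
    P (A ∩ times θ₁ θ₂ ⁻¹' D₂) = ENNReal.ofReal c' * P (A ∩ times θ₁ θ₂ ⁻¹' D) := by
  have h1 := hM.measure_inter_union A h hd
  have h2 : ENNReal.ofReal c + ENNReal.ofReal c' = 1 := by
    rw [← ENNReal.ofReal_add hc hc', hcc, ENNReal.ofReal_one]
  have h3 : P (A ∩ times θ₁ θ₂ ⁻¹' D₁) + P (A ∩ times θ₁ θ₂ ⁻¹' D₂)
      = P (A ∩ times θ₁ θ₂ ⁻¹' D₁) + ENNReal.ofReal c' * P (A ∩ times θ₁ θ₂ ⁻¹' D) := by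
    rw [← h1, h₁, ← add_mul, h2, one_mul]
  exact (ENNReal.add_right_inj (measure_ne_top _ _)).1 h3

/-- The geometric law of `θ₁`: before `θ₁` both disorder times can be shifted by one. -/
theorem measure_inter_shift (hM : M.IsModel x P θ₁ θ₂ X) (hX : ∀ n, Measurable (X n)) {n : ℕ}
    {D D' : Set (ℕ × ℕ)} (hD : ∀ d ∈ D, n < d.1 ∧ d.1 ≤ d.2)
    (hD' : D' = (fun d => (d.1 + 1, d.2 + 1)) '' D) {A : Set Ω}
    (hA : MeasurableSet[obsSigma X n] A) :
    P (A ∩ times θ₁ θ₂ ⁻¹' D') = ENNReal.ofReal M.p₁ * P (A ∩ times θ₁ θ₂ ⁻¹' D) := by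
  rw [hD']
  refine hM.measure_inter_image hX (fun d _ d' _ h => ?_) M.p₁_nonneg (fun d hd => ?_) n
    (fun d hd i hi => ?_) hA
  · simpa [Prod.ext_iff] using h
  · obtain ⟨j, k⟩ := d
    obtain ⟨j, rfl⟩ : ∃ i, j = i + 1 := ⟨j - 1, by have := (hD _ hd).1; dsimp only at this; omega⟩
    simp only [prior₁, prior₂, Nat.add_right_cancel_iff, Nat.add_lt_add_iff_right,
      Nat.add_sub_add_right, Nat.add_eq_zero_iff, one_ne_zero, and_false, if_false,
      Nat.add_sub_cancel, pow_succ]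
    ring
  · have := hD d hd
    simp only [segment]
    rw [if_pos (by omega), if_pos (by omega)]

theorem measure_before_succ (hM : M.IsModel x P θ₁ θ₂ X) (hX : ∀ n, Measurable (X n)) (n : ℕ)
    {A : Set Ω} (hA : MeasurableSet[obsSigma X n] A) :
    P (A ∩ times θ₁ θ₂ ⁻¹' before (n + 1))
      = ENNReal.ofReal M.p₁ * P (A ∩ times θ₁ θ₂ ⁻¹' before n) := by
  refine hM.measure_inter_shift (D := before n) hX (fun d hd => hd) ?_ hA
  ext ⟨j, k⟩
  simp only [before, Set.mem_ofPred_eq, Set.mem_image, Prod.mk.injEq, Prod.exists]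
  exact ⟨fun h => ⟨j - 1, k - 1, by omega⟩, by rintro ⟨j, k, h⟩; omega⟩

theorem measure_beforeLt_succ (hM : M.IsModel x P θ₁ θ₂ X) (hX : ∀ n, Measurable (X n)) (n : ℕ)
    {A : Set Ω} (hA : MeasurableSet[obsSigma X n] A) :
    P (A ∩ times θ₁ θ₂ ⁻¹' beforeLt (n + 1))
      = ENNReal.ofReal M.p₁ * P (A ∩ times θ₁ θ₂ ⁻¹' beforeLt n) := by
  refine hM.measure_inter_shift hX (fun d hd => ⟨hd.1, hd.2.le⟩) ?_ hA
  ext ⟨j, k⟩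
  simp only [beforeLt, Set.mem_ofPred_eq, Set.mem_image, Prod.mk.injEq, Prod.exists]
  exact ⟨fun h => ⟨j - 1, k - 1, by omega⟩, by rintro ⟨j, k, h⟩; omega⟩

theorem measure_beforeEq_succ (hM : M.IsModel x P θ₁ θ₂ X) (hX : ∀ n, Measurable (X n)) (n : ℕ)
    {A : Set Ω} (hA : MeasurableSet[obsSigma X n] A) :
    P (A ∩ times θ₁ θ₂ ⁻¹' beforeEq (n + 1))
      = ENNReal.ofReal M.p₁ * P (A ∩ times θ₁ θ₂ ⁻¹' beforeEq n) := by
  refine hM.measure_inter_shift hX (fun d hd => ⟨hd.2, hd.1.le⟩) ?_ hA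
  ext ⟨j, k⟩
  simp only [beforeEq, Set.mem_ofPred_eq, Set.mem_image, Prod.mk.injEq, Prod.exists]
  exact ⟨fun h => ⟨j - 1, k - 1, by omega⟩, by rintro ⟨j, k, h⟩; omega⟩

/-- Both disorders occur at time `n + 1`. -/
theorem measure_both_succ (hM : M.IsModel x P θ₁ θ₂ X) (hX : ∀ n, Measurable (X n)) (n : ℕ)
    {A : Set Ω} (hA : MeasurableSet[obsSigma X n] A) :
    P (A ∩ times θ₁ θ₂ ⁻¹' {(n + 1, n + 1)})
      = ENNReal.ofReal M.q₁ * P (A ∩ times θ₁ θ₂ ⁻¹' beforeEq n) := by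
  refine hM.measure_inter_complement A (D₁ := beforeEq (n + 1)) ?_ ?_ M.p₁_nonneg M.q₁_nonneg
    M.p₁_add_q₁ (hM.measure_beforeEq_succ hX n hA)
  · ext ⟨j, k⟩
    simp only [beforeEq, Set.mem_ofPred_eq, Set.mem_union, Set.mem_singleton_iff, Prod.mk.injEq]
    omega
  · rw [Set.disjoint_left]
    rintro ⟨j, k⟩
    simp only [beforeEq, Set.mem_ofPred_eq, Set.mem_singleton_iff, Prod.mk.injEq]
    omega

/-- The first disorder occurs at time `n + 1` and the second one later. -/
theorem measure_first_succ (hM : M.IsModel x P θ₁ θ₂ X) (hX : ∀ n, Measurable (X n)) (n : ℕ)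
    {A : Set Ω} (hA : MeasurableSet[obsSigma X n] A) :
    P (A ∩ times θ₁ θ₂ ⁻¹' {d | d.1 = n + 1 ∧ n + 1 < d.2})
      = ENNReal.ofReal M.q₁ * P (A ∩ times θ₁ θ₂ ⁻¹' beforeLt n) := by
  refine hM.measure_inter_complement A (D₁ := beforeLt (n + 1)) ?_ ?_ M.p₁_nonneg M.q₁_nonneg
    M.p₁_add_q₁ (hM.measure_beforeLt_succ hX n hA)
  · ext ⟨j, k⟩
    simp only [beforeLt, Set.mem_ofPred_eq, Set.mem_union]
    omega
  · rw [Set.disjoint_left]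
    rintro ⟨j, k⟩
    simp only [beforeLt, Set.mem_ofPred_eq]
    omega

/-- The second disorder does not occur at time `n + 1`. -/
theorem measure_stay_between (hM : M.IsModel x P θ₁ θ₂ X) (hX : ∀ n, Measurable (X n)) (n : ℕ)
    {A : Set Ω} (hA : MeasurableSet[obsSigma X n] A) :
    P (A ∩ times θ₁ θ₂ ⁻¹' {d | d.1 ≤ n ∧ n + 1 < d.2})
      = ENNReal.ofReal M.p₂ * P (A ∩ times θ₁ θ₂ ⁻¹' between n) := by
  have himg : {d : ℕ × ℕ | d.1 ≤ n ∧ n + 1 < d.2} = (fun d => (d.1, d.2 + 1)) '' between n := by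
    ext ⟨j, k⟩
    simp only [between, Set.mem_ofPred_eq, Set.mem_image, Prod.mk.injEq, Prod.exists]
    exact ⟨fun h => ⟨j, k - 1, by omega⟩, by rintro ⟨j, k, h⟩; omega⟩
  rw [himg]
  refine hM.measure_inter_image hX (fun d _ d' _ h => ?_) M.p₂_nonneg (fun d hd => ?_) n
    (fun d hd i hi => ?_) hA
  · simpa [Prod.ext_iff] using h
  · obtain ⟨j, k⟩ := d
    have hd : j ≤ n ∧ n < k := hd
    simp only [prior₂]
    rw [if_neg (by omega), if_pos (by omega), if_neg (by omega), if_pos (by omega),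
      show k + 1 - j - 1 = (k - j - 1) + 1 by omega, pow_succ]
    ring
  · have hd : d.1 ≤ n ∧ n < d.2 := hd
    simp only [segment]
    split_ifs <;> first | rfl | omega

/-- The second disorder, after the first one, occurs at time `n + 1`. -/
theorem measure_second_succ (hM : M.IsModel x P θ₁ θ₂ X) (hX : ∀ n, Measurable (X n)) (n : ℕ)
    {A : Set Ω} (hA : MeasurableSet[obsSigma X n] A) :
    P (A ∩ times θ₁ θ₂ ⁻¹' {d | d.1 ≤ n ∧ d.2 = n + 1})
      = ENNReal.ofReal M.q₂ * P (A ∩ times θ₁ θ₂ ⁻¹' between n) := by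
  refine hM.measure_inter_complement A (D₁ := {d | d.1 ≤ n ∧ n + 1 < d.2}) ?_ ?_ M.p₂_nonneg
    M.q₂_nonneg M.p₂_add_q₂ (hM.measure_stay_between hX n hA)
  · ext ⟨j, k⟩
    simp only [between, Set.mem_ofPred_eq, Set.mem_union]
    omega
  · rw [Set.disjoint_left]
    rintro ⟨j, k⟩
    simp only [Set.mem_ofPred_eq]
    omega

theorem measure_between_succ (hM : M.IsModel x P θ₁ θ₂ X) (hX : ∀ n, Measurable (X n)) (n : ℕ)
    {A : Set Ω} (hA : MeasurableSet[obsSigma X n] A) :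
    P (A ∩ times θ₁ θ₂ ⁻¹' between (n + 1))
      = ENNReal.ofReal M.p₂ * P (A ∩ times θ₁ θ₂ ⁻¹' between n)
        + ENNReal.ofReal M.q₁ * P (A ∩ times θ₁ θ₂ ⁻¹' beforeLt n) := by
  rw [← hM.measure_stay_between hX n hA, ← hM.measure_first_succ hX n hA]
  refine hM.measure_inter_union A ?_ ?_
  · ext ⟨j, k⟩
    simp only [between, Set.mem_ofPred_eq, Set.mem_union]
    omega
  · rw [Set.disjoint_left]
    rintro ⟨j, k⟩
    simp only [Set.mem_ofPred_eq]
    omega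

theorem measure_after_succ (hM : M.IsModel x P θ₁ θ₂ X) (hX : ∀ n, Measurable (X n)) (n : ℕ)
    {A : Set Ω} (hA : MeasurableSet[obsSigma X n] A) :
    P (A ∩ times θ₁ θ₂ ⁻¹' after (n + 1))
      = P (A ∩ times θ₁ θ₂ ⁻¹' after n)
        + (ENNReal.ofReal M.q₂ * P (A ∩ times θ₁ θ₂ ⁻¹' between n)
        + ENNReal.ofReal M.q₁ * P (A ∩ times θ₁ θ₂ ⁻¹' beforeEq n)) := by
  rw [← hM.measure_second_succ hX n hA, ← hM.measure_both_succ hX n hA,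
    ← hM.measure_inter_union A rfl]
  · refine hM.measure_inter_union A ?_ ?_
    · ext ⟨j, k⟩
      simp only [after, Set.mem_ofPred_eq, Set.mem_union, Set.mem_singleton_iff, Prod.mk.injEq]
      omega
    · rw [Set.disjoint_left]
      rintro ⟨j, k⟩
      simp only [after, Set.mem_ofPred_eq, Set.mem_union, Set.mem_singleton_iff, Prod.mk.injEq]
      omega
  · rw [Set.disjoint_left]
    rintro ⟨j, k⟩
    simp only [Set.mem_ofPred_eq, Set.mem_singleton_iff, Prod.mk.injEq]
    omega

/-! ### The prior values of the posterior probabilities -/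

/-- The series over the pairs `(j, j)` need not be summed: the pair `(1, 1)` has the proportion
`q₁ > 0` of the mass. -/
theorem measure_beforeEq_zero (hM : M.IsModel x P θ₁ θ₂ X) (hX : ∀ n, Measurable (X n)) :
    P (times θ₁ θ₂ ⁻¹' beforeEq 0) = ENNReal.ofReal (M.ρ * (1 - M.π)) := by
  have h := hM.measure_both_succ hX 0 MeasurableSet.univ
  rw [Set.univ_inter, Set.univ_inter, hM.measure_times] at h
  have hw : M.prior₁ 1 * M.prior₂ 1 1 = M.q₁ * (M.ρ * (1 - M.π)) := by
    simp [prior₁, prior₂]; ring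
  have hq : 0 < M.q₁ := sub_pos.2 M.p₁_mem.2
  simp only [zero_add] at h
  rw [hw, ENNReal.ofReal_mul hq.le] at h
  exact ((ENNReal.mul_right_inj (ENNReal.ofReal_pos.2 hq).ne' ENNReal.ofReal_ne_top).1 h).symm

theorem measure_between_zero (hM : M.IsModel x P θ₁ θ₂ X) (hX : ∀ n, Measurable (X n)) :
    P (times θ₁ θ₂ ⁻¹' between 0) = ENNReal.ofReal (M.π * (1 - M.ρ)) := by
  have h := hM.measure_second_succ hX 0 MeasurableSet.univ
  have hs : {d : ℕ × ℕ | d.1 ≤ 0 ∧ d.2 = 0 + 1} = {(0, 1)} := by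
    ext ⟨j, k⟩
    simp
  rw [Set.univ_inter, Set.univ_inter, hs, hM.measure_times] at h
  have hw : M.prior₁ 0 * M.prior₂ 0 1 = M.q₂ * (M.π * (1 - M.ρ)) := by
    simp [prior₁, prior₂]; ring
  have hq : 0 < M.q₂ := sub_pos.2 M.p₂_mem.2
  simp only at h
  rw [hw, ENNReal.ofReal_mul hq.le] at h
  exact ((ENNReal.mul_right_inj (ENNReal.ofReal_pos.2 hq).ne' ENNReal.ofReal_ne_top).1 h).symm

end Params.IsModel
end TwoDisorders

namespace TwoDisorders

/-! ### Posterior probabilities as densities -/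

namespace IsPosterior

variable {E Ω : Type*} [MeasurableSpace E] [MeasurableSpace Ω] {M : Params E} {x : E}
  {P : Measure Ω} {θ₁ θ₂ : Ω → ℕ} {X : ℕ → Ω → E}
  {hX : ∀ n, Measurable (X n)} {Ψ : ℕ → Ω → ℝ × ℝ × ℝ}

theorem indicator_times {Ω : Type*} {θ₁ θ₂ : Ω → ℕ} (D : Set (ℕ × ℕ)) (ω : Ω) :
    (times θ₁ θ₂ ⁻¹' D).indicator (fun _ => (1 : ℝ)) ω
      = D.indicator (fun _ => (1 : ℝ)) (θ₁ ω, θ₂ ω) := rfl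

theorem measurable (hΨ : IsPosterior P (obsFiltration X hX) θ₁ θ₂ Ψ) (n : ℕ) :
    Measurable[obsSigma X n] (Ψ n) := hΨ.adapted n

theorem measurable' (hΨ : IsPosterior P (obsFiltration X hX) θ₁ θ₂ Ψ) (n : ℕ) :
    Measurable (Ψ n) := (hΨ.measurable n).mono (obsSigma_le hX n) le_rfl

theorem eq_condExp_beforeEq (hΨ : IsPosterior P (obsFiltration X hX) θ₁ θ₂ Ψ) (n : ℕ) :
    (fun ω => (Ψ n ω).2.2)
      =ᵐ[P] P[(times θ₁ θ₂ ⁻¹' beforeEq n).indicator (fun _ => (1 : ℝ)) | obsSigma X n] :=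
  hΨ.trd n

theorem eq_condExp_after (hM : M.IsModel x P θ₁ θ₂ X)
    (hΨ : IsPosterior P (obsFiltration X hX) θ₁ θ₂ Ψ) (n : ℕ) :
    (fun ω => (Ψ n ω).2.1)
      =ᵐ[P] P[(times θ₁ θ₂ ⁻¹' after n).indicator (fun _ => (1 : ℝ)) | obsSigma X n] := by
  refine (hΨ.snd n).trans (condExp_congr_ae ?_)
  filter_upwards [hM.ae_le] with ω h
  simp only [indicator_times, Set.indicator_apply, Set.mem_ofPred_eq, after, h, true_and]

variable [IsProbabilityMeasure P]

theorem eq_condExp_before (hM : M.IsModel x P θ₁ θ₂ X)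
    (hΨ : IsPosterior P (obsFiltration X hX) θ₁ θ₂ Ψ) (n : ℕ) :
    (fun ω => 1 - (Ψ n ω).1)
      =ᵐ[P] P[(times θ₁ θ₂ ⁻¹' before n).indicator (fun _ => (1 : ℝ)) | obsSigma X n] := by
  have hs : MeasurableSet {ω | θ₁ ω ≤ n} := hM.measurable_θ₁ measurableSet_Iic
  have h1 : (times θ₁ θ₂ ⁻¹' before n).indicator (fun _ => (1 : ℝ))
      =ᵐ[P] (fun _ => (1 : ℝ)) - {ω | θ₁ ω ≤ n}.indicator (fun _ => (1 : ℝ)) := by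
    filter_upwards [hM.ae_le] with ω h
    simp only [indicator_times, Set.indicator_apply, before, Set.mem_ofPred_eq, Pi.sub_apply]
    split_ifs <;> first | omega | norm_num
  have h2 := condExp_sub (m₀ := inferInstance) (μ := P) (integrable_const (1 : ℝ))
    ((integrable_const (1 : ℝ)).indicator hs) (obsSigma X n)
  rw [condExp_const (obsSigma_le hX n)] at h2
  refine EventuallyEq.trans ?_ ((condExp_congr_ae h1).trans h2).symm
  filter_upwards [hΨ.fst n] with ω h
  simp only [Pi.sub_apply]
  rw [h]
  rfl

theorem eq_condExp_beforeLt (hM : M.IsModel x P θ₁ θ₂ X)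
    (hΨ : IsPosterior P (obsFiltration X hX) θ₁ θ₂ Ψ) (n : ℕ) :
    (fun ω => 1 - (Ψ n ω).1 - (Ψ n ω).2.2)
      =ᵐ[P] P[(times θ₁ θ₂ ⁻¹' beforeLt n).indicator (fun _ => (1 : ℝ)) | obsSigma X n] := by
  have hi : ∀ D, Integrable ((times θ₁ θ₂ ⁻¹' D).indicator (fun _ => (1 : ℝ))) P := fun D =>
    (integrable_const (1 : ℝ)).indicator (hM.measurableSet_times D)
  have h1 : (times θ₁ θ₂ ⁻¹' beforeLt n).indicator (fun _ => (1 : ℝ))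
      = (times θ₁ θ₂ ⁻¹' before n).indicator (fun _ => (1 : ℝ))
        - (times θ₁ θ₂ ⁻¹' beforeEq n).indicator (fun _ => (1 : ℝ)) := by
    ext ω
    simp only [indicator_times, Set.indicator_apply, before, beforeEq, beforeLt,
      Set.mem_ofPred_eq, Pi.sub_apply]
    split_ifs <;> first | omega | norm_num
  rw [h1]
  refine EventuallyEq.trans ?_ (condExp_sub (hi _) (hi _) (obsSigma X n)).symm
  filter_upwards [hΨ.eq_condExp_before hM n, hΨ.eq_condExp_beforeEq n] with ω h h'
  rw [Pi.sub_apply, ← h, ← h']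

theorem eq_condExp_between (hM : M.IsModel x P θ₁ θ₂ X)
    (hΨ : IsPosterior P (obsFiltration X hX) θ₁ θ₂ Ψ) (n : ℕ) :
    (fun ω => (Ψ n ω).1 - (Ψ n ω).2.1)
      =ᵐ[P] P[(times θ₁ θ₂ ⁻¹' between n).indicator (fun _ => (1 : ℝ)) | obsSigma X n] := by
  have hs : MeasurableSet {ω | θ₁ ω ≤ n} := hM.measurable_θ₁ measurableSet_Iic
  have hs' : MeasurableSet {ω | θ₂ ω ≤ n} := hM.measurable_θ₂ measurableSet_Iic
  have h1 : (times θ₁ θ₂ ⁻¹' between n).indicator (fun _ => (1 : ℝ))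
      =ᵐ[P] {ω | θ₁ ω ≤ n}.indicator (fun _ => (1 : ℝ))
        - {ω | θ₂ ω ≤ n}.indicator (fun _ => (1 : ℝ)) := by
    filter_upwards [hM.ae_le] with ω h
    simp only [indicator_times, Set.indicator_apply, between, Set.mem_ofPred_eq, Pi.sub_apply]
    split_ifs <;> first | omega | norm_num
  have h2 := condExp_sub (m₀ := inferInstance) (μ := P) ((integrable_const (1 : ℝ)).indicator hs)
    ((integrable_const (1 : ℝ)).indicator hs') (obsSigma X n)
  refine EventuallyEq.trans ?_ ((condExp_congr_ae h1).trans h2).symm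
  filter_upwards [hΨ.fst n, hΨ.snd n] with ω h h'
  simp only [Pi.sub_apply]
  rw [h, h']
  rfl

theorem density_before (hM : M.IsModel x P θ₁ θ₂ X)
    (hΨ : IsPosterior P (obsFiltration X hX) θ₁ θ₂ Ψ) (n : ℕ) {A : Set Ω}
    (hA : MeasurableSet[obsSigma X n] A) :
    P (A ∩ times θ₁ θ₂ ⁻¹' before n) = ∫⁻ ω in A, ENNReal.ofReal (1 - (Ψ n ω).1) ∂P :=
  (density_of_eq_condExp (obsSigma_le hX n) (hM.measurableSet_times _)
    (hΨ.eq_condExp_before hM n)).2 A hA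

theorem density_beforeLt (hM : M.IsModel x P θ₁ θ₂ X)
    (hΨ : IsPosterior P (obsFiltration X hX) θ₁ θ₂ Ψ) (n : ℕ) {A : Set Ω}
    (hA : MeasurableSet[obsSigma X n] A) :
    P (A ∩ times θ₁ θ₂ ⁻¹' beforeLt n)
      = ∫⁻ ω in A, ENNReal.ofReal (1 - (Ψ n ω).1 - (Ψ n ω).2.2) ∂P :=
  (density_of_eq_condExp (obsSigma_le hX n) (hM.measurableSet_times _)
    (hΨ.eq_condExp_beforeLt hM n)).2 A hA

theorem density_beforeEq (hM : M.IsModel x P θ₁ θ₂ X)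
    (hΨ : IsPosterior P (obsFiltration X hX) θ₁ θ₂ Ψ) (n : ℕ) {A : Set Ω}
    (hA : MeasurableSet[obsSigma X n] A) :
    P (A ∩ times θ₁ θ₂ ⁻¹' beforeEq n) = ∫⁻ ω in A, ENNReal.ofReal (Ψ n ω).2.2 ∂P :=
  (density_of_eq_condExp (obsSigma_le hX n) (hM.measurableSet_times _)
    (hΨ.eq_condExp_beforeEq n)).2 A hA

theorem density_between (hM : M.IsModel x P θ₁ θ₂ X)
    (hΨ : IsPosterior P (obsFiltration X hX) θ₁ θ₂ Ψ) (n : ℕ) {A : Set Ω}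
    (hA : MeasurableSet[obsSigma X n] A) :
    P (A ∩ times θ₁ θ₂ ⁻¹' between n)
      = ∫⁻ ω in A, ENNReal.ofReal ((Ψ n ω).1 - (Ψ n ω).2.1) ∂P :=
  (density_of_eq_condExp (obsSigma_le hX n) (hM.measurableSet_times _)
    (hΨ.eq_condExp_between hM n)).2 A hA

theorem density_after (hM : M.IsModel x P θ₁ θ₂ X)
    (hΨ : IsPosterior P (obsFiltration X hX) θ₁ θ₂ Ψ) (n : ℕ) {A : Set Ω}
    (hA : MeasurableSet[obsSigma X n] A) :
    P (A ∩ times θ₁ θ₂ ⁻¹' after n) = ∫⁻ ω in A, ENNReal.ofReal (Ψ n ω).2.1 ∂P :=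
  (density_of_eq_condExp (obsSigma_le hX n) (hM.measurableSet_times _)
    (hΨ.eq_condExp_after hM n)).2 A hA

theorem ae_adm (hM : M.IsModel x P θ₁ θ₂ X)
    (hΨ : IsPosterior P (obsFiltration X hX) θ₁ θ₂ Ψ) (n : ℕ) : ∀ᵐ ω ∂P, Adm (Ψ n ω) := by
  have hle := obsSigma_le hX n
  filter_upwards [(density_of_eq_condExp hle (hM.measurableSet_times _)
      (hΨ.eq_condExp_after hM n)).1,
    (density_of_eq_condExp hle (hM.measurableSet_times _) (hΨ.eq_condExp_between hM n)).1,
    (density_of_eq_condExp hle (hM.measurableSet_times _) (hΨ.eq_condExp_beforeEq n)).1,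
    (density_of_eq_condExp hle (hM.measurableSet_times _) (hΨ.eq_condExp_beforeLt hM n)).1]
    with ω h1 h2 h3 h4
  simp only [Pi.zero_apply] at h1 h2 h3 h4
  exact ⟨h1, by linarith, h3, by linarith⟩

/-! ### The joint law of the next observation and the disorder times -/

theorem next_before (hM : M.IsModel x P θ₁ θ₂ X)
    (hΨ : IsPosterior P (obsFiltration X hX) θ₁ θ₂ Ψ) (n : ℕ) {A : Set Ω}
    (hA : MeasurableSet[obsSigma X n] A) :
    P (A ∩ times θ₁ θ₂ ⁻¹' before (n + 1))
      = ∫⁻ ω in A, ENNReal.ofReal ((1 - (Ψ n ω).1) * M.p₁) ∂P := by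
  have hm := hΨ.measurable' n
  rw [hM.measure_before_succ hX n hA, hΨ.density_before hM n hA,
    ← lintegral_const_mul _ (by fun_prop)]
  refine lintegral_congr fun ω => ?_
  rw [← ENNReal.ofReal_mul M.p₁_nonneg, mul_comm]

theorem next_beforeEq (hM : M.IsModel x P θ₁ θ₂ X)
    (hΨ : IsPosterior P (obsFiltration X hX) θ₁ θ₂ Ψ) (n : ℕ) {A : Set Ω}
    (hA : MeasurableSet[obsSigma X n] A) :
    P (A ∩ times θ₁ θ₂ ⁻¹' beforeEq (n + 1))
      = ∫⁻ ω in A, ENNReal.ofReal (M.p₁ * (Ψ n ω).2.2) ∂P := by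
  have hm := hΨ.measurable' n
  rw [hM.measure_beforeEq_succ hX n hA, hΨ.density_beforeEq hM n hA,
    ← lintegral_const_mul _ (by fun_prop)]
  refine lintegral_congr fun ω => ?_
  rw [← ENNReal.ofReal_mul M.p₁_nonneg]

theorem next_between (hM : M.IsModel x P θ₁ θ₂ X)
    (hΨ : IsPosterior P (obsFiltration X hX) θ₁ θ₂ Ψ) (n : ℕ) {A : Set Ω}
    (hA : MeasurableSet[obsSigma X n] A) :
    P (A ∩ times θ₁ θ₂ ⁻¹' between (n + 1)) = ∫⁻ ω in A, ENNReal.ofReal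
      (M.p₂ * ((Ψ n ω).1 - (Ψ n ω).2.1) + M.q₁ * (1 - (Ψ n ω).1 - (Ψ n ω).2.2)) ∂P := by
  have hm := hΨ.measurable' n
  rw [hM.measure_between_succ hX n hA, hΨ.density_between hM n hA, hΨ.density_beforeLt hM n hA,
    ← lintegral_const_mul _ (by fun_prop), ← lintegral_const_mul _ (by fun_prop),
    ← lintegral_add_left (by fun_prop)]
  refine lintegral_congr_ae (ae_restrict_of_ae ?_)
  filter_upwards [hΨ.ae_adm hM n] with ω h
  have h1 : 0 ≤ (Ψ n ω).1 - (Ψ n ω).2.1 := sub_nonneg.2 h.2.1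
  have h2 : 0 ≤ 1 - (Ψ n ω).1 - (Ψ n ω).2.2 := sub_nonneg.2 h.2.2.2
  rw [← ENNReal.ofReal_mul M.p₂_nonneg, ← ENNReal.ofReal_mul M.q₁_nonneg,
    ← ENNReal.ofReal_add (mul_nonneg M.p₂_nonneg h1) (mul_nonneg M.q₁_nonneg h2)]

theorem next_after (hM : M.IsModel x P θ₁ θ₂ X)
    (hΨ : IsPosterior P (obsFiltration X hX) θ₁ θ₂ Ψ) (n : ℕ) {A : Set Ω}
    (hA : MeasurableSet[obsSigma X n] A) :
    P (A ∩ times θ₁ θ₂ ⁻¹' after (n + 1)) = ∫⁻ ω in A, ENNReal.ofReal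
      (M.q₂ * (Ψ n ω).1 + M.p₂ * (Ψ n ω).2.1 + M.q₁ * (Ψ n ω).2.2) ∂P := by
  have hm := hΨ.measurable' n
  rw [hM.measure_after_succ hX n hA, hΨ.density_between hM n hA, hΨ.density_beforeEq hM n hA,
    hΨ.density_after hM n hA, ← lintegral_const_mul _ (by fun_prop),
    ← lintegral_const_mul _ (by fun_prop), ← lintegral_add_left (by fun_prop),
    ← lintegral_add_left (by fun_prop)]
  refine lintegral_congr_ae (ae_restrict_of_ae ?_)
  filter_upwards [hΨ.ae_adm hM n] with ω h
  have h1 : 0 ≤ (Ψ n ω).1 - (Ψ n ω).2.1 := sub_nonneg.2 h.2.1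
  have h2 := mul_nonneg M.q₂_nonneg h1
  have h3 := mul_nonneg M.q₁_nonneg h.2.2.1
  rw [← ENNReal.ofReal_mul M.q₂_nonneg, ← ENNReal.ofReal_mul M.q₁_nonneg,
    ← ENNReal.ofReal_add h2 h3, ← ENNReal.ofReal_add h.1 (add_nonneg h2 h3)]
  congr 1
  linear_combination (- (Ψ n ω).2.1) * M.p₂_add_q₂

/-- The joint law of the next observation and an event about the disorder times that determines its
segment, given the past. -/
theorem lintegral_next_of_segment (hM : M.IsModel x P θ₁ θ₂ X)
    (hΨ : IsPosterior P (obsFiltration X hX) θ₁ θ₂ Ψ) {n : ℕ} {D : Set (ℕ × ℕ)} {i : Fin 3}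
    (hseg : ∀ d ∈ D, Params.segment d.1 d.2 (n + 1) = i) {w : ℝ × ℝ × ℝ → ℝ} (hw : Measurable w)
    (hD : ∀ A, MeasurableSet[obsSigma X n] A →
      P (A ∩ times θ₁ θ₂ ⁻¹' D) = ∫⁻ ω in A, ENNReal.ofReal (w (Ψ n ω)) ∂P)
    {A : Set Ω} (hA : MeasurableSet[obsSigma X n] A) {Φ : (E × ℝ × ℝ × ℝ) × E → ENNReal}
    (hΦ : Measurable Φ) :
    ∫⁻ ω in A ∩ times θ₁ θ₂ ⁻¹' D, Φ ((X n ω, Ψ n ω), X (n + 1) ω) ∂P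
      = ∫⁻ ω in A, ∫⁻ u, ENNReal.ofReal (w (Ψ n ω)) * ENNReal.ofReal (M.f i (X n ω) u)
          * Φ ((X n ω, Ψ n ω), u) ∂M.μ ∂P := by
  have hYm : Measurable[obsSigma X n] fun ω => (X n ω, Ψ n ω) :=
    (measurable_obs le_rfl).prodMk (hΨ.measurable n)
  have hle := obsSigma_le hX n
  have hf : Measurable fun q : (E × ℝ × ℝ × ℝ) × E => ENNReal.ofReal (M.f i q.1.1 q.2) :=
    (M.measurable_f_comp i (by fun_prop) (by fun_prop)).ennreal_ofReal
  have hwm : Measurable fun q : (E × ℝ × ℝ × ℝ) × E => ENNReal.ofReal (w q.1.2) :=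
    (hw.comp (by fun_prop)).ennreal_ofReal
  refine lintegral_pair_of_density (ν := P.restrict (A ∩ times θ₁ θ₂ ⁻¹' D))
    (ν' := P.restrict A) (Y := fun ω => (X n ω, Ψ n ω)) (μ := M.μ)
    (κ := fun q => ENNReal.ofReal (w q.1.2) * ENNReal.ofReal (M.f i q.1.1 q.2))
    (hYm.mono hle le_rfl) (hX (n + 1)) (hwm.mul hf) (fun C B hC hB => ?_) hΦ
  have hC' : MeasurableSet[obsSigma X n] ((fun ω => (X n ω, Ψ n ω)) ⁻¹' C) := hYm hC
  set Y := fun ω => (X n ω, Ψ n ω)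
  have hg : Measurable[obsSigma X n] fun ω =>
      ∫⁻ u in B, ENNReal.ofReal (M.f i (X n ω) u) ∂M.μ :=
    ((M.f_measurable _).ennreal_ofReal.lintegral_prod_right'
      (ν := M.μ.restrict B)).comp (measurable_obs le_rfl)
  have hwΨ : Measurable fun ω => ENNReal.ofReal (w (Ψ n ω)) :=
    (hw.comp (hΨ.measurable' n)).ennreal_ofReal
  have hAC := hC'.inter hA
  have e1 : P.restrict (A ∩ times θ₁ θ₂ ⁻¹' D) (Y ⁻¹' C ∩ X (n + 1) ⁻¹' B)
      = P (Y ⁻¹' C ∩ A ∩ times θ₁ θ₂ ⁻¹' D ∩ X (n + 1) ⁻¹' B) := by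
    rw [Measure.restrict_apply ((hle _ hC').inter (hX _ hB))]
    congr 1
    ext ω
    simp only [Set.mem_inter_iff]
    tauto
  rw [e1, hM.transition_of_segment hX hseg hAC hB, ← Measure.restrict_restrict (hle _ hAC),
    setLIntegral_congr_of_agree hle
      (ν' := P.withDensity fun ω => ENNReal.ofReal (w (Ψ n ω))) (fun A hA => ?_) hg hAC,
    setLIntegral_withDensity_eq_setLIntegral_mul _ hwΨ (hg.mono hle le_rfl) (hle _ hAC),
    Measure.restrict_restrict (hle _ hC')]
  · refine lintegral_congr fun ω => ?_
    have hu : Measurable fun u => ENNReal.ofReal (M.f i (X n ω) u) :=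
      (M.measurable_f_comp i measurable_const measurable_id).ennreal_ofReal
    exact (lintegral_const_mul _ hu).symm
  · rw [Measure.restrict_apply (hle _ hA), hD A hA, withDensity_apply _ (hle _ hA)]

theorem lintegral_next_before (hM : M.IsModel x P θ₁ θ₂ X)
    (hΨ : IsPosterior P (obsFiltration X hX) θ₁ θ₂ Ψ) {n : ℕ}
    {A : Set Ω} (hA : MeasurableSet[obsSigma X n] A) {Φ : (E × ℝ × ℝ × ℝ) × E → ENNReal}
    (hΦ : Measurable Φ) :
    ∫⁻ ω in A ∩ times θ₁ θ₂ ⁻¹' before (n + 1), Φ ((X n ω, Ψ n ω), X (n + 1) ω) ∂P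
      = ∫⁻ ω in A, ∫⁻ u, ENNReal.ofReal ((1 - (Ψ n ω).1) * M.p₁)
          * ENNReal.ofReal (M.f 0 (X n ω) u) * Φ ((X n ω, Ψ n ω), u) ∂M.μ ∂P :=
  hΨ.lintegral_next_of_segment hM (w := fun a => (1 - a.1) * M.p₁)
    (fun d hd => if_pos hd.1) (by fun_prop) (fun _ hA => hΨ.next_before hM n hA) hA hΦ

theorem lintegral_next_beforeEq (hM : M.IsModel x P θ₁ θ₂ X)
    (hΨ : IsPosterior P (obsFiltration X hX) θ₁ θ₂ Ψ) {n : ℕ}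
    {A : Set Ω} (hA : MeasurableSet[obsSigma X n] A) {Φ : (E × ℝ × ℝ × ℝ) × E → ENNReal}
    (hΦ : Measurable Φ) :
    ∫⁻ ω in A ∩ times θ₁ θ₂ ⁻¹' beforeEq (n + 1), Φ ((X n ω, Ψ n ω), X (n + 1) ω) ∂P
      = ∫⁻ ω in A, ∫⁻ u, ENNReal.ofReal (M.p₁ * (Ψ n ω).2.2)
          * ENNReal.ofReal (M.f 0 (X n ω) u) * Φ ((X n ω, Ψ n ω), u) ∂M.μ ∂P :=
  hΨ.lintegral_next_of_segment hM (w := fun a => M.p₁ * a.2.2)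
    (fun d hd => if_pos hd.2) (by fun_prop) (fun _ hA => hΨ.next_beforeEq hM n hA) hA hΦ

theorem lintegral_next_between (hM : M.IsModel x P θ₁ θ₂ X)
    (hΨ : IsPosterior P (obsFiltration X hX) θ₁ θ₂ Ψ) {n : ℕ}
    {A : Set Ω} (hA : MeasurableSet[obsSigma X n] A) {Φ : (E × ℝ × ℝ × ℝ) × E → ENNReal}
    (hΦ : Measurable Φ) :
    ∫⁻ ω in A ∩ times θ₁ θ₂ ⁻¹' between (n + 1), Φ ((X n ω, Ψ n ω), X (n + 1) ω) ∂P
      = ∫⁻ ω in A, ∫⁻ u, ENNReal.ofReal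
            (M.p₂ * ((Ψ n ω).1 - (Ψ n ω).2.1) + M.q₁ * (1 - (Ψ n ω).1 - (Ψ n ω).2.2))
          * ENNReal.ofReal (M.f 1 (X n ω) u) * Φ ((X n ω, Ψ n ω), u) ∂M.μ ∂P :=
  hΨ.lintegral_next_of_segment hM
    (w := fun a => M.p₂ * (a.1 - a.2.1) + M.q₁ * (1 - a.1 - a.2.2))
    (fun d hd => (if_neg (not_lt.2 hd.1)).trans (if_pos hd.2)) (by fun_prop)
    (fun _ hA => hΨ.next_between hM n hA) hA hΦ

theorem lintegral_next_after (hM : M.IsModel x P θ₁ θ₂ X)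
    (hΨ : IsPosterior P (obsFiltration X hX) θ₁ θ₂ Ψ) {n : ℕ}
    {A : Set Ω} (hA : MeasurableSet[obsSigma X n] A) {Φ : (E × ℝ × ℝ × ℝ) × E → ENNReal}
    (hΦ : Measurable Φ) :
    ∫⁻ ω in A ∩ times θ₁ θ₂ ⁻¹' after (n + 1), Φ ((X n ω, Ψ n ω), X (n + 1) ω) ∂P
      = ∫⁻ ω in A, ∫⁻ u, ENNReal.ofReal
            (M.q₂ * (Ψ n ω).1 + M.p₂ * (Ψ n ω).2.1 + M.q₁ * (Ψ n ω).2.2)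
          * ENNReal.ofReal (M.f 2 (X n ω) u) * Φ ((X n ω, Ψ n ω), u) ∂M.μ ∂P :=
  hΨ.lintegral_next_of_segment hM
    (w := fun a => M.q₂ * a.1 + M.p₂ * a.2.1 + M.q₁ * a.2.2)
    (fun d hd => (if_neg (not_lt.2 (hd.1.trans hd.2))).trans (if_neg (not_lt.2 hd.2)))
    (by fun_prop) (fun _ hA => hΨ.next_after hM n hA) hA hΦ

/-- Given the past, the next observation has the density `H`. -/
theorem lintegral_next (hM : M.IsModel x P θ₁ θ₂ X)
    (hΨ : IsPosterior P (obsFiltration X hX) θ₁ θ₂ Ψ) {n : ℕ}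
    {A : Set Ω} (hA : MeasurableSet[obsSigma X n] A) {Φ : (E × ℝ × ℝ × ℝ) × E → ENNReal}
    (hΦ : Measurable Φ) :
    ∫⁻ ω in A, Φ ((X n ω, Ψ n ω), X (n + 1) ω) ∂P
      = ∫⁻ ω in A, ∫⁻ u, ENNReal.ofReal (M.H (X n ω) u (Ψ n ω))
          * Φ ((X n ω, Ψ n ω), u) ∂M.μ ∂P := by
  have hY : Measurable fun ω => (X n ω, Ψ n ω) := (hX n).prodMk (hΨ.measurable' n)
  have hm : ∀ (i : Fin 3) (w : ℝ × ℝ × ℝ → ℝ), Measurable w →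
      Measurable fun ω => ∫⁻ u, ENNReal.ofReal (w (Ψ n ω))
        * ENNReal.ofReal (M.f i (X n ω) u) * Φ ((X n ω, Ψ n ω), u) ∂M.μ := fun i w hw => by
    have hq : Measurable fun q : (E × ℝ × ℝ × ℝ) × E => ENNReal.ofReal (w q.1.2)
        * ENNReal.ofReal (M.f i q.1.1 q.2) * Φ q :=
      ((hw.comp (by fun_prop)).ennreal_ofReal.mul
        (M.measurable_f_comp i (by fun_prop) (by fun_prop)).ennreal_ofReal).mul hΦ
    exact hq.lintegral_prod_right'.comp hY
  have m0 := hm 0 (fun a => (1 - a.1) * M.p₁) (by fun_prop)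
  have m1 := hm 1 (fun a => M.p₂ * (a.1 - a.2.1) + M.q₁ * (1 - a.1 - a.2.2)) (by fun_prop)
  rw [hM.setLIntegral_eq_add (n + 1) (obsSigma_le hX _ _ hA), hΨ.lintegral_next_before hM hA hΦ,
    hΨ.lintegral_next_between hM hA hΦ, hΨ.lintegral_next_after hM hA hΦ,
    ← lintegral_add_left m1, ← lintegral_add_left m0]
  refine lintegral_congr_ae (ae_restrict_of_ae ?_)
  filter_upwards [hΨ.ae_adm hM n] with ω h
  exact (Params.lintegral_H_mul_eq_add h _ (hΦ.comp measurable_prodMk_left)).symm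

/-! ### Bayes' formula -/

/-- If `g (post) * H = w * f i` is the density of the next observation together with an event about
the disorder times, then `g (post)` is the posterior probability of the event. -/
theorem eq_condExp_post (hM : M.IsModel x P θ₁ θ₂ X)
    (hΨ : IsPosterior P (obsFiltration X hX) θ₁ θ₂ Ψ) {n : ℕ} {D : Set (ℕ × ℕ)} {i : Fin 3}
    {w g : ℝ × ℝ × ℝ → ℝ} (hg : Measurable g) (hgnn : ∀ a, Adm a → 0 ≤ g a)
    (hwnn : ∀ a, Adm a → 0 ≤ w a)
    (hgw : ∀ z u a, Adm a → g (M.post z u a) * M.H z u a = w a * M.f i z u)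
    (hD : ∀ A, MeasurableSet[obsSigma X n] A → ∀ Φ : (E × ℝ × ℝ × ℝ) × E → ENNReal,
      Measurable Φ → ∫⁻ ω in A ∩ times θ₁ θ₂ ⁻¹' D, Φ ((X n ω, Ψ n ω), X (n + 1) ω) ∂P
      = ∫⁻ ω in A, ∫⁻ u, ENNReal.ofReal (w (Ψ n ω)) * ENNReal.ofReal (M.f i (X n ω) u)
          * Φ ((X n ω, Ψ n ω), u) ∂M.μ ∂P) :
    (fun ω => g (M.post (X n ω) (X (n + 1) ω) (Ψ n ω)))
      =ᵐ[P] P[(times θ₁ θ₂ ⁻¹' D).indicator (fun _ => (1 : ℝ)) | obsSigma X (n + 1)] := by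
  have hle := obsSigma_le hX (n + 1)
  have hmono : obsSigma X n ≤ obsSigma X (n + 1) := (obsFiltration X hX).mono n.le_succ
  have hgm : Measurable[obsSigma X (n + 1)]
      fun ω => g (M.post (X n ω) (X (n + 1) ω) (Ψ n ω)) :=
    hg.comp (@Params.measurable_post_comp E _ M Ω (obsSigma X (n + 1)) _ _ _
      (measurable_obs n.le_succ) (measurable_obs le_rfl) ((hΨ.measurable n).mono hmono le_rfl))
  have hgm' := hgm.mono hle le_rfl
  refine eq_condExp_of_density hle (hM.measurableSet_times D) hgm ?_ fun A hA => ?_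
  · filter_upwards [hΨ.ae_adm hM n] with ω h using hgnn _ (Params.adm_post _ _ h)
  rw [← Measure.restrict_apply (hle _ hA), ← withDensity_apply _ (hle _ hA)]
  refine agree_on_obsSigma_succ hX n (fun A B hA hB => ?_) hA
  have hA' := obsSigma_le hX n _ hA
  have hB' := hX (n + 1) hB
  have hΦ1 : Measurable fun q : (E × ℝ × ℝ × ℝ) × E => B.indicator (fun _ => (1 : ENNReal)) q.2 :=
    (measurable_const.indicator hB).comp measurable_snd
  have hgq : Measurable fun q : (E × ℝ × ℝ × ℝ) × E =>
      ENNReal.ofReal (g (M.post q.1.1 q.2 q.1.2)) :=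
    (hg.comp (M.measurable_post_comp (by fun_prop) (by fun_prop) (by fun_prop))).ennreal_ofReal
  have e1 := hD A hA _ hΦ1
  have e2 := hΨ.lintegral_next hM hA (hgq.mul hΦ1)
  have l1 : P.restrict (times θ₁ θ₂ ⁻¹' D) (A ∩ X (n + 1) ⁻¹' B)
      = ∫⁻ ω in A ∩ times θ₁ θ₂ ⁻¹' D,
          B.indicator (fun _ => (1 : ENNReal)) (X (n + 1) ω) ∂P := by
    have : (fun ω => B.indicator (fun _ => (1 : ENNReal)) (X (n + 1) ω))
        = (X (n + 1) ⁻¹' B).indicator fun _ => 1 := rfl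
    rw [this, lintegral_indicator hB', setLIntegral_one, Measure.restrict_apply hB',
      Measure.restrict_apply (hA'.inter hB')]
    congr 1
    ext ω
    simp only [Set.mem_inter_iff]
    tauto
  have l2 : P.withDensity (fun ω =>
        ENNReal.ofReal (g (M.post (X n ω) (X (n + 1) ω) (Ψ n ω)))) (A ∩ X (n + 1) ⁻¹' B)
      = ∫⁻ ω in A, ENNReal.ofReal (g (M.post (X n ω) (X (n + 1) ω) (Ψ n ω)))
          * B.indicator (fun _ => (1 : ENNReal)) (X (n + 1) ω) ∂P := by
    have : (fun ω => ENNReal.ofReal (g (M.post (X n ω) (X (n + 1) ω) (Ψ n ω)))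
          * B.indicator (fun _ => (1 : ENNReal)) (X (n + 1) ω))
        = (X (n + 1) ⁻¹' B).indicator
          fun ω => ENNReal.ofReal (g (M.post (X n ω) (X (n + 1) ω) (Ψ n ω))) := by
      ext ω
      by_cases h : X (n + 1) ω ∈ B <;> simp [h]
    rw [this, lintegral_indicator hB', withDensity_apply _ (hA'.inter hB'),
      Measure.restrict_restrict hB', Set.inter_comm]
  rw [l1, l2]
  refine e1.trans (Eq.trans ?_ e2.symm)
  refine lintegral_congr_ae (ae_restrict_of_ae ?_)
  filter_upwards [hΨ.ae_adm hM n] with ω h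
  refine lintegral_congr fun u => ?_
  simp only [Pi.mul_apply]
  rw [← mul_assoc, ← ENNReal.ofReal_mul (hwnn _ h), ← hgw _ _ _ h,
    ← ENNReal.ofReal_mul (Params.H_nonneg _ _ h), mul_comm (M.H _ _ _)]

/-- The recursion for the posterior probabilities. -/
theorem ae_eq_post (hM : M.IsModel x P θ₁ θ₂ X)
    (hΨ : IsPosterior P (obsFiltration X hX) θ₁ θ₂ Ψ) (n : ℕ) :
    ∀ᵐ ω ∂P, Ψ (n + 1) ω = M.post (X n ω) (X (n + 1) ω) (Ψ n ω) := by
  have h1 := hΨ.eq_condExp_post hM (g := fun a => 1 - a.1) (w := fun a => (1 - a.1) * M.p₁)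
    (by fun_prop) (fun a ha => by linarith [ha.2.2.1, ha.2.2.2])
    (fun a ha => Params.weight₀_nonneg ha) (fun z u a ha => Params.one_sub_post_fst_mul_H ha)
    fun A hA Φ hΦ => hΨ.lintegral_next_before (n := n) hM hA hΦ
  have h2 := hΨ.eq_condExp_post hM (g := fun a => a.2.1)
    (w := fun a => M.q₂ * a.1 + M.p₂ * a.2.1 + M.q₁ * a.2.2)
    (by fun_prop) (fun a ha => ha.1)
    (fun a ha => Params.weight₂_nonneg ha) (fun z u a ha => Params.post_snd_mul_H ha)
    fun A hA Φ hΦ => hΨ.lintegral_next_after (n := n) hM hA hΦ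
  have h3 := hΨ.eq_condExp_post hM (g := fun a => a.2.2) (w := fun a => M.p₁ * a.2.2)
    (by fun_prop) (fun a ha => ha.2.2.1)
    (fun a ha => mul_nonneg M.p₁_nonneg ha.2.2.1) (fun z u a ha => Params.post_trd_mul_H ha)
    fun A hA Φ hΦ => hΨ.lintegral_next_beforeEq (n := n) hM hA hΦ
  filter_upwards [h1, h2, h3, hΨ.eq_condExp_before hM (n + 1), hΨ.eq_condExp_after hM (n + 1),
    hΨ.eq_condExp_beforeEq (n + 1)] with ω h1 h2 h3 h1' h2' h3'
  refine Prod.ext ?_ (Prod.ext ?_ ?_)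
  · linarith [h1.trans h1'.symm]
  · exact h2'.trans h2.symm
  · exact h3'.trans h3.symm

/-- At time `0` the posterior probabilities are the prior ones. -/
theorem ae_eq_init (hM : M.IsModel x P θ₁ θ₂ X)
    (hΨ : IsPosterior P (obsFiltration X hX) θ₁ θ₂ Ψ) : ∀ᵐ ω ∂P, Ψ 0 ω = M.init := by
  have key : ∀ (D : Set (ℕ × ℕ)) (c : ℝ), 0 ≤ c →
      P (times θ₁ θ₂ ⁻¹' D) = ENNReal.ofReal c →
      (fun _ => c) =ᵐ[P] P[(times θ₁ θ₂ ⁻¹' D).indicator (fun _ => (1 : ℝ)) | obsSigma X 0] := by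
    intro D c hc hD
    refine eq_condExp_of_density (obsSigma_le hX 0) (hM.measurableSet_times D) measurable_const
      (ae_of_all _ fun _ => hc) fun A hA => ?_
    rw [hM.measure_obs_zero_inter hA, hD, Set.inter_univ, setLIntegral_const, mul_comm]
  have ha := M.adm_init
  have h1 := key (between 0) _ (mul_nonneg M.π_mem.1 (sub_nonneg.2 M.ρ_mem.2))
    (hM.measure_between_zero hX)
  have h2 := key (after 0) _ ha.1 hM.measure_after_zero
  have h3 := key (beforeEq 0) _ ha.2.2.1 (hM.measure_beforeEq_zero hX)
  filter_upwards [h1, h2, h3, hΨ.eq_condExp_between hM 0, hΨ.eq_condExp_after hM 0,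
    hΨ.eq_condExp_beforeEq 0] with ω h1 h2 h3 h1' h2' h3'
  have e2 := h2'.trans h2.symm
  have e1 := h1'.trans h1.symm
  refine Prod.ext ?_ (Prod.ext e2 (h3'.trans h3.symm))
  simp only [Params.init] at e1 e2 ⊢
  linarith

end IsPosterior
end TwoDisorders

namespace TwoDisorders

/-! ### Optimal stopping of a process dominated by a supermartingale -/

section Stopping

variable {Ω : Type*} {m : MeasurableSpace Ω} {P : Measure Ω} {F : Filtration ℕ m}
  {σ : Ω → WithTop ℕ} {W Y : ℕ → Ω → ℝ}

/-- The value collected by stopping the process `Y` at `σ`; it is `0` if `σ = ∞`. -/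
noncomputable def stoppedSum (Y : ℕ → Ω → ℝ) (σ : Ω → WithTop ℕ) : Ω → ℝ :=
  Set.indicator {ω | σ ω ≠ ⊤} (stoppedValue Y σ)

theorem sum_indicator_eq (Y : ℕ → Ω → ℝ) (σ : Ω → WithTop ℕ) (N : ℕ) (ω : Ω) :
    ∑ n ∈ Finset.range N, {ω | σ ω = n}.indicator (Y n) ω
      = {ω | σ ω < N}.indicator (stoppedSum Y σ) ω := by
  induction N with
  | zero => simp
  | succ N ih =>
    rw [Finset.sum_range_succ, ih]
    rcases h : σ ω with _ | k
    · have h' : σ ω = ⊤ := h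
      simp [h']
    · have h' : σ ω = (k : WithTop ℕ) := h
      rcases lt_trichotomy k N with hk | rfl | hk
      · have h1 : (k : WithTop ℕ) < (N : WithTop ℕ) := by exact_mod_cast hk
        have h2 : (k : WithTop ℕ) < (N : WithTop ℕ) + 1 := by exact_mod_cast hk.trans N.lt_succ_self
        have h3 : (k : WithTop ℕ) ≠ (N : WithTop ℕ) := h1.ne
        simp [h', h1, h2, h3]
      · have h2 : (k : WithTop ℕ) < (k : WithTop ℕ) + 1 := by exact_mod_cast k.lt_succ_self
        have h4 : stoppedSum Y σ ω = Y k ω := by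
          rw [stoppedSum, Set.indicator_of_mem (by simp [h']), stoppedValue, h']
          rfl
        simp [h', h4, h2]
      · have h1 : ¬ (k : WithTop ℕ) < (N : WithTop ℕ) := by exact_mod_cast hk.not_gt
        have h2 : ¬ (k : WithTop ℕ) < (N : WithTop ℕ) + 1 := by
          exact_mod_cast (Nat.succ_le_of_lt hk).not_gt
        have h3 : (k : WithTop ℕ) ≠ (N : WithTop ℕ) := by exact_mod_cast hk.ne'
        simp [h', h1, h2, h3]

theorem tendsto_sum_setIntegral [IsFiniteMeasure P] (hσ : IsStoppingTime F σ)
    (hY : ∀ n, Integrable (Y n) P) (hb : ∀ n, ∀ᵐ ω ∂P, Y n ω ∈ Set.Icc (0 : ℝ) 1) :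
    Tendsto (fun N => ∑ n ∈ Finset.range N, ∫ ω in {ω | σ ω = n}, Y n ω ∂P) atTop
      (𝓝 (∫ ω, stoppedSum Y σ ω ∂P)) := by
  have hms : ∀ n : ℕ, MeasurableSet {ω | σ ω = n} := fun n => F.le n _ (hσ.measurableSet_eq n)
  have hint : ∀ n : ℕ, Integrable ({ω | σ ω = n}.indicator (Y n)) P := fun n =>
    (hY n).indicator (hms n)
  have heq : ∀ N, ∑ n ∈ Finset.range N, ∫ ω in {ω | σ ω = n}, Y n ω ∂P
      = ∫ ω, ∑ n ∈ Finset.range N, {ω | σ ω = n}.indicator (Y n) ω ∂P := fun N => by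
    rw [integral_finsetSum _ fun n _ => hint n]
    exact Finset.sum_congr rfl fun n _ => (integral_indicator (hms n)).symm
  simp only [heq]
  refine tendsto_integral_of_dominated_convergence (fun _ => (1 : ℝ))
    (fun N => (integrable_finsetSum _ fun n _ => hint n).aestronglyMeasurable)
    (integrable_const _) (fun N => ?_) (ae_of_all _ fun ω => ?_)
  · filter_upwards [ae_all_iff.2 hb] with ω h
    have h01 : stoppedSum Y σ ω ∈ Set.Icc (0 : ℝ) 1 := by
      unfold stoppedSum stoppedValue
      rw [Set.indicator_apply]
      split_ifs
      · exact h _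
      · exact ⟨le_rfl, zero_le_one⟩
    rw [sum_indicator_eq, Set.indicator_apply]
    split_ifs
    · rw [Real.norm_eq_abs, abs_of_nonneg h01.1]; exact h01.2
    · simp
  · refine tendsto_const_nhds.congr' ?_
    rcases h : σ ω with _ | k
    · have h' : σ ω = ⊤ := h
      refine Eventually.of_forall fun N => ?_
      refine Eq.trans ?_ (sum_indicator_eq Y σ N ω).symm
      simp [h', stoppedSum]
    · have h' : σ ω = (k : WithTop ℕ) := h
      filter_upwards [eventually_gt_atTop k] with N hN
      have h1 : (k : WithTop ℕ) < (N : WithTop ℕ) := by exact_mod_cast hN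
      refine Eq.trans ?_ (sum_indicator_eq Y σ N ω).symm
      rw [Set.indicator_of_mem]
      simpa [h'] using h1

/-- Discrete Doob decomposition of the expected value of `W` at the time `min σ N`. -/
theorem sum_setIntegral_add_eq (hσ : IsStoppingTime F σ) (hW : ∀ n, Integrable (W n) P) (N : ℕ) :
    ∑ n ∈ Finset.range N, ∫ ω in {ω | σ ω = n}, W n ω ∂P
      + ∫ ω in {ω | (N : WithTop ℕ) ≤ σ ω}, W N ω ∂P
      = ∫ ω, W 0 ω ∂P - ∑ n ∈ Finset.range N, (∫ ω in {ω | (n : WithTop ℕ) < σ ω}, W n ω ∂P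
          - ∫ ω in {ω | (n : WithTop ℕ) < σ ω}, W (n + 1) ω ∂P) := by
  induction N with
  | zero => simp
  | succ N ih =>
    rw [Finset.sum_range_succ, Finset.sum_range_succ]
    have hgt : MeasurableSet {ω | (N : WithTop ℕ) < σ ω} := F.le N _ (hσ.measurableSet_gt N)
    have hset : {ω | (N : WithTop ℕ) ≤ σ ω} = {ω | σ ω = N} ∪ {ω | (N : WithTop ℕ) < σ ω} := by
      ext ω
      simp only [Set.mem_ofPred_eq, Set.mem_union, le_iff_eq_or_lt, eq_comm]
    have hdisj : Disjoint {ω | σ ω = N} {ω | (N : WithTop ℕ) < σ ω} := by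
      rw [Set.disjoint_left]
      intro ω (h1 : σ ω = N) (h2 : (N : WithTop ℕ) < σ ω)
      exact h2.ne h1.symm
    have hsucc : {ω | ((N + 1 : ℕ) : WithTop ℕ) ≤ σ ω} = {ω | (N : WithTop ℕ) < σ ω} := by
      ext ω
      simp only [Set.mem_ofPred_eq]
      rcases h : σ ω with _ | k
      · exact ⟨fun _ => WithTop.coe_lt_top N, fun _ => le_top⟩
      · exact ⟨fun h => WithTop.coe_lt_coe.2 (Nat.lt_of_succ_le (WithTop.coe_le_coe.1 h)),
          fun h => WithTop.coe_le_coe.2 (Nat.succ_le_of_lt (WithTop.coe_lt_coe.1 h))⟩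
    rw [hset, setIntegral_union hdisj hgt (hW N).integrableOn (hW N).integrableOn] at ih
    rw [hsucc]
    linarith

/-- A supermartingale `W ≥ Y ≥ 0` bounds the expected value of `Y` at every stopping time. -/
theorem integral_stoppedSum_le [IsFiniteMeasure P] (hσ : IsStoppingTime F σ)
    (hW : ∀ n, Integrable (W n) P)
    (hY : ∀ n, Integrable (Y n) P) (hb : ∀ n, ∀ᵐ ω ∂P, Y n ω ∈ Set.Icc (0 : ℝ) 1)
    (hYW : ∀ n, Y n ≤ᵐ[P] W n)
    (hsuper : ∀ n A, MeasurableSet[F n] A → ∫ ω in A, W (n + 1) ω ∂P ≤ ∫ ω in A, W n ω ∂P) :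
    ∫ ω, stoppedSum Y σ ω ∂P ≤ ∫ ω, W 0 ω ∂P := by
  refine le_of_tendsto (tendsto_sum_setIntegral hσ hY hb) (Eventually.of_forall fun N => ?_)
  have h1 := sum_setIntegral_add_eq hσ hW N
  have h2 : 0 ≤ ∑ n ∈ Finset.range N, (∫ ω in {ω | (n : WithTop ℕ) < σ ω}, W n ω ∂P
      - ∫ ω in {ω | (n : WithTop ℕ) < σ ω}, W (n + 1) ω ∂P) :=
    Finset.sum_nonneg fun n _ => sub_nonneg.2 (hsuper n _ (hσ.measurableSet_gt n))
  have h3 : 0 ≤ ∫ ω in {ω | (N : WithTop ℕ) ≤ σ ω}, W N ω ∂P := by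
    refine integral_nonneg_of_ae (ae_restrict_of_ae ?_)
    filter_upwards [hb N, hYW N] with ω h h' using h.1.trans h'
  have h4 : ∑ n ∈ Finset.range N, ∫ ω in {ω | σ ω = n}, Y n ω ∂P
      ≤ ∑ n ∈ Finset.range N, ∫ ω in {ω | σ ω = n}, W n ω ∂P :=
    Finset.sum_le_sum fun n _ => setIntegral_mono_ae (hY n).integrableOn (hW n).integrableOn
      (hYW n)
  linarith

/-- The bound is attained if `W` is a martingale before `σ`, agrees with `Y` at `σ` and vanishes in
the mean at infinity. -/
theorem integral_stoppedSum_eq [IsFiniteMeasure P] (hσ : IsStoppingTime F σ)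
    (hW : ∀ n, Integrable (W n) P)
    (hY : ∀ n, Integrable (Y n) P) (hb : ∀ n, ∀ᵐ ω ∂P, Y n ω ∈ Set.Icc (0 : ℝ) 1)
    (hYW : ∀ n, Y n ≤ᵐ[P] W n)
    (hmart : ∀ n : ℕ, ∫ ω in {ω | (n : WithTop ℕ) < σ ω}, W (n + 1) ω ∂P
      = ∫ ω in {ω | (n : WithTop ℕ) < σ ω}, W n ω ∂P)
    (heqσ : ∀ n : ℕ, ∀ᵐ ω ∂P, σ ω = n → Y n ω = W n ω)
    (hlim : Tendsto (fun n => ∫ ω, W n ω ∂P) atTop (𝓝 0)) :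
    ∫ ω, stoppedSum Y σ ω ∂P = ∫ ω, W 0 ω ∂P := by
  have hnn : ∀ n, 0 ≤ᵐ[P] W n := fun n => by
    filter_upwards [hb n, hYW n] with ω h h' using h.1.trans h'
  have hrest : Tendsto (fun N : ℕ => ∫ ω in {ω | (N : WithTop ℕ) ≤ σ ω}, W N ω ∂P) atTop (𝓝 0) :=
    squeeze_zero (fun N => integral_nonneg_of_ae (ae_restrict_of_ae (hnn N)))
      (fun N => setIntegral_le_integral (hW N) (hnn N)) hlim
  refine tendsto_nhds_unique (tendsto_sum_setIntegral hσ hY hb) ?_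
  have heq : ∀ N, ∑ n ∈ Finset.range N, ∫ ω in {ω | σ ω = n}, Y n ω ∂P
      = ∫ ω, W 0 ω ∂P - ∫ ω in {ω | (N : WithTop ℕ) ≤ σ ω}, W N ω ∂P := fun N => by
    have h1 := sum_setIntegral_add_eq hσ hW N
    rw [Finset.sum_eq_zero (f := fun n : ℕ => ∫ ω in {ω | (n : WithTop ℕ) < σ ω}, W n ω ∂P
      - ∫ ω in {ω | (n : WithTop ℕ) < σ ω}, W (n + 1) ω ∂P)
      (fun n _ => sub_eq_zero.2 (hmart n).symm), sub_zero] at h1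
    rw [← h1, add_sub_cancel_right]
    refine Finset.sum_congr rfl fun n _ => ?_
    refine setIntegral_congr_ae (F.le n _ (hσ.measurableSet_eq n)) ?_
    exact heqσ n
  simp only [heq]
  simpa using tendsto_const_nhds.sub hrest

end Stopping

end TwoDisorders

namespace TwoDisorders

/-! ### The Markov property of the system -/

namespace Params

variable {E : Type*} [MeasurableSpace E] {M : Params E}

theorem measurable_T {v : State E → ℝ} (hv : Measurable v) : Measurable (M.T v) := by
  have hz : Measurable fun p : State E × E => p.1.2.1 := by fun_prop
  have hu : Measurable fun p : State E × E => p.2 := by fun_prop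
  have ha : Measurable fun p : State E × E => p.1.2.2 := by fun_prop
  have h : Measurable fun p : State E × E =>
      v (p.1.2.1, p.2, M.post p.1.2.1 p.2 p.1.2.2) * M.H p.1.2.1 p.2 p.1.2.2 :=
    (hv.comp (hz.prodMk (hu.prodMk (M.measurable_post_comp hz hu ha)))).mul
      (M.measurable_H_comp hz hu ha)
  exact (h.stronglyMeasurable.integral_prod_right' (ν := M.μ)).measurable

end Params

namespace IsPosterior

variable {E Ω : Type*} [MeasurableSpace E] [MeasurableSpace Ω] {M : Params E} {x : E}
  {P : Measure Ω} {θ₁ θ₂ : Ω → ℕ} {X : ℕ → Ω → E}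
  {hX : ∀ n, Measurable (X n)} {Ψ : ℕ → Ω → ℝ × ℝ × ℝ}

/-! ### The value process -/

variable (M X Ψ) in
/-- The value of the problem at time `n`. The first coordinate of the state, on which the value does
not depend, is filled with the current observation, so that time `0` is covered as well. -/
noncomputable def valueProc (n : ℕ) (ω : Ω) : ℝ := M.limVal (X n ω, X n ω, Ψ n ω)

variable (Ψ) in
/-- The posterior probability of success when the observations are stopped at time `n`. -/
def payoffProc (n : ℕ) (ω : Ω) : ℝ := (Ψ n ω).1 - (Ψ n ω).2.1

theorem measurable_valueProc (hΨ : IsPosterior P (obsFiltration X hX) θ₁ θ₂ Ψ) (n : ℕ) :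
    Measurable (valueProc M X Ψ n) :=
  Params.measurable_limVal.comp ((hX n).prodMk ((hX n).prodMk (hΨ.measurable' n)))

theorem valueProc_eq_max {Ω : Type*} {X : ℕ → Ω → E} {Ψ : ℕ → Ω → ℝ × ℝ × ℝ} {n : ℕ} {ω : Ω}
    (h : Adm (Ψ n ω)) (y : E) :
    valueProc M X Ψ n ω
      = max (payoffProc Ψ n ω) (M.contVal M.RStar M.SStar (y, X n ω, Ψ n ω)) :=
  (Params.limVal_congr _ y _ _).trans (Params.limVal_eq_max h)

theorem mem_BStar_system {Ω : Type*} {X : ℕ → Ω → E} {Ψ : ℕ → Ω → ℝ × ℝ × ℝ} {n : ℕ} {ω : Ω}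
    (h : Adm (Ψ (n + 1) ω)) :
    system X Ψ n ω ∈ M.BStar ↔ valueProc M X Ψ (n + 1) ω ≤ payoffProc Ψ (n + 1) ω := by
  rw [Params.mem_BStar (t := system X Ψ n ω) h, valueProc,
    Params.limVal_congr (X (n + 1) ω) (X n ω)]
  rfl

theorem isStoppingTime_tauZero (hΨ : IsPosterior P (obsFiltration X hX) θ₁ θ₂ Ψ) :
    IsStoppingTime (shiftFiltration (obsFiltration X hX)) (M.tauZero X Ψ) :=
  Adapted.isStoppingTime_hittingAfter (fun n => Measurable.prodMk (measurable_obs n.le_succ)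
    (Measurable.prodMk (measurable_obs le_rfl) (hΨ.measurable (n + 1)))) Params.measurableSet_BStar

theorem isStoppingTime_tauStar (hΨ : IsPosterior P (obsFiltration X hX) θ₁ θ₂ Ψ) :
    IsStoppingTime (obsFiltration X hX) (M.tauStar x X Ψ) := by
  intro n
  by_cases hV : M.V₀ x ≤ M.π * (1 - M.ρ)
  · simp [Params.tauStar, hV]
  · simp only [Params.tauStar, if_neg hV]
    rcases n with _ | n
    · have : {ω | M.tauZero X Ψ ω + 1 ≤ ((0 : ℕ) : WithTop ℕ)} = ∅ := by
        ext ω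
        simp
      change MeasurableSet[obsSigma X 0] {ω | M.tauZero X Ψ ω + 1 ≤ ((0 : ℕ) : WithTop ℕ)}
      rw [this]
      exact @MeasurableSet.empty _ (obsSigma X 0)
    · have : {ω | M.tauZero X Ψ ω + 1 ≤ ((n + 1 : ℕ) : WithTop ℕ)}
          = {ω | M.tauZero X Ψ ω ≤ (n : WithTop ℕ)} := by
        ext ω
        simp only [Set.mem_ofPred_eq]
        rcases h : M.tauZero X Ψ ω with _ | k
        · have : ((⊤ : WithTop ℕ) + 1) = ⊤ := rfl
          change (⊤ : WithTop ℕ) + 1 ≤ _ ↔ (⊤ : WithTop ℕ) ≤ _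
          simp [this]
        · change ((k + 1 : ℕ) : WithTop ℕ) ≤ _ ↔ ((k : ℕ) : WithTop ℕ) ≤ _
          exact WithTop.coe_le_coe.trans (Nat.add_le_add_iff_right.trans WithTop.coe_le_coe.symm)
      change MeasurableSet[obsSigma X (n + 1)]
        {ω | M.tauZero X Ψ ω + 1 ≤ ((n + 1 : ℕ) : WithTop ℕ)}
      rw [this]
      exact hΨ.isStoppingTime_tauZero n

variable [IsProbabilityMeasure P]

/-! ### The transition operator -/

/-- `T` is the transition operator; its value does not depend on the first coordinate `y`. -/
theorem setIntegral_next (hM : M.IsModel x P θ₁ θ₂ X)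
    (hΨ : IsPosterior P (obsFiltration X hX) θ₁ θ₂ Ψ) {v : State E → ℝ} (hv : Measurable v)
    (hv01 : ∀ s ∈ stateSpace E, v s ∈ Set.Icc (0 : ℝ) 1) (n : ℕ) (y : E) {A : Set Ω}
    (hA : MeasurableSet[obsSigma X n] A) :
    ∫ ω in A, v (X n ω, X (n + 1) ω, Ψ (n + 1) ω) ∂P
      = ∫ ω in A, M.T v (y, X n ω, Ψ n ω) ∂P := by
  have hΨm := hΨ.measurable'
  have hl : Measurable fun ω => v (X n ω, X (n + 1) ω, Ψ (n + 1) ω) :=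
    hv.comp ((hX n).prodMk ((hX (n + 1)).prodMk (hΨm (n + 1))))
  have hr : Measurable fun ω => M.T v (y, X n ω, Ψ n ω) :=
    (Params.measurable_T hv).comp (measurable_const.prodMk ((hX n).prodMk (hΨm n)))
  have hΦ : Measurable fun q : (E × ℝ × ℝ × ℝ) × E =>
      ENNReal.ofReal (v (q.1.1, q.2, M.post q.1.1 q.2 q.1.2)) :=
    (hv.comp (Measurable.prodMk (by fun_prop) (Measurable.prodMk (by fun_prop)
      (M.measurable_post_comp (by fun_prop) (by fun_prop) (by fun_prop))))).ennreal_ofReal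
  rw [integral_eq_lintegral_of_nonneg_ae ?_ hl.aestronglyMeasurable,
    integral_eq_lintegral_of_nonneg_ae ?_ hr.aestronglyMeasurable]
  · congr 1
    have e1 : ∫⁻ ω in A, ENNReal.ofReal (v (X n ω, X (n + 1) ω, Ψ (n + 1) ω)) ∂P
        = ∫⁻ ω in A, ENNReal.ofReal
          (v (X n ω, X (n + 1) ω, M.post (X n ω) (X (n + 1) ω) (Ψ n ω))) ∂P := by
      refine lintegral_congr_ae (ae_restrict_of_ae ?_)
      filter_upwards [hΨ.ae_eq_post hM n] with ω h
      rw [h]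
    rw [e1, hΨ.lintegral_next hM hA hΦ]
    refine lintegral_congr_ae (ae_restrict_of_ae ?_)
    filter_upwards [hΨ.ae_adm hM n] with ω h
    rw [Params.T, ofReal_integral_eq_lintegral_ofReal (Params.integrable_mul_H hv hv01 _ h)]
    · refine lintegral_congr fun u => ?_
      rw [mul_comm, ← ENNReal.ofReal_mul (hv01 _ (Params.adm_post _ u h)).1]
    · exact ae_of_all _ fun u => mul_nonneg (hv01 _ (Params.adm_post _ u h)).1
        (Params.H_nonneg _ _ h)
  · refine ae_restrict_of_ae ?_
    filter_upwards [hΨ.ae_adm hM n] with ω h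
    exact integral_nonneg fun u => mul_nonneg (hv01 _ (Params.adm_post _ u h)).1
        (Params.H_nonneg _ _ h)
  · refine ae_restrict_of_ae ?_
    filter_upwards [hΨ.ae_adm hM (n + 1)] with ω h using (hv01 _ h).1

theorem condExp_system (hM : M.IsModel x P θ₁ θ₂ X)
    (hΨ : IsPosterior P (obsFiltration X hX) θ₁ θ₂ Ψ) {v : State E → ℝ} (hv : Measurable v)
    (hv01 : ∀ s, v s ∈ Set.Icc (0 : ℝ) 1) (n : ℕ) :
    P[fun ω => v (system X Ψ (n + 1) ω) | shiftFiltration (obsFiltration X hX) n]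
      =ᵐ[P] fun ω => M.T v (system X Ψ n ω) := by
  have hΨm := hΨ.measurable'
  have hl : Measurable fun ω => v (system X Ψ (n + 1) ω) :=
    hv.comp ((hX _).prodMk ((hX _).prodMk (hΨm _)))
  have hr : Measurable[obsSigma X (n + 1)] fun ω => M.T v (system X Ψ n ω) :=
    (Params.measurable_T hv).comp ((measurable_obs n.le_succ).prodMk
      ((measurable_obs le_rfl).prodMk (hΨ.measurable _)))
  have hle := obsSigma_le hX (n + 1)
  have hb : ∀ ω, ‖v (system X Ψ (n + 1) ω)‖ ≤ 1 := fun ω => by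
    rw [Real.norm_eq_abs, abs_of_nonneg (hv01 _).1]; exact (hv01 _).2
  have hTb : ∀ᵐ ω ∂P, ‖M.T v (system X Ψ n ω)‖ ≤ ∫ u, M.H (X (n + 1) ω) u (Ψ (n + 1) ω) ∂M.μ := by
    filter_upwards [hΨ.ae_adm hM (n + 1)] with ω h
    have hnn : 0 ≤ M.T v (system X Ψ n ω) := integral_nonneg fun u =>
      mul_nonneg (hv01 _).1 (Params.H_nonneg _ _ h)
    rw [Real.norm_eq_abs, abs_of_nonneg hnn]
    exact integral_mono (Params.integrable_mul_H hv (fun s _ => hv01 s) _ h)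
      (Params.integrable_H _ _) fun u =>
        mul_le_of_le_one_left (Params.H_nonneg _ _ h) (hv01 _).2
  refine (ae_eq_condExp_of_forall_setIntegral_eq hle
    (Integrable.of_bound hl.aestronglyMeasurable 1 (ae_of_all _ hb)) (fun A _ _ => ?_)
    (fun A hA _ => ?_) (Measurable.stronglyMeasurable hr).aestronglyMeasurable).symm
  · refine (Integrable.of_bound (hr.mono hle le_rfl).aestronglyMeasurable 1 ?_).integrableOn
    filter_upwards [hTb] with ω h
    exact h.trans Params.integral_H.le
  · rcases isEmpty_or_nonempty Ω with hΩ | ⟨⟨ω₀⟩⟩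
    · simp [Set.eq_empty_of_isEmpty A]
    · exact (hΨ.setIntegral_next hM hv (fun s _ => hv01 s) (n + 1) (X n ω₀) hA).symm

/-! ### The supermartingale property of the value process -/

theorem integrable_valueProc (hM : M.IsModel x P θ₁ θ₂ X)
    (hΨ : IsPosterior P (obsFiltration X hX) θ₁ θ₂ Ψ) (n : ℕ) :
    Integrable (valueProc M X Ψ n) P := by
  refine Integrable.of_bound (hΨ.measurable_valueProc n).aestronglyMeasurable 1 ?_
  filter_upwards [hΨ.ae_adm hM n] with ω h
  have := Params.limVal_mem (M := M) (t := (X n ω, X n ω, Ψ n ω)) h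
  rw [valueProc, Real.norm_eq_abs, abs_of_nonneg this.1]
  exact this.2

theorem ae_payoffProc_mem (hM : M.IsModel x P θ₁ θ₂ X)
    (hΨ : IsPosterior P (obsFiltration X hX) θ₁ θ₂ Ψ) (n : ℕ) :
    ∀ᵐ ω ∂P, payoffProc Ψ n ω ∈ Set.Icc (0 : ℝ) 1 := by
  filter_upwards [hΨ.ae_adm hM n] with ω ⟨h1, h2, h3, h4⟩
  exact ⟨sub_nonneg.2 h2, by unfold payoffProc; linarith⟩

theorem integrable_payoffProc (hM : M.IsModel x P θ₁ θ₂ X)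
    (hΨ : IsPosterior P (obsFiltration X hX) θ₁ θ₂ Ψ) (n : ℕ) :
    Integrable (payoffProc Ψ n) P := by
  have hm : Measurable (payoffProc Ψ n) := by
    have := hΨ.measurable' n
    unfold payoffProc
    fun_prop
  refine Integrable.of_bound hm.aestronglyMeasurable 1 ?_
  filter_upwards [hΨ.ae_payoffProc_mem hM n] with ω h
  rw [Real.norm_eq_abs, abs_of_nonneg h.1]
  exact h.2

theorem payoffProc_le_valueProc (hM : M.IsModel x P θ₁ θ₂ X)
    (hΨ : IsPosterior P (obsFiltration X hX) θ₁ θ₂ Ψ) (n : ℕ) :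
    payoffProc Ψ n ≤ᵐ[P] valueProc M X Ψ n := by
  filter_upwards [hΨ.ae_adm hM n] with ω h
  rw [valueProc_eq_max h (X n ω)]
  exact le_max_left _ _

theorem setIntegral_valueProc_succ (hM : M.IsModel x P θ₁ θ₂ X)
    (hΨ : IsPosterior P (obsFiltration X hX) θ₁ θ₂ Ψ) (n : ℕ) (y : E) {A : Set Ω}
    (hA : MeasurableSet[obsSigma X n] A) :
    ∫ ω in A, valueProc M X Ψ (n + 1) ω ∂P
      = ∫ ω in A, M.contVal M.RStar M.SStar (y, X n ω, Ψ n ω) ∂P := by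
  have h := hΨ.setIntegral_next hM Params.measurable_limVal
    (fun s hs => Params.limVal_mem (M := M) hs) n y hA
  have e1 : ∀ ω, valueProc M X Ψ (n + 1) ω = M.limVal (X n ω, X (n + 1) ω, Ψ (n + 1) ω) :=
    fun ω => Params.limVal_congr _ _ _ _
  simp only [e1]
  rw [h]
  refine integral_congr_ae (ae_restrict_of_ae ?_)
  filter_upwards [hΨ.ae_adm hM n] with ω h using Params.T_limVal h

theorem integrable_contVal (hM : M.IsModel x P θ₁ θ₂ X)
    (hΨ : IsPosterior P (obsFiltration X hX) θ₁ θ₂ Ψ) (n : ℕ) (y : E) :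
    Integrable (fun ω => M.contVal M.RStar M.SStar (y, X n ω, Ψ n ω)) P := by
  have hm : Measurable fun ω => M.contVal M.RStar M.SStar (y, X n ω, Ψ n ω) :=
    (Params.measurable_contVal Params.measurable_RStar Params.measurable_SStar).comp
      (measurable_const.prodMk ((hX n).prodMk (hΨ.measurable' n)))
  refine Integrable.of_bound hm.aestronglyMeasurable 1 ?_
  filter_upwards [hΨ.ae_adm hM n] with ω h
  have h1 : 0 ≤ M.contVal M.RStar M.SStar (y, X n ω, Ψ n ω) := by
    rw [← Params.T_limVal h]
    exact integral_nonneg fun u => mul_nonneg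
      (Params.limVal_mem (Params.adm_post _ _ h)).1 (Params.H_nonneg _ _ h)
  rw [Real.norm_eq_abs, abs_of_nonneg h1]
  have h2 := (Params.limVal_mem (M := M) (t := (y, X n ω, Ψ n ω)) h).2
  rw [Params.limVal_eq_max h] at h2
  exact (le_max_right _ _).trans h2

theorem supermartingale_valueProc (hM : M.IsModel x P θ₁ θ₂ X)
    (hΨ : IsPosterior P (obsFiltration X hX) θ₁ θ₂ Ψ) (n : ℕ) {A : Set Ω}
    (hA : MeasurableSet[obsSigma X n] A) :
    ∫ ω in A, valueProc M X Ψ (n + 1) ω ∂P ≤ ∫ ω in A, valueProc M X Ψ n ω ∂P := by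
  rw [hΨ.setIntegral_valueProc_succ hM n x hA]
  refine setIntegral_mono_ae (hΨ.integrable_contVal hM n x).integrableOn
    (hΨ.integrable_valueProc hM n).integrableOn ?_
  filter_upwards [hΨ.ae_adm hM n] with ω h
  rw [valueProc_eq_max h x]
  exact le_max_right _ _

/-- The value process is a martingale where it exceeds the payoff. -/
theorem martingale_valueProc (hM : M.IsModel x P θ₁ θ₂ X)
    (hΨ : IsPosterior P (obsFiltration X hX) θ₁ θ₂ Ψ) (n : ℕ) {A : Set Ω}
    (hA : MeasurableSet[obsSigma X n] A)
    (hne : ∀ᵐ ω ∂P, ω ∈ A → payoffProc Ψ n ω < valueProc M X Ψ n ω) :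
    ∫ ω in A, valueProc M X Ψ (n + 1) ω ∂P = ∫ ω in A, valueProc M X Ψ n ω ∂P := by
  rw [hΨ.setIntegral_valueProc_succ hM n x hA]
  refine setIntegral_congr_ae (obsSigma_le hX _ _ hA) ?_
  filter_upwards [hΨ.ae_adm hM n, hne] with ω h hne hω
  have h1 := valueProc_eq_max (M := M) (X := X) h x
  have h2 := hne hω
  rcases max_choice (payoffProc Ψ n ω) (M.contVal M.RStar M.SStar (x, X n ω, Ψ n ω)) with h3 | h3
  · rw [h1, h3] at h2
    exact absurd h2 (lt_irrefl _)
  · rw [h1, h3]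

/-- The value at time `n` is at most the posterior probability of `n < θ₂`. -/
theorem tendsto_integral_valueProc (hM : M.IsModel x P θ₁ θ₂ X)
    (hΨ : IsPosterior P (obsFiltration X hX) θ₁ θ₂ Ψ) :
    Tendsto (fun n => ∫ ω, valueProc M X Ψ n ω ∂P) atTop (𝓝 0) := by
  have hs : ∀ n, MeasurableSet {ω | θ₂ ω ≤ n} := fun n => hM.measurable_θ₂ measurableSet_Iic
  have hint : ∀ n, Integrable (fun ω => (Ψ n ω).2.1) P := fun n =>
    integrable_condExp.congr (hΨ.snd n).symm
  have hval : ∀ n, ∫ ω, (Ψ n ω).2.1 ∂P = P.real {ω | θ₂ ω ≤ n} := fun n => by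
    rw [integral_congr_ae (hΨ.snd n), integral_condExp ((obsFiltration X hX).le n)]
    exact integral_indicator_one (hs n)
  have hlim : Tendsto (fun n => P.real {ω | θ₂ ω ≤ n}) atTop (𝓝 1) := by
    have hmono : Monotone fun n => {ω | θ₂ ω ≤ n} := fun a b hab ω (h : θ₂ ω ≤ a) => h.trans hab
    have h := tendsto_measure_iUnion_atTop (μ := P) hmono
    have hU : (⋃ n, {ω | θ₂ ω ≤ n}) = Set.univ :=
      Set.eq_univ_of_forall fun ω => Set.mem_iUnion.2 ⟨θ₂ ω, by simp⟩
    rw [hU, measure_univ] at h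
    have h' := (ENNReal.tendsto_toReal ENNReal.one_ne_top).comp h
    rw [ENNReal.toReal_one] at h'
    exact h'
  refine squeeze_zero (g := fun n => 1 - P.real {ω | θ₂ ω ≤ n}) (fun n => ?_) (fun n => ?_) ?_
  · refine integral_nonneg_of_ae ?_
    filter_upwards [hΨ.ae_adm hM n] with ω h using (Params.limVal_mem h).1
  · have h1 : ∫ ω, valueProc M X Ψ n ω ∂P ≤ ∫ ω, (1 - (Ψ n ω).2.1) ∂P := by
      refine integral_mono_ae (hΨ.integrable_valueProc hM n) ((integrable_const 1).sub (hint n)) ?_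
      filter_upwards [hΨ.ae_adm hM n] with ω h
      exact (Params.val_mem Params.isUnit01_RStar Params.isUnit01_SStar
        (t := (X n ω, X n ω, Ψ n ω)) h).2
    rw [integral_sub (integrable_const 1) (hint n), hval] at h1
    simpa using h1
  · simpa using (tendsto_const_nhds (x := (1 : ℝ))).sub hlim

theorem integral_valueProc_zero (hM : M.IsModel x P θ₁ θ₂ X)
    (hΨ : IsPosterior P (obsFiltration X hX) θ₁ θ₂ Ψ) :
    ∫ ω, valueProc M X Ψ 0 ω ∂P = M.V x := by
  have h : valueProc M X Ψ 0 =ᵐ[P] fun _ => M.V x := by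
    filter_upwards [hM.start, hΨ.ae_eq_init hM] with ω h1 h2
    rw [valueProc, h1, h2, Params.limVal_init]
  rw [integral_congr_ae h]
  simp

/-! ### Stopping the observations -/

theorem measureReal_success (hM : M.IsModel x P θ₁ θ₂ X)
    (hΨ : IsPosterior P (obsFiltration X hX) θ₁ θ₂ Ψ) {τ : Ω → WithTop ℕ}
    (hτ : IsStoppingTime (obsFiltration X hX) τ) :
    P.real (success θ₁ θ₂ τ) = ∫ ω, stoppedSum (payoffProc Ψ) τ ω ∂P := by
  set Y : ℕ → Ω → ℝ := fun n => (times θ₁ θ₂ ⁻¹' between n).indicator fun _ => 1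
  have hYi : ∀ n, Integrable (Y n) P := fun n =>
    (integrable_const 1).indicator (hM.measurableSet_times _)
  have hYb : ∀ n, ∀ᵐ ω ∂P, Y n ω ∈ Set.Icc (0 : ℝ) 1 := fun n => ae_of_all _ fun ω => by
    by_cases h : ω ∈ times θ₁ θ₂ ⁻¹' between n
    · simp only [Y, Set.indicator_of_mem h]
      exact ⟨zero_le_one, le_rfl⟩
    · simp only [Y, Set.indicator_of_notMem h]
      exact ⟨le_rfl, zero_le_one⟩
  have hms : ∀ n : ℕ, MeasurableSet {ω | τ ω = n} := fun n =>
    (obsFiltration X hX).le n _ (hτ.measurableSet_eq n)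
  have hsucc : success θ₁ θ₂ τ = ⋃ n : ℕ, {ω | τ ω = n} ∩ times θ₁ θ₂ ⁻¹' between n := by
    ext ω
    simp only [success, Set.mem_ofPred_eq, Set.mem_iUnion, Set.mem_inter_iff, Set.mem_preimage,
      times, between]
    constructor
    · rintro ⟨h1, h2, h3⟩
      lift τ ω to ℕ using h1.ne with k hk
      exact ⟨k, rfl, WithTop.coe_le_coe.1 h2, WithTop.coe_lt_coe.1 h3⟩
    · rintro ⟨k, h1, h2, h3⟩
      rw [h1]
      exact ⟨WithTop.coe_lt_top k, WithTop.coe_le_coe.2 h2, WithTop.coe_lt_coe.2 h3⟩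
  have hsm : MeasurableSet (success θ₁ θ₂ τ) := by
    rw [hsucc]
    exact MeasurableSet.iUnion fun n => (hms n).inter (hM.measurableSet_times _)
  have hind : stoppedSum Y τ = (success θ₁ θ₂ τ).indicator 1 := by
    ext ω
    unfold stoppedSum stoppedValue
    rcases h : τ ω with _ | k
    · have h' : τ ω = ⊤ := h
      rw [Set.indicator_of_notMem (by simp [h']), Set.indicator_of_notMem]
      simp [success, h']
    · have h' : τ ω = (k : WithTop ℕ) := h
      have hmem : ω ∈ success θ₁ θ₂ τ ↔ ω ∈ times θ₁ θ₂ ⁻¹' between k := by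
        simp [success, h', times, between]
      have hu : (τ ω).untopA = k := by rw [h']; rfl
      rw [Set.indicator_of_mem (by simp [h']), hu]
      simp only [Y]
      by_cases hω : ω ∈ success θ₁ θ₂ τ
      · rw [Set.indicator_of_mem hω, Set.indicator_of_mem (hmem.1 hω)]
        rfl
      · rw [Set.indicator_of_notMem hω, Set.indicator_of_notMem fun h => hω (hmem.2 h)]
  have h1 := tendsto_sum_setIntegral hτ hYi hYb
  have h2 := tendsto_sum_setIntegral hτ (hΨ.integrable_payoffProc hM) (hΨ.ae_payoffProc_mem hM)
  have heq : ∀ n : ℕ, ∫ ω in {ω | τ ω = n}, Y n ω ∂P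
      = ∫ ω in {ω | τ ω = n}, payoffProc Ψ n ω ∂P := fun n => by
    refine (setIntegral_condExp (obsSigma_le hX n) (hYi n) (hτ.measurableSet_eq n)).symm.trans ?_
    exact setIntegral_congr_ae (hms n)
      ((hΨ.eq_condExp_between hM n).mono fun ω h _ => h.symm)
  simp only [heq] at h1
  rw [← tendsto_nhds_unique h1 h2, hind, integral_indicator_one hsm]

theorem success_le (hM : M.IsModel x P θ₁ θ₂ X)
    (hΨ : IsPosterior P (obsFiltration X hX) θ₁ θ₂ Ψ) {τ : Ω → WithTop ℕ}
    (hτ : IsStoppingTime (obsFiltration X hX) τ) : P.real (success θ₁ θ₂ τ) ≤ M.V x := by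
  rw [hΨ.measureReal_success hM hτ, ← hΨ.integral_valueProc_zero hM]
  exact integral_stoppedSum_le hτ (hΨ.integrable_valueProc hM) (hΨ.integrable_payoffProc hM)
    (hΨ.ae_payoffProc_mem hM) (hΨ.payoffProc_le_valueProc hM)
    fun n A hA => hΨ.supermartingale_valueProc hM n hA

theorem success_eq (hM : M.IsModel x P θ₁ θ₂ X)
    (hΨ : IsPosterior P (obsFiltration X hX) θ₁ θ₂ Ψ) {τ : Ω → WithTop ℕ}
    (hτ : IsStoppingTime (obsFiltration X hX) τ)
    (hlt : ∀ n : ℕ, ∀ᵐ ω ∂P, n < τ ω → payoffProc Ψ n ω < valueProc M X Ψ n ω)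
    (heq : ∀ n : ℕ, ∀ᵐ ω ∂P, τ ω = n → valueProc M X Ψ n ω ≤ payoffProc Ψ n ω) :
    P.real (success θ₁ θ₂ τ) = M.V x := by
  rw [hΨ.measureReal_success hM hτ, ← hΨ.integral_valueProc_zero hM]
  refine integral_stoppedSum_eq hτ (hΨ.integrable_valueProc hM) (hΨ.integrable_payoffProc hM)
    (hΨ.ae_payoffProc_mem hM) (hΨ.payoffProc_le_valueProc hM)
    (fun n => hΨ.martingale_valueProc hM n (hτ.measurableSet_gt n) (hlt n)) (fun n => ?_)
    (hΨ.tendsto_integral_valueProc hM)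
  filter_upwards [heq n, hΨ.payoffProc_le_valueProc (M := M) hM n] with ω h h' hω
  exact h'.antisymm (h hω)

/-! ### The entry time into the stopping set -/

theorem ae_lt_of_lt_tauZero (hM : M.IsModel x P θ₁ θ₂ X)
    (hΨ : IsPosterior P (obsFiltration X hX) θ₁ θ₂ Ψ) (n : ℕ) :
    ∀ᵐ ω ∂P, n < M.tauZero X Ψ ω → payoffProc Ψ (n + 1) ω < valueProc M X Ψ (n + 1) ω := by
  filter_upwards [hΨ.ae_adm hM (n + 1)] with ω h hω
  exact not_le.1 fun hle => notMem_of_lt_hittingAfter hω n.zero_le ((mem_BStar_system h).2 hle)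

theorem ae_le_of_tauZero_eq (hM : M.IsModel x P θ₁ θ₂ X)
    (hΨ : IsPosterior P (obsFiltration X hX) θ₁ θ₂ Ψ) (n : ℕ) :
    ∀ᵐ ω ∂P, M.tauZero X Ψ ω = n → valueProc M X Ψ (n + 1) ω ≤ payoffProc Ψ (n + 1) ω := by
  filter_upwards [hΨ.ae_adm hM (n + 1)] with ω h hω
  refine (mem_BStar_system h).1 ?_
  have hmem := hittingAfter_mem_set_of_ne_top (u := system X Ψ) (s := M.BStar) (n := 0) (ω := ω)
    (by change M.tauZero X Ψ ω ≠ ⊤; rw [hω]; exact WithTop.coe_ne_top)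
  have hu : (hittingAfter (system X Ψ) M.BStar 0 ω).untopA = n := by
    change (M.tauZero X Ψ ω).untopA = n
    rw [hω]; rfl
  rwa [hu] at hmem

theorem hittingAfter_hStar_eq (hM : M.IsModel x P θ₁ θ₂ X)
    (hΨ : IsPosterior P (obsFiltration X hX) θ₁ θ₂ Ψ) :
    hittingAfter (system X Ψ) {s | M.hStar s ≤ payoff s} 0 =ᵐ[P] M.tauZero X Ψ := by
  filter_upwards [ae_all_iff.2 fun n => hΨ.ae_adm hM (n + 1)] with ω h
  have hiff : ∀ n, system X Ψ n ω ∈ {s | M.hStar s ≤ payoff s} ↔ system X Ψ n ω ∈ M.BStar :=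
    fun n => by
      have hs : system X Ψ n ω ∈ stateSpace E := h n
      rw [Params.mem_BStar hs, ← Params.hStar_eq hs]
      rfl
  have hset : ∀ n, 0 ≤ n ∧ system X Ψ n ω ∈ {s | M.hStar s ≤ payoff s}
      ↔ 0 ≤ n ∧ system X Ψ n ω ∈ M.BStar := fun n => and_congr_right fun _ => hiff n
  classical
  simp only [Params.tauZero, hittingAfter]
  exact if_congr (exists_congr hset) (by simp only [hset]) rfl

theorem integral_stoppedPayoff_le (hM : M.IsModel x P θ₁ θ₂ X)
    (hΨ : IsPosterior P (obsFiltration X hX) θ₁ θ₂ Ψ) {σ : Ω → WithTop ℕ}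
    (hσ : IsStoppingTime (shiftFiltration (obsFiltration X hX)) σ) :
    ∫ ω, stoppedPayoff (system X Ψ) σ ω ∂P ≤ ∫ ω, valueProc M X Ψ 1 ω ∂P :=
  integral_stoppedSum_le (Y := fun n => payoffProc Ψ (n + 1))
    (W := fun n => valueProc M X Ψ (n + 1)) hσ (fun n => hΨ.integrable_valueProc hM (n + 1))
    (fun n => hΨ.integrable_payoffProc hM (n + 1)) (fun n => hΨ.ae_payoffProc_mem hM (n + 1))
    (fun n => hΨ.payoffProc_le_valueProc hM (n + 1))
    fun n _ hA => hΨ.supermartingale_valueProc hM (n + 1) hA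

theorem integral_stoppedPayoff_tauZero (hM : M.IsModel x P θ₁ θ₂ X)
    (hΨ : IsPosterior P (obsFiltration X hX) θ₁ θ₂ Ψ) :
    ∫ ω, stoppedPayoff (system X Ψ) (M.tauZero X Ψ) ω ∂P = ∫ ω, valueProc M X Ψ 1 ω ∂P := by
  have hσ := hΨ.isStoppingTime_tauZero (M := M)
  refine integral_stoppedSum_eq (Y := fun n => payoffProc Ψ (n + 1))
    (W := fun n => valueProc M X Ψ (n + 1)) hσ (fun n => hΨ.integrable_valueProc hM (n + 1))
    (fun n => hΨ.integrable_payoffProc hM (n + 1)) (fun n => hΨ.ae_payoffProc_mem hM (n + 1))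
    (fun n => hΨ.payoffProc_le_valueProc hM (n + 1))
    (fun n => hΨ.martingale_valueProc hM (n + 1) (hσ.measurableSet_gt n)
      (hΨ.ae_lt_of_lt_tauZero hM n)) (fun n => ?_)
    ((tendsto_add_atTop_iff_nat 1).2 (hΨ.tendsto_integral_valueProc hM))
  filter_upwards [hΨ.ae_le_of_tauZero_eq hM n, hΨ.payoffProc_le_valueProc (M := M) hM (n + 1)]
    with ω h h' hω
  exact h'.antisymm (h hω)

theorem success_tauStar (hM : M.IsModel x P θ₁ θ₂ X)
    (hΨ : IsPosterior P (obsFiltration X hX) θ₁ θ₂ Ψ) :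
    P.real (success θ₁ θ₂ (M.tauStar x X Ψ)) = M.V x := by
  have hzero : ∀ᵐ ω ∂P, payoffProc Ψ 0 ω = M.π * (1 - M.ρ) ∧ valueProc M X Ψ 0 ω = M.V x := by
    filter_upwards [hM.start, hΨ.ae_eq_init hM] with ω h1 h2
    refine ⟨?_, ?_⟩
    · rw [← Params.payoff_init x x, payoffProc, h2]; rfl
    · rw [valueProc, h1, h2, Params.limVal_init]
  refine hΨ.success_eq hM hΨ.isStoppingTime_tauStar (fun n => ?_) fun n => ?_
  · by_cases hV : M.V₀ x ≤ M.π * (1 - M.ρ)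
    · refine ae_of_all _ fun ω hω => ?_
      simp [Params.tauStar, hV] at hω
    · simp only [Params.tauStar, if_neg hV]
      rcases n with _ | n
      · filter_upwards [hzero] with ω ⟨h1, h2⟩ _
        rw [h1, h2, Params.V]
        exact lt_max_of_lt_right (not_le.1 hV)
      · filter_upwards [hΨ.ae_lt_of_lt_tauZero hM n] with ω h hω
        refine h ?_
        rcases h : M.tauZero X Ψ ω with _ | k
        · exact WithTop.coe_lt_top n
        · rw [h] at hω
          have hω : ((n + 1 : ℕ) : WithTop ℕ) < ((k + 1 : ℕ) : WithTop ℕ) := hω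
          exact WithTop.coe_lt_coe.2 (Nat.lt_of_succ_lt_succ (WithTop.coe_lt_coe.1 hω))
  · by_cases hV : M.V₀ x ≤ M.π * (1 - M.ρ)
    · filter_upwards [hzero] with ω ⟨h1, h2⟩ hω
      have hn : n = 0 := by simpa [Params.tauStar, hV, eq_comm] using hω
      rw [hn, h1, h2, Params.V, max_eq_left hV]
    · simp only [Params.tauStar, if_neg hV]
      rcases n with _ | n
      · refine ae_of_all _ fun ω hω => ?_
        simp at hω
      · filter_upwards [hΨ.ae_le_of_tauZero_eq hM n] with ω h hω
        refine h ?_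
        rcases h : M.tauZero X Ψ ω with _ | k
        · rw [h] at hω
          exact absurd hω.symm WithTop.coe_ne_top
        · rw [h] at hω
          have hω : ((k + 1 : ℕ) : WithTop ℕ) = ((n + 1 : ℕ) : WithTop ℕ) := hω
          exact WithTop.coe_inj.2 (Nat.succ_injective (WithTop.coe_inj.1 hω))

end IsPosterior
end TwoDisorders

theorem theorem1 {E Ω : Type*} [MeasurableSpace E] [MeasurableSpace Ω]
    (M : Params E) (x : E) (P : Measure Ω) [IsProbabilityMeasure P]
    (θ₁ θ₂ : Ω → ℕ) (X : ℕ → Ω → E) (hX : ∀ n, Measurable (X n))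
    (hM : M.IsModel x P θ₁ θ₂ X)
    (Ψ : ℕ → Ω → ℝ × ℝ × ℝ) (hΨ : IsPosterior P (obsFiltration X hX) θ₁ θ₂ Ψ) :
    -- `T` is the conditional expectation operator of the system `(X_n, X_{n+1}, Ψ_{n+1})`
    (∀ v : State E → ℝ, Measurable v → (∀ s, v s ∈ Set.Icc (0 : ℝ) 1) → ∀ n : ℕ,
      P[fun ω => v (system X Ψ (n + 1) ω) | shiftFiltration (obsFiltration X hX) n]
        =ᵐ[P] fun ω => M.T v (system X Ψ n ω)) ∧
    -- (a) the limits exist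
    (∀ s ∈ stateSpace E,
      Tendsto (fun k : ℕ => (M.Q)^[k] payoff s) atTop (𝓝 (M.hStar s)) ∧
      Tendsto (fun k : ℕ => M.R k s) atTop (𝓝 (M.RStar s)) ∧
      Tendsto (fun k : ℕ => M.S k s) atTop (𝓝 (M.SStar s))) ∧
    -- (a) the two descriptions of the stopping sets
    (∀ k : ℕ, {s ∈ stateSpace E | M.T ((M.Q)^[k] payoff) s ≤ payoff s} = M.stopSet k) ∧
    {s ∈ stateSpace E | M.hStar s ≤ payoff s} = M.BStar ∧
    (hittingAfter (system X Ψ) {s | M.hStar s ≤ payoff s} 0 =ᵐ[P] M.tauZero X Ψ) ∧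
    -- (a) optimality of the first entry time into `B*` for the Markov system
    IsStoppingTime (shiftFiltration (obsFiltration X hX)) (M.tauZero X Ψ) ∧
    (∀ σ : Ω → WithTop ℕ, IsStoppingTime (shiftFiltration (obsFiltration X hX)) σ →
      ∫ ω, stoppedPayoff (system X Ψ) σ ω ∂P
        ≤ ∫ ω, stoppedPayoff (system X Ψ) (M.tauZero X Ψ) ω ∂P) ∧
    -- (b) the optimal value and the optimal time for the observed sequence
    IsGreatest {c : ℝ | ∃ τ : Ω → WithTop ℕ, IsStoppingTime (obsFiltration X hX) τ ∧
      c = P.real (success θ₁ θ₂ τ)} (M.V x) ∧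
    IsStoppingTime (obsFiltration X hX) (M.tauStar x X Ψ) ∧
    P.real (success θ₁ θ₂ (M.tauStar x X Ψ)) = M.V x := by
  refine ⟨fun v hv hv01 n => hΨ.condExp_system hM hv hv01 n,
    fun s hs => ⟨?_, Params.tendsto_R s, Params.tendsto_S s⟩, fun k => ?_, ?_,
    hΨ.hittingAfter_hStar_eq hM, hΨ.isStoppingTime_tauZero, fun σ hσ => ?_,
    ⟨⟨M.tauStar x X Ψ, hΨ.isStoppingTime_tauStar, (hΨ.success_tauStar hM).symm⟩, ?_⟩,
    hΨ.isStoppingTime_tauStar, hΨ.success_tauStar hM⟩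
  · rw [Params.hStar_eq hs]
    exact Params.tendsto_iterate_Q hs
  · ext s
    refine Iff.trans ?_ Params.mem_stopRegion.symm
    exact and_congr_right fun hs => by rw [Params.T_iterate_Q_payoff k hs]
  · ext s
    constructor
    · rintro ⟨hs, h⟩
      rw [Params.hStar_eq hs] at h
      exact (Params.mem_BStar hs).2 h
    · intro h
      have hs : s ∈ stateSpace E := h.1
      refine ⟨hs, ?_⟩
      rw [Params.hStar_eq hs]
      exact (Params.mem_BStar hs).1 h
  · rw [hΨ.integral_stoppedPayoff_tauZero hM]
    exact hΨ.integral_stoppedPayoff_le hM hσ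
  · rintro _ ⟨τ, hτ, rfl⟩
    exact hΨ.success_le hM hτ
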